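/- Fix a prime $p$, a real number $\lambda\ge 0$ and an integer $h\ge\lfloor\lambda\rfloor$. **Galois groups.** Let either (local case) $K$ be a finite extension of $\mathbf{Q}_p$ and $\Omega=\overline K$, or (global case) $K$ be a number field and $\Omega=K^S$ the maximal extension of $K$ unramified outside a finite set $S$ of places containing all infinite places and all places above $p$. Put $G=\mathrm{Gal}(\Omega/K)$, $K_\infty=K(\mu_{p^\infty})$, $H=\mathrm{Gal}(\Omega/K_\infty)$, let $\chi:G\to\mathbf{Z}_p^\times$ be the cyclotomic character, identify $\Gamma=G/H$ with its image under $\chi$ in $\mathbf{Z}_p^\times$, and let $\Gamma_n=\{\gamma\in\Gamma:\chi(\gamma)\equiv 1 \bmod p^n\}$. **Coefficients.** Let $A$ be a commutative Noetherian Banach algebra over $\mathbf{Q}_p$, and $M$ a finite free $A$-module with a norm making it a Banach $A$-module (all norms non-archimedean) and a jointly continuous $A$-linear action of $G$. Let $B\ge 0$ be a constant with $\|gm\|\le B\|m\|$ for all $g\in G$, $m\in M$ (such a $B$ always exists, and $B=1$ works if the norm is $G$-invariant). **Distributions.** Let $C_\lambda(\mathbf{Z}_p,\mathbf{Q}_p)$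 be the space of continuous functions $f=\sum_n b_n p^{\lfloor\lambda\ell(n)\rfloor}\binom{x}{n}$ with $b_n\in\mathbf{Q}_p$, $b_n\to 0$, where $\ell(n)$ is the least integer $L\ge 0$ with $p^L>n$, with norm $\sup_n|b_n|$. Let $D_\lambda(\Gamma,M)$ be the space of continuous linear maps $\mu: C_\lambda(\mathbf{Z}_p,\mathbf{Q}_p)\to M$, $f\mapsto\int f\,d\mu$, that are supported in $\Gamma$ (that is, vanish on every $f$ with $f|_\Gamma=0$), with the topology of pointwise convergence and the $G$-action $\int f(x)\,d(g\mu)(x)=g\left(\int f(\chi(g)^{-1}x)\,d\mu(x)\right)$. Let $\|\mu\|_\lambda$ be its operator norm as a functional on the subspace of those $f\in C_\lambda(\mathbf{Z}_p,\mathbf{Q}_p)$ that vanish outside $\Gamma$, and $\|\mu\|'_\lambda$ its operator norm on all of $C_\lambda(\mathbf{Z}_p,\mathbf{Q}_p)$. **Cohomology.** For $X=M$ or $X=D_\lambda(\Gamma,M)$, $H^1(K_\infty,X)$ is the group of continuous $1$-cocycles $H\to X$ modulo coboundaries, with its action of $\Gamma=G/H$; a norm on $X$ gives the seminorm of a class,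 the infimum over its cocycles $z$ of $\sup_{g\in H}\|z(g)\|$. **Statement.** There are a constant $D$ depending only on $p,\lambda,h$, and a constant $D'_\Gamma$ depending only on $p,\lambda,h$ and the subgroup $\Gamma\subseteq\mathbf{Z}_p^\times$, such that the following holds for all $K$, $\Omega$, $A$, $M$, $B$ as above. Suppose given $x_{n,j}\in H^1(K_\infty,M)$ for $n\ge 0$ and $0\le j\le h$, on which each $\gamma\in\Gamma_n$ acts as multiplication by $\chi(\gamma)^j$, such that * $\sum_{\gamma\in\Gamma_n/\Gamma_{n+1}}\chi(\gamma)^{-j}\,\gamma\cdot x_{n+1,j}=x_{n,j}$ for all $n\ge 0$ and $0\le j\le h$; * there is a constant $C\ge 0$ with $\left\|p^{-hn}\sum_{j=0}^h(-1)^j\binom hj x_{n,j}\right\|\le C\,p^{\lfloor\lambda n\rfloor}$ for all $n\ge 0$. Then there is a unique $\mu\in H^1(K_\infty,D_\lambda(\Gamma,M))^\Gamma$ with $x_{n,j}=\int_{\Gamma_n}\chi^j\,\mu$ for all $n\ge 0$ and $0\le j\le h$. Moreover $\|\mu\|_\lambda\le B\,C\,D$ and $\|\mu\|'_\lambda\le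 B\,C\,D'_\Gamma$. In particular $\|\mu\|_\lambda\le C\,D$ if the norm of $M$ is $G$-invariant. -/

import Mathlib

open Filter Topology
open scoped ZeroAtInfty NNReal ENNReal NumberField

namespace PadicIwasawa

section OrderFunctions

variable (p : ℕ) [Fact p.Prime] (lam : ℝ)

instance isBoundedSMul_padicInt : IsBoundedSMul ℤ_[p] ℚ_[p] :=
  IsBoundedSMul.of_norm_smul_le fun r x => by
    rw [Algebra.smul_def, norm_mul]
    rfl

/-- `ell p n` is the smallest integer `L ≥ 0` such that `p ^ L > n`. -/
def ell (n : ℕ) : ℕ := Nat.clog p (n + 1)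

theorem ell_le_iff (n L : ℕ) : ell p n ≤ L ↔ n < p ^ L := by
  rw [ell, Nat.clog_le_iff_le_pow (Fact.out : p.Prime).one_lt, Nat.succ_le_iff]

/-- The coefficient of `f` along the function `p ^ ⌊lam * ell n⌋ * binom(x, n)`: the `n`-th Mahler
coefficient `Δ^n f (0)` divided by `p ^ ⌊lam * ell n⌋`. -/
noncomputable def mahlerCoeff (f : ℤ_[p] → ℚ_[p]) (n : ℕ) : ℚ_[p] :=
  (fwdDiff (1 : ℤ_[p]))^[n] f 0 / (p : ℚ_[p]) ^ ⌊lam * ell p n⌋₊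

theorem mahlerCoeff_add (f g : ℤ_[p] → ℚ_[p]) (n : ℕ) :
    mahlerCoeff p lam (f + g) n = mahlerCoeff p lam f n + mahlerCoeff p lam g n := by
  simp only [mahlerCoeff, fwdDiff_iter_add, Pi.add_apply, add_div]

theorem mahlerCoeff_smul (c : ℚ_[p]) (f : ℤ_[p] → ℚ_[p]) (n : ℕ) :
    mahlerCoeff p lam (c • f) n = c * mahlerCoeff p lam f n := by
  simp only [mahlerCoeff, fwdDiff_iter_const_smul, Pi.smul_apply, smul_eq_mul, mul_div_assoc]

/-- The functions of order `lam` on `ℤ_[p]`: those continuous functions whose coefficients along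
`p ^ ⌊lam * ell n⌋ * binom(x, n)` tend to zero. -/
noncomputable def orderSubmodule : Submodule ℚ_[p] C(ℤ_[p], ℚ_[p]) where
  carrier := {f | Tendsto (mahlerCoeff p lam f) atTop (𝓝 0)}
  zero_mem' := by
    have : mahlerCoeff p lam (0 : C(ℤ_[p], ℚ_[p])) = fun _ => 0 := by
      funext n
      have := mahlerCoeff_smul p lam 0 0 n
      simpa using this
    simp only [Set.mem_ofPred_eq, this]
    exact tendsto_const_nhds
  add_mem' := by
    intro f g hf hg
    have : mahlerCoeff p lam (f + g : C(ℤ_[p], ℚ_[p])) =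
        fun n => mahlerCoeff p lam f n + mahlerCoeff p lam g n := by
      funext n
      exact mahlerCoeff_add p lam f g n
    simp only [Set.mem_ofPred_eq, this]
    simpa using hf.add hg
  smul_mem' := by
    intro c f hf
    have : mahlerCoeff p lam (c • f : C(ℤ_[p], ℚ_[p])) =
        fun n => c * mahlerCoeff p lam f n := by
      funext n
      exact mahlerCoeff_smul p lam c f n
    simp only [Set.mem_ofPred_eq, this]
    simpa using hf.const_mul c

/-- The Banach space `C_lam(ℤ_p, ℚ_p)` of functions of order `lam`. -/
def OrderFun : Type := ↥(orderSubmodule p lam)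

noncomputable instance : AddCommGroup (OrderFun p lam) :=
  inferInstanceAs (AddCommGroup ↥(orderSubmodule p lam))

noncomputable instance : Module ℚ_[p] (OrderFun p lam) :=
  inferInstanceAs (Module ℚ_[p] ↥(orderSubmodule p lam))

noncomputable instance : FunLike (OrderFun p lam) ℤ_[p] ℚ_[p] where
  coe f := (f.1 : ℤ_[p] → ℚ_[p])
  coe_injective _ _ h := Subtype.ext (DFunLike.coe_injective h)

/-- The null sequence of coefficients of a function of order `lam` along
`p ^ ⌊lam * ell n⌋ * binom(x, n)`. -/
noncomputable def coeffMap : OrderFun p lam →ₗ[ℚ_[p]] C₀(ℕ, ℚ_[p]) where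
  toFun f := ⟨⟨mahlerCoeff p lam f, continuous_of_discreteTopology⟩, by
    rw [cocompact_eq_atTop]; exact f.2⟩
  map_add' f g := by
    ext n
    exact mahlerCoeff_add p lam f g n
  map_smul' c f := by
    ext n
    exact mahlerCoeff_smul p lam c f n

theorem coeffMap_apply (f : OrderFun p lam) (n : ℕ) :
    coeffMap p lam f n = mahlerCoeff p lam f n := rfl

theorem coeffMap_injective : Function.Injective (coeffMap p lam) := by
  intro f g h
  refine Subtype.ext ((PadicInt.mahlerEquiv ℚ_[p]).injective ?_)
  ext n
  have h1 : mahlerCoeff p lam f n = mahlerCoeff p lam g n := DFunLike.congr_fun h n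
  have hp : (p : ℚ_[p]) ≠ 0 := by exact_mod_cast (Fact.out : p.Prime).ne_zero
  simp only [mahlerCoeff] at h1
  exact (div_left_inj' (pow_ne_zero _ hp)).1 h1

/-- The norm of `C_lam(ℤ_p, ℚ_p)`: the supremum of the absolute values of the coefficients along
`p ^ ⌊lam * ell n⌋ * binom(x, n)`, which thus form an orthonormal basis. -/
noncomputable instance : NormedAddCommGroup (OrderFun p lam) :=
  NormedAddCommGroup.induced _ _ (coeffMap p lam) (coeffMap_injective p lam)

theorem norm_def (f : OrderFun p lam) : ‖f‖ = ‖coeffMap p lam f‖ := rfl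

noncomputable instance : NormedSpace ℚ_[p] (OrderFun p lam) :=
  NormedSpace.induced _ _ _ (coeffMap p lam)

theorem norm_le_iff (f : OrderFun p lam) {c : ℝ} (hc : 0 ≤ c) :
    ‖f‖ ≤ c ↔ ∀ n, ‖mahlerCoeff p lam f n‖ ≤ c := by
  rw [norm_def, ← ZeroAtInftyContinuousMap.norm_toBCF_eq_norm,
    BoundedContinuousFunction.norm_le hc]
  rfl

theorem norm_mahlerCoeff_le (f : OrderFun p lam) (n : ℕ) : ‖mahlerCoeff p lam f n‖ ≤ ‖f‖ :=
  (norm_le_iff p lam f (norm_nonneg f)).1 le_rfl n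

end OrderFunctions
section Dilation
variable (p : ℕ) [Fact p.Prime] {lam : ℝ}

theorem ell_mono (p : ℕ) : Monotone (ell p) := fun _ _ h => Nat.clog_mono_right p (Nat.succ_le_succ h)

/-- `f(u x)` for a continuous function `f` on `ℤ_[p]`. -/
noncomputable def dilate (u : ℤ_[p]) (f : C(ℤ_[p], ℚ_[p])) : C(ℤ_[p], ℚ_[p]) :=
  f.comp ⟨fun x => u * x, by fun_prop⟩

theorem dilate_apply (u : ℤ_[p]) (f : C(ℤ_[p], ℚ_[p])) (x : ℤ_[p]) :
    dilate p u f x = f (u * x) := rfl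

/-- `binom(u x, k)` is a polynomial of degree at most `k` in `x`. -/
theorem fwdDiff_choose_dilate (u : ℤ_[p]) {k n : ℕ} (h : k < n) :
    (fwdDiff (1 : ℤ_[p]))^[n] (fun x : ℤ_[p] => Ring.choose (u * x) k) = 0 := by
  have hk : (k.factorial : ℤ_[p]) ≠ 0 := Nat.cast_ne_zero.2 k.factorial_ne_zero
  set P : Polynomial ℤ_[p] := (descPochhammer ℤ_[p] k).comp (Polynomial.C u * Polynomial.X)
  have hP : P.natDegree < n := by
    refine lt_of_le_of_lt (Polynomial.natDegree_comp_le) ?_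
    rw [descPochhammer_natDegree]
    refine lt_of_le_of_lt ?_ h
    calc k * _ ≤ k * 1 := Nat.mul_le_mul_left k (Polynomial.natDegree_C_mul_le _ _ |>.trans Polynomial.natDegree_X_le)
      _ = k := mul_one k
  have h1 : (k.factorial : ℤ_[p]) • (fun x : ℤ_[p] => Ring.choose (u * x) k) = P.eval := by
    funext x
    have := Ring.descPochhammer_eq_factorial_smul_choose (u * x) k
    simp only [Pi.smul_apply, smul_eq_mul, P, Polynomial.eval_comp, Polynomial.eval_mul,
      Polynomial.eval_C, Polynomial.eval_X]
    rw [nsmul_eq_mul] at this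
    rw [← this]
    rw [← descPochhammer_map (Int.castRingHom ℤ_[p]),
      Polynomial.eval_map, ← Polynomial.aeval_eq_smeval]
    rfl
  have h2 := Polynomial.fwdDiff_iter_eq_zero_of_degree_lt hP
  rw [← h1, fwdDiff_iter_const_smul] at h2
  exact (smul_eq_zero.1 h2).resolve_left hk

theorem norm_fwdDiff_dilate_le (u : ℤ_[p]) (f : C(ℤ_[p], ℚ_[p])) (n : ℕ) (c : ℝ)
    (hc0 : 0 ≤ c) (hc : ∀ k, n ≤ k → ‖(fwdDiff (1 : ℤ_[p]))^[k] f 0‖ ≤ c) :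
    ‖(fwdDiff (1 : ℤ_[p]))^[n] (dilate p u f) 0‖ ≤ c := by
  have hs := PadicInt.hasSum_mahler f
  have hL : Continuous fun g : C(ℤ_[p], ℚ_[p]) =>
      (fwdDiff (1 : ℤ_[p]))^[n] (dilate p u g) 0 := by
    simp only [fwdDiff_iter_eq_sum_shift, dilate_apply]
    fun_prop
  let L : C(ℤ_[p], ℚ_[p]) →+ ℚ_[p] :=
    { toFun := fun g => (fwdDiff (1 : ℤ_[p]))^[n] (dilate p u g) 0
      map_zero' := by simp [fwdDiff_iter_eq_sum_shift, dilate_apply]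
      map_add' := fun g g' => by
        simp [fwdDiff_iter_eq_sum_shift, dilate_apply, Finset.sum_add_distrib] }
  have hs' := hs.map L hL
  change ‖L f‖ ≤ c
  rw [← hs'.tsum_eq]
  refine IsUltrametricDist.norm_tsum_le_of_forall_le_of_nonneg hc0 fun k => ?_
  have hterm : L (PadicInt.mahlerTerm ((fwdDiff (1 : ℤ_[p]))^[k] f 0) k) =
      ((fwdDiff (1 : ℤ_[p]))^[n] (fun x : ℤ_[p] => Ring.choose (u * x) k) 0) •
        (fwdDiff (1 : ℤ_[p]))^[k] f 0 := by
    simp only [L, AddMonoidHom.coe_mk, ZeroHom.coe_mk, fwdDiff_iter_eq_sum_shift, dilate_apply,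
      PadicInt.mahlerTerm_apply, mahler_apply, Finset.sum_smul, smul_assoc]
  simp only [Function.comp_apply]
  rw [hterm]
  rcases lt_or_ge k n with hkn | hkn
  · rw [fwdDiff_choose_dilate p u hkn]
    simpa using hc0
  · refine (norm_smul_le _ _).trans ?_
    calc _ ≤ 1 * c := mul_le_mul (PadicInt.norm_le_one _) (hc k hkn) (norm_nonneg _) zero_le_one
      _ = c := one_mul c

theorem norm_mahlerCoeff (lam : ℝ) (f : ℤ_[p] → ℚ_[p]) (n : ℕ) :
    ‖(fwdDiff (1 : ℤ_[p]))^[n] f 0‖ =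
      ‖mahlerCoeff p lam f n‖ * ‖(p : ℚ_[p])‖ ^ ⌊lam * ell p n⌋₊ := by
  have hp : (p : ℚ_[p]) ≠ 0 := by exact_mod_cast (Fact.out : p.Prime).ne_zero
  rw [mahlerCoeff, norm_div, norm_pow, div_mul_cancel₀]
  exact pow_ne_zero _ (norm_ne_zero_iff.2 hp)

theorem floor_ell_mono (p : ℕ) (lam : ℝ) : Monotone fun n => ⌊lam * ell p n⌋₊ := by
  intro a b hab
  rcases le_or_gt 0 lam with h | h
  · exact Nat.floor_mono (mul_le_mul_of_nonneg_left (by exact_mod_cast ell_mono p hab) h)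
  · have : ⌊lam * ell p a⌋₊ = 0 :=
      Nat.floor_of_nonpos (mul_nonpos_of_nonpos_of_nonneg h.le (Nat.cast_nonneg _))
    simp [this]

theorem norm_mahlerCoeff_dilate_le (u : ℤ_[p]) (f : C(ℤ_[p], ℚ_[p])) (n : ℕ) (c : ℝ)
    (hc0 : 0 ≤ c) (hc : ∀ k, n ≤ k → ‖mahlerCoeff p lam f k‖ ≤ c) :
    ‖mahlerCoeff p lam (dilate p u f) n‖ ≤ c := by
  have hp : (p : ℚ_[p]) ≠ 0 := by exact_mod_cast (Fact.out : p.Prime).ne_zero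
  have hpos : 0 < ‖(p : ℚ_[p])‖ := norm_pos_iff.2 hp
  have hle : ‖(p : ℚ_[p])‖ ≤ 1 := Padic.norm_p_lt_one.le
  have h := norm_fwdDiff_dilate_le p u f n (c * ‖(p : ℚ_[p])‖ ^ ⌊lam * ell p n⌋₊)
    (by positivity) (fun k hk => by
      rw [norm_mahlerCoeff p lam]
      exact mul_le_mul (hc k hk) (pow_le_pow_of_le_one hpos.le hle (floor_ell_mono p lam hk))
        (by positivity) hc0)
  rw [norm_mahlerCoeff p lam] at h
  exact le_of_mul_le_mul_right h (by positivity)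

/-- If `f` is of order `lam`, so is `f(u x)`. -/
theorem dilate_mem (u : ℤ_[p]) {f : C(ℤ_[p], ℚ_[p])} (hf : f ∈ orderSubmodule p lam) :
    dilate p u f ∈ orderSubmodule p lam := by
  change Tendsto _ _ _ at hf ⊢
  rw [Metric.tendsto_atTop] at hf ⊢
  intro ε hε
  obtain ⟨N, hN⟩ := hf (ε / 2) (by positivity)
  refine ⟨N, fun n hn => ?_⟩
  rw [dist_zero_right]
  refine lt_of_le_of_lt (norm_mahlerCoeff_dilate_le p u f n (ε / 2) (by positivity)
    fun k hk => ?_) (half_lt_self hε)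
  simpa using (hN k (hn.trans hk)).le

variable (lam) in
/-- The continuous linear map `f(x) ↦ f(u x)` on `C_lam(ℤ_p, ℚ_p)`. -/
noncomputable def dilateL (u : ℤ_[p]) : OrderFun p lam →L[ℚ_[p]] OrderFun p lam :=
  LinearMap.mkContinuous
    { toFun := fun f => ⟨dilate p u f.1, dilate_mem p u f.2⟩
      map_add' := fun _ _ => rfl
      map_smul' := fun _ _ => rfl } 1 (fun f => by
    rw [one_mul, norm_le_iff p lam _ (norm_nonneg f)]
    exact fun n => norm_mahlerCoeff_dilate_le p u f.1 n _ (norm_nonneg f)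
      fun k _ => norm_mahlerCoeff_le p lam f k)

@[simp] theorem dilateL_apply (u : ℤ_[p]) (f : OrderFun p lam) (x : ℤ_[p]) :
    dilateL p lam u f x = f (u * x) := rfl

variable {p} in
theorem OrderFun.ext {f g : OrderFun p lam} (h : ∀ x, f x = g x) : f = g := DFunLike.ext f g h

theorem dilateL_one (f : OrderFun p lam) : dilateL p lam 1 f = f :=
  OrderFun.ext fun x => by simp

theorem dilateL_dilateL (u v : ℤ_[p]) (f : OrderFun p lam) :
    dilateL p lam u (dilateL p lam v f) = dilateL p lam (v * u) f :=
  OrderFun.ext fun x => by simp [mul_assoc]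

end Dilation

section LocallyPolynomial
variable (p : ℕ) [Fact p.Prime]

/-- `f` has Mahler coefficients decaying geometrically. -/
def MahlerDecay (f : ℤ_[p] → ℚ_[p]) : Prop :=
  ∃ c : ℝ, 0 ≤ c ∧ ∃ t : ℕ, ∀ s n : ℕ, ‖(fwdDiff (1 : ℤ_[p]))^[n + s * p ^ t] f 0‖ ≤ c / p ^ s

theorem fwdDiff_id_mul (f : ℤ_[p] → ℚ_[p]) (m : ℕ) (y : ℤ_[p]) :
    (fwdDiff (1 : ℤ_[p]))^[m + 1] (fun x => (x : ℚ_[p]) * f x) y =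
      y * (fwdDiff (1 : ℤ_[p]))^[m + 1] f y +
        (m + 1) * (fwdDiff (1 : ℤ_[p]))^[m] f (y + 1) := by
  induction m generalizing y with
  | zero => simp [fwdDiff]; ring
  | succ m ih =>
    rw [Function.iterate_succ_apply', fwdDiff, ih, ih, Function.iterate_succ_apply' _ (m + 1) f,
      fwdDiff, Function.iterate_succ_apply' _ m f, fwdDiff, fwdDiff]
    push_cast
    ring

theorem MahlerDecay.id_mul {f : ℤ_[p] → ℚ_[p]} (hf : MahlerDecay p f) :
    MahlerDecay p (fun x => (x : ℚ_[p]) * f x) := by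
  obtain ⟨c, hc, t, h⟩ := hf
  have hp0 : 0 < p := (Fact.out : p.Prime).pos
  have hp1 : (1 : ℝ) ≤ p := by exact_mod_cast hp0
  have hq : 0 < p ^ t := pow_pos hp0 t
  have key : ∀ m : ℕ, ∀ b : ℝ, ‖(fwdDiff (1 : ℤ_[p]))^[m] f 0‖ ≤ b →
      ‖(fwdDiff (1 : ℤ_[p]))^[m + 1] f 0‖ ≤ b →
      ‖(fwdDiff (1 : ℤ_[p]))^[m + 1] (fun x => (x : ℚ_[p]) * f x) 0‖ ≤ b := by
    intro m b h1 h2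
    have hb : 0 ≤ b := (norm_nonneg _).trans h1
    have e : (fwdDiff (1 : ℤ_[p]))^[m] f (0 + 1) =
        (fwdDiff (1 : ℤ_[p]))^[m + 1] f 0 + (fwdDiff (1 : ℤ_[p]))^[m] f 0 := by
      rw [Function.iterate_succ_apply', fwdDiff]; ring
    rw [fwdDiff_id_mul, e]
    simp only [PadicInt.coe_zero, zero_mul, zero_add]
    rw [norm_mul]
    have h3 : ‖((m : ℚ_[p]) + 1)‖ ≤ 1 := by
      have := PadicInt.norm_le_one ((m + 1 : ℕ) : ℤ_[p])
      rw [PadicInt.norm_def] at this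
      simpa using this
    calc _ ≤ 1 * b := mul_le_mul h3
          ((IsUltrametricDist.norm_add_le_max _ _).trans (max_le h2 h1)) (norm_nonneg _) zero_le_one
      _ = b := one_mul b
  refine ⟨c * p, by positivity, t, fun s n => ?_⟩
  have mono : ∀ s : ℕ, c / (p : ℝ) ^ s ≤ c * p / p ^ s := fun s => by
    gcongr
    exact le_mul_of_one_le_right hc hp1
  have step : ∀ s : ℕ, c / (p : ℝ) ^ s = c * p / p ^ (s + 1) := fun s => by
    rw [pow_succ]
    field_simp
  rcases n with _ | n
  · rcases s with _ | s
    · simp only [zero_mul, Nat.add_zero, Function.iterate_zero, id_eq, PadicInt.coe_zero,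
        norm_zero]
      positivity
    · have e : 0 + (s + 1) * p ^ t = (p ^ t - 1 + s * p ^ t) + 1 := by
        rw [add_mul]; omega
      rw [e]
      refine key _ _ ?_ ?_
      · rw [← step]; exact h s _
      · have e' : (p ^ t - 1 + s * p ^ t) + 1 = 0 + (s + 1) * p ^ t := e.symm
        rw [e']
        exact (h (s + 1) 0).trans (mono _)
  · have e : n + 1 + s * p ^ t = (n + s * p ^ t) + 1 := by ring
    rw [e]
    refine key _ _ ((h s n).trans (mono s)) ?_
    rw [← e]
    exact (h s (n + 1)).trans (mono s)

/-- A continuous function with geometrically decaying Mahler coefficients is of every order. -/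
theorem MahlerDecay.mem (lam : ℝ) {f : C(ℤ_[p], ℚ_[p])} (hf : MahlerDecay p f) :
    f ∈ orderSubmodule p lam := by
  obtain ⟨c, hc, t, h⟩ := hf
  have hp0 : 0 < p := (Fact.out : p.Prime).pos
  have hp1 : (1 : ℝ) < p := by exact_mod_cast (Fact.out : p.Prime).one_lt
  have hq : 0 < p ^ t := pow_pos hp0 t
  change Tendsto _ _ _
  set k : ℕ := ⌈lam⌉₊
  have bound : ∀ n, ‖mahlerCoeff p lam f n‖ ≤
      (c * (p * p ^ t) ^ k) * (((n / p ^ t + 1 : ℕ) : ℝ) ^ k / (p : ℝ) ^ (n / p ^ t + 1) * p) := by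
    intro n
    have e0 : n % p ^ t + n / p ^ t * p ^ t = n := Nat.mod_add_div' n (p ^ t)
    have b1 : ‖(fwdDiff (1 : ℤ_[p]))^[n] f 0‖ ≤ c / (p : ℝ) ^ (n / p ^ t) := by
      have := h (n / p ^ t) (n % p ^ t)
      rwa [e0] at this
    have b2 : p ^ ell p n ≤ p * p ^ t * (n / p ^ t + 1) := by
      have h1 : n + 1 ≤ p ^ t * (n / p ^ t + 1) := Nat.lt_mul_div_succ n hq
      have h2 : p ^ ell p n ≤ p * (n + 1) := by
        rcases Nat.eq_zero_or_pos (ell p n) with hz | hz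
        · rw [hz, pow_zero]
          exact Nat.mul_pos hp0 n.succ_pos
        · have h3 : ¬ ell p n ≤ ell p n - 1 := by omega
          rw [ell_le_iff, not_lt] at h3
          calc p ^ ell p n = p * p ^ (ell p n - 1) := by
                rw [← pow_succ', Nat.sub_add_cancel hz]
            _ ≤ p * (n + 1) := Nat.mul_le_mul_left p (h3.trans n.le_succ)
      calc _ ≤ p * (n + 1) := h2
        _ ≤ p * (p ^ t * (n / p ^ t + 1)) := Nat.mul_le_mul_left p h1
        _ = _ := (mul_assoc _ _ _).symm
    have b3 : ⌊lam * ell p n⌋₊ ≤ ell p n * k := by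
      refine Nat.floor_le_of_le ?_
      push_cast
      rw [mul_comm]
      exact mul_le_mul_of_nonneg_left (Nat.le_ceil lam) (Nat.cast_nonneg _)
    have b4 : (p : ℝ) ^ ⌊lam * ell p n⌋₊ ≤ ((p * p ^ t) * ((n / p ^ t + 1 : ℕ) : ℝ)) ^ k := by
      calc (p : ℝ) ^ ⌊lam * ell p n⌋₊ ≤ (p : ℝ) ^ (ell p n * k) := pow_le_pow_right₀ hp1.le b3
        _ = ((p : ℝ) ^ ell p n) ^ k := pow_mul _ _ _
        _ ≤ _ := pow_le_pow_left₀ (by positivity) (by exact_mod_cast b2) k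
    have b5 : ‖mahlerCoeff p lam f n‖ =
        ‖(fwdDiff (1 : ℤ_[p]))^[n] f 0‖ * (p : ℝ) ^ ⌊lam * ell p n⌋₊ := by
      rw [mahlerCoeff, norm_div, norm_pow, Padic.norm_p, inv_pow, div_inv_eq_mul]
    rw [b5]
    calc _ ≤ c / (p : ℝ) ^ (n / p ^ t) * ((p * p ^ t) * ((n / p ^ t + 1 : ℕ) : ℝ)) ^ k :=
          mul_le_mul b1 b4 (by positivity) (by positivity)
      _ = _ := by
          rw [mul_pow, pow_succ]
          field_simp
  refine squeeze_zero_norm bound ?_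
  have h1 : Tendsto (fun s : ℕ => (s : ℝ) ^ k / (p : ℝ) ^ s) atTop (𝓝 0) :=
    tendsto_pow_const_div_const_pow_of_one_lt k hp1
  have h2 : Tendsto (fun n : ℕ => n / p ^ t + 1) atTop atTop :=
    (tendsto_add_atTop_nat 1).comp (Nat.tendsto_div_const_atTop hq.ne')
  simpa using ((h1.comp h2).mul_const (p : ℝ)).const_mul (c * (p * p ^ t) ^ k)

/-- The function `x ^ j` on `1 + p ^ n ℤ_p`, extended by zero to `ℤ_p`. -/
noncomputable def ballPowFun (n j : ℕ) : ℤ_[p] → ℚ_[p] :=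
  Set.indicator {x : ℤ_[p] | (p : ℤ_[p]) ^ n ∣ x - 1} fun x => (x : ℚ_[p]) ^ j

theorem ballPowFun_eq_of_dvd (n : ℕ) {x y : ℤ_[p]} (h : ‖x - y‖ ≤ (p : ℝ) ^ (-n : ℤ)) :
    ballPowFun p n 0 x = ballPowFun p n 0 y := by
  rw [PadicInt.norm_le_pow_iff_mem_span_pow, Ideal.mem_span_singleton] at h
  have : (p : ℤ_[p]) ^ n ∣ x - 1 ↔ (p : ℤ_[p]) ^ n ∣ y - 1 := by
    rw [← sub_add_sub_cancel x y 1]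
    exact dvd_add_right h
  by_cases hx : (p : ℤ_[p]) ^ n ∣ x - 1
  · simp [ballPowFun, Set.indicator, hx, this.1 hx]
  · simp [ballPowFun, Set.indicator, hx, mt this.2 hx]

theorem continuous_ballPowFun (n j : ℕ) : Continuous (ballPowFun p n j) := by
  have h0 : Continuous (ballPowFun p n 0) := by
    refine IsLocallyConstant.continuous ((IsLocallyConstant.iff_eventually_eq _).2 fun x => ?_)
    have hpos : (0 : ℝ) < (p : ℝ) ^ (-n : ℤ) :=
      zpow_pos (by exact_mod_cast (Fact.out : p.Prime).pos) _
    filter_upwards [Metric.closedBall_mem_nhds x hpos] with y hy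
    exact ballPowFun_eq_of_dvd p n (by simpa [dist_eq_norm] using hy)
  have : ballPowFun p n j = fun x : ℤ_[p] => (x : ℚ_[p]) ^ j * ballPowFun p n 0 x := by
    funext x
    by_cases hx : (p : ℤ_[p]) ^ n ∣ x - 1 <;> simp [ballPowFun, Set.indicator, hx]
  rw [this]
  exact (continuous_subtype_val.pow j).mul h0

theorem mahlerDecay_ballPowFun (n j : ℕ) : MahlerDecay p (ballPowFun p n j) := by
  induction j with
  | zero =>
    let F : C(ℤ_[p], ℚ_[p]) := ⟨_, continuous_ballPowFun p n 0⟩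
    refine ⟨‖F‖, norm_nonneg _, n, fun s m => ?_⟩
    refine PadicInt.fwdDiff_iter_le_of_forall_le (f := F) (fun x y hxy => ?_) m
    have : F x = F y := ballPowFun_eq_of_dvd p n hxy
    rw [this, sub_self, norm_zero]
    positivity
  | succ j ih =>
    convert ih.id_mul using 1
    funext x
    by_cases hx : (p : ℤ_[p]) ^ n ∣ x - 1 <;> simp [ballPowFun, Set.indicator, hx, pow_succ']

/-- The function `x ^ j` on `1 + p ^ n ℤ_p`, extended by zero, as an element of
`C_lam(ℤ_p, ℚ_p)`. -/
noncomputable def ballPow (lam : ℝ) (n j : ℕ) : OrderFun p lam :=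
  ⟨⟨_, continuous_ballPowFun p n j⟩, MahlerDecay.mem p lam (mahlerDecay_ballPowFun p n j)⟩

end LocallyPolynomial
section ContinuousCohomology

variable (R H X : Type*) [CommRing R] [Group H] [TopologicalSpace H] [AddCommGroup X]
  [TopologicalSpace X] [IsTopologicalAddGroup X] [Module R X] [ContinuousConstSMul R X]
  [DistribMulAction H X] [SMulCommClass H R X]

/-- Continuous 1-cocycles `H → X`. -/
def Z1 : Submodule R (H → X) where
  carrier := {z | Continuous z ∧ ∀ g h, z (g * h) = z g + g • z h}
  zero_mem' := ⟨continuous_const, fun g h => by simp⟩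
  add_mem' := by
    rintro y z ⟨hy, hy'⟩ ⟨hz, hz'⟩
    refine ⟨hy.add hz, fun g h => ?_⟩
    simp only [Pi.add_apply, hy', hz', smul_add]
    abel
  smul_mem' := by
    rintro c z ⟨hz, hz'⟩
    refine ⟨hz.const_smul c, fun g h => ?_⟩
    simp only [Pi.smul_apply, hz', smul_add, smul_comm g c]

/-- The 1-coboundaries `h ↦ h x - x`, inside the continuous 1-cocycles. -/
def B1 : Submodule R (Z1 R H X) where
  carrier := {z | ∃ x : X, ∀ h : H, z.1 h = h • x - x}
  zero_mem' := ⟨0, fun h => by simp⟩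
  add_mem' := by
    rintro y z ⟨a, ha⟩ ⟨b, hb⟩
    refine ⟨a + b, fun h => ?_⟩
    have : (y + z).1 h = y.1 h + z.1 h := rfl
    rw [this, ha, hb, smul_add]
    abel
  smul_mem' := by
    rintro c z ⟨a, ha⟩
    refine ⟨c • a, fun h => ?_⟩
    have : (c • z).1 h = c • z.1 h := rfl
    rw [this, ha, smul_sub, smul_comm h c]

/-- The first continuous cohomology group `H^1(H, X)`: continuous cocycles modulo coboundaries. -/
abbrev H1 : Type _ := Z1 R H X ⧸ B1 R H X

variable {R H X}

/-- The seminorm on `H^1(H, X)` induced by a (possibly infinite) seminorm `ν` on `X`: the infimum,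
over the cocycles `z` in the class, of `sup_h ν (z h)`. -/
noncomputable def H1.seminorm (ν : X → ℝ≥0∞) (c : H1 R H X) : ℝ≥0∞ :=
  ⨅ (z : Z1 R H X) (_ : (B1 R H X).mkQ z = c), ⨆ h : H, ν (z.1 h)

variable {Y : Type*} [AddCommGroup Y] [TopologicalSpace Y] [IsTopologicalAddGroup Y] [Module R Y]
  [ContinuousConstSMul R Y] [DistribMulAction H Y] [SMulCommClass H R Y]

/-- Composition of cocycles with an equivariant continuous linear map. -/
def Z1.map (φ : X →L[R] Y) (hφ : ∀ (h : H) (x : X), φ (h • x) = h • φ x) :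
    Z1 R H X →ₗ[R] Z1 R H Y where
  toFun z := ⟨fun h => φ (z.1 h), φ.continuous.comp z.2.1, fun g h => by
    beta_reduce
    rw [z.2.2, map_add, hφ]⟩
  map_add' y z := Subtype.ext (funext fun h => map_add φ (y.1 h) (z.1 h))
  map_smul' c z := Subtype.ext (funext fun h => map_smul φ c (z.1 h))

/-- The map on `H^1` induced by an equivariant continuous linear map. -/
def H1.map (φ : X →L[R] Y) (hφ : ∀ (h : H) (x : X), φ (h • x) = h • φ x) :
    H1 R H X →ₗ[R] H1 R H Y :=
  (B1 R H X).mapQ (B1 R H Y) (Z1.map φ hφ) (by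
    rintro z ⟨x, hx⟩
    refine ⟨φ x, fun h => ?_⟩
    change φ (z.1 h) = _
    rw [hx, map_sub, hφ])

end ContinuousCohomology

section Conjugation

variable {R G X : Type*} [CommRing R] [Group G] [AddCommGroup X] [DistribMulAction G X]
  (N : Subgroup G) [N.Normal]

/-- The element `g⁻¹ h g` of the normal subgroup `N`. -/
def conjElt (g : G) (h : N) : N := ⟨g⁻¹ * h * g, by
  simpa using Subgroup.Normal.conj_mem ‹N.Normal› h.1 h.2 g⁻¹⟩

theorem smul_conjElt_smul (g : G) (h : N) (x : X) : g • conjElt N g h • x = h • g • x := by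
  change g • (g⁻¹ * h * g) • x = (h : G) • g • x
  simp only [smul_smul]
  congr 1
  group

variable [TopologicalSpace G] [IsTopologicalGroup G] [TopologicalSpace X] [IsTopologicalAddGroup X]
  [Module R X] [ContinuousConstSMul R X] [SMulCommClass G R X] [ContinuousConstSMul G X]

/-- The action of `g` on cocycles: `h ↦ g z(g⁻¹ h g)`. -/
def Z1.conj (g : G) : Z1 R N X →ₗ[R] Z1 R N X where
  toFun z := ⟨fun h => g • z.1 (conjElt N g h), by
    refine (z.2.1.comp ?_).const_smul g
    exact Continuous.subtype_mk (by fun_prop) _, fun a b => by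
    have : conjElt N g (a * b) = conjElt N g a * conjElt N g b := by
      apply Subtype.ext
      simp only [conjElt, Subgroup.coe_mul]
      group
    beta_reduce
    rw [this, z.2.2, smul_add, smul_conjElt_smul]⟩
  map_add' y z := Subtype.ext (funext fun h => smul_add g _ _)
  map_smul' c z := Subtype.ext (funext fun h => smul_comm g c _)

/-- The action of `g ∈ G` on `H^1(N, X)` for a normal subgroup `N` of `G`. It is trivial for
`g ∈ N`, so that it is an action of `G / N`. -/
def H1.conj (g : G) : H1 R N X →ₗ[R] H1 R N X :=
  (B1 R N X).mapQ (B1 R N X) (Z1.conj N g) (by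
    rintro z ⟨x, hx⟩
    refine ⟨g • x, fun h => ?_⟩
    change g • z.1 (conjElt N g h) = _
    rw [hx, smul_sub, smul_conjElt_smul])

end Conjugation

section Distributions

variable (p : ℕ) [Fact p.Prime] (lam : ℝ)
  (M : Type*) [NormedAddCommGroup M] [NormedSpace ℚ_[p] M]

/-- `D_lam(U, M)`: the continuous linear maps `C_lam(ℤ_p, ℚ_p) → M` supported in `U`, with the
weak topology, that is the topology of pointwise convergence. -/
noncomputable def distributions (U : Set ℤ_[p]) :
    Submodule ℚ_[p] (OrderFun p lam →Lₚₜ[ℚ_[p]] M) where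
  carrier := {μ | ∀ f : OrderFun p lam, (∀ x ∈ U, f x = 0) → μ f = 0}
  zero_mem' := fun _ _ => rfl
  add_mem' := by
    intro μ ν hμ hν f hf
    change μ f + ν f = 0
    rw [hμ f hf, hν f hf, add_zero]
  smul_mem' := by
    intro c μ hμ f hf
    change c • μ f = 0
    rw [hμ f hf, smul_zero]

variable {p lam M}

/-- The operator norm of the restriction of a distribution to the functions of order `lam` that
vanish outside `U`. For `U = ℤ_p` it is the operator norm of the distribution. -/
noncomputable def distNorm (U : Set ℤ_[p]) (μ : OrderFun p lam →Lₚₜ[ℚ_[p]] M) : ℝ≥0∞ :=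
  ⨆ (f : OrderFun p lam) (_ : ∀ x, x ∉ U → f x = 0), ‖μ f‖ₑ / ‖f‖ₑ

variable {G : Type*} [Group G] (χ : G →* ℤ_[p]ˣ)

/-- The image `Γ` of `χ`, as a subset of `ℤ_p`. -/
def imageSet : Set ℤ_[p] := Set.range fun g : G => (χ g : ℤ_[p])

variable (lam M) in
/-- `D_lam(Γ, M)`, where `Γ` is the image of `χ` in `ℤ_p`. -/
def GammaDist : Type _ := ↥(distributions p lam M (imageSet χ))

noncomputable instance : AddCommGroup (GammaDist lam M χ) :=
  inferInstanceAs (AddCommGroup ↥(distributions p lam M (imageSet χ)))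

noncomputable instance : Module ℚ_[p] (GammaDist lam M χ) :=
  inferInstanceAs (Module ℚ_[p] ↥(distributions p lam M (imageSet χ)))

noncomputable instance : TopologicalSpace (GammaDist lam M χ) :=
  inferInstanceAs (TopologicalSpace ↥(distributions p lam M (imageSet χ)))

instance : IsTopologicalAddGroup (GammaDist lam M χ) :=
  inferInstanceAs (IsTopologicalAddGroup ↥(distributions p lam M (imageSet χ)))

theorem GammaDist.continuous_iff {T : Type*} [TopologicalSpace T] {F : T → GammaDist lam M χ} :
    Continuous F ↔ ∀ f : OrderFun p lam, Continuous fun t => (F t).1 f :=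
  (Topology.IsInducing.subtypeVal.continuous_iff).trans
    (((PointwiseConvergenceCLM.isEmbedding_coeFn _ _ _).isInducing.continuous_iff).trans
      continuous_pi_iff)

theorem GammaDist.continuous_eval (f : OrderFun p lam) :
    Continuous fun μ : GammaDist lam M χ => μ.1 f :=
  (GammaDist.continuous_iff χ).1 continuous_id f

instance : ContinuousConstSMul ℚ_[p] (GammaDist lam M χ) where
  continuous_const_smul c := (GammaDist.continuous_iff χ).2 fun f =>
    (GammaDist.continuous_eval χ f).const_smul c

variable {χ} in
theorem GammaDist.ext {μ ν : GammaDist lam M χ} (h : ∀ f, μ.1 f = ν.1 f) : μ = ν :=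
  Subtype.ext (DFunLike.ext _ _ h)

variable (lam M) in
/-- Integration of a fixed function, `μ ↦ ∫ f dμ`. -/
noncomputable def GammaDist.eval (f : OrderFun p lam) : GammaDist lam M χ →L[ℚ_[p]] M where
  toFun μ := μ.1 f
  map_add' _ _ := rfl
  map_smul' _ _ := rfl
  cont := GammaDist.continuous_eval χ f

variable [DistribMulAction G M] [ContinuousConstSMul G M] [SMulCommClass G ℚ_[p] M]

/-- The action of `G` on `D_lam(Γ, M)`: `∫ f(x) d(gμ)(x) = g (∫ f(χ(g)⁻¹ x) dμ(x))`. -/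
noncomputable instance : SMul G (GammaDist lam M χ) where
  smul g μ := ⟨(show OrderFun p lam →L[ℚ_[p]] M from
    { toFun := fun f => g • μ.1 (dilateL p lam (χ g)⁻¹.1 f)
      map_add' := fun f f' => by rw [map_add, map_add, smul_add]
      map_smul' := fun c f => by rw [map_smul, map_smul, smul_comm]; rfl
      cont := ((ContinuousLinearMap.continuous
        (show OrderFun p lam →L[ℚ_[p]] M from μ.1)).comp
          (dilateL p lam (χ g)⁻¹.1).continuous).const_smul g }), by
    intro f hf
    change g • μ.1 (dilateL p lam (χ g)⁻¹.1 f) = 0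
    rw [μ.2 _ _, smul_zero]
    rintro x ⟨g', rfl⟩
    rw [dilateL_apply]
    refine hf _ ⟨g⁻¹ * g', ?_⟩
    simp⟩

theorem GammaDist.smul_apply (g : G) (μ : GammaDist lam M χ) (f : OrderFun p lam) :
    (g • μ).1 f = g • μ.1 (dilateL p lam (χ g)⁻¹.1 f) := rfl

noncomputable instance : DistribMulAction G (GammaDist lam M χ) where
  one_smul μ := GammaDist.ext fun f => by
    rw [GammaDist.smul_apply, one_smul, map_one, inv_one, Units.val_one, dilateL_one]
  mul_smul g g' μ := GammaDist.ext fun f => by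
    simp only [GammaDist.smul_apply, mul_smul, dilateL_dilateL, map_mul, mul_inv, Units.val_mul]
  smul_zero g := GammaDist.ext fun _ => smul_zero g
  smul_add g _ _ := GammaDist.ext fun _ => smul_add g _ _

instance : SMulCommClass G ℚ_[p] (GammaDist lam M χ) where
  smul_comm g c _ := GammaDist.ext fun _ => smul_comm g c _

instance : ContinuousConstSMul G (GammaDist lam M χ) where
  continuous_const_smul g := (GammaDist.continuous_iff χ).2 fun f =>
    (GammaDist.continuous_eval χ _).const_smul g

variable [TopologicalSpace G] {N : Subgroup G}

variable (lam M) in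
/-- The map `H^1(N, D_lam(Γ, M)) → H^1(N, M)`, `μ ↦ ∫ f dμ`, for a subgroup `N` on which `χ` is
trivial. -/
noncomputable def H1.integral (hN : N ≤ χ.ker) (f : OrderFun p lam) :
    H1 ℚ_[p] N (GammaDist lam M χ) →ₗ[ℚ_[p]] H1 ℚ_[p] N M :=
  H1.map (GammaDist.eval lam M χ f) fun h μ => by
    have h1 : χ (h : G) = 1 := hN h.2
    change (h : G) • μ.1 (dilateL p lam (χ (h : G))⁻¹.1 f) = (h : G) • μ.1 f
    rw [h1, inv_one, Units.val_one, dilateL_one]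

end Distributions

section Galois

variable (p : ℕ) [Fact p.Prime] (K Ω : Type*) [Field K] [Field Ω] [Algebra K Ω]

/-- The `p`-adic cyclotomic character of `Gal(Ω/K)`. -/
noncomputable def cycChar : Gal(Ω/K) →* ℤ_[p]ˣ :=
  (cyclotomicCharacter Ω p).comp (MulSemiringAction.toRingAut Gal(Ω/K) Ω)

/-- `K_∞ = K(μ_{p^∞})`, inside `Ω`. -/
def cycTower : IntermediateField K Ω :=
  IntermediateField.adjoin K {ζ : Ω | ∃ n : ℕ, ζ ^ p ^ n = 1}

/-- `Gal(Ω/K_∞)`. -/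
def galInf : Subgroup Gal(Ω/K) := (cycTower p K Ω).fixingSubgroup

theorem mem_galInf_iff (p : ℕ) (K Ω : Type*) [Field K] [Field Ω] [Algebra K Ω] (g : Gal(Ω/K)) :
    g ∈ galInf p K Ω ↔ ∀ ζ : Ω, (∃ n : ℕ, ζ ^ p ^ n = 1) → g ζ = ζ := by
  rw [galInf, IntermediateField.mem_fixingSubgroup_iff]
  constructor
  · exact fun h ζ hζ => h ζ (IntermediateField.subset_adjoin K _ hζ)
  · intro h
    have : cycTower p K Ω ≤ IntermediateField.fixedField (Subgroup.zpowers g) := by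
      refine IntermediateField.adjoin_le_iff.2 fun ζ hζ => ?_
      rintro ⟨_, hm⟩
      exact (Subgroup.zpowers_le.2 (show g ∈ MulAction.stabilizer Gal(Ω/K) ζ from h ζ hζ)) hm
    intro x hx
    exact this hx ⟨g, Subgroup.mem_zpowers g⟩

instance : (galInf p K Ω).Normal where
  conj_mem h hh g := by
    rw [mem_galInf_iff] at hh ⊢
    rintro ζ ⟨n, hn⟩
    have : h (g⁻¹ ζ) = g⁻¹ ζ := hh _ ⟨n, by rw [← map_pow, hn, map_one]⟩
    simp only [AlgEquiv.mul_apply, this]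
    exact g.apply_symm_apply ζ

theorem galInf_le_ker : galInf p K Ω ≤ (cycChar p K Ω).ker := by
  intro g hg
  rw [mem_galInf_iff] at hg
  rw [MonoidHom.mem_ker]
  by_cases H : ∀ i : ℕ, ∃ ζ : Ω, IsPrimitiveRoot ζ (p ^ i)
  · have _ (i) : HasEnoughRootsOfUnity Ω (p ^ i) := ⟨H i, rootsOfUnity.isCyclic _ _⟩
    apply Units.ext
    refine PadicInt.ext_of_toZModPow.mp fun n => ?_
    rw [cycChar, MonoidHom.comp_apply, cyclotomicCharacter.toZModPow, Units.val_one, map_one]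
    symm
    rcases Nat.eq_zero_or_pos n with rfl | hn
    · exact Subsingleton.elim (α := ZMod 1) _ _
    apply modularCyclotomicCharacter.unique
    intro t ht
    rw [ZMod.val_one'' (one_lt_pow₀ (Fact.out : p.Prime).one_lt hn.ne').ne', pow_one]
    exact hg _ ⟨n, by
      rw [← Units.val_pow_eq_pow_val, (mem_rootsOfUnity _ _).1 ht, Units.val_one]⟩
  · apply Units.ext
    simp [cycChar, cyclotomicCharacter, cyclotomicCharacter.toFun, dif_neg H]

/-- `Γ_n`, or rather its inverse image in `Gal(Ω/K)`: the `g` with `χ(g) ≡ 1` modulo `p ^ n`. -/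
noncomputable def levelSubgroup (n : ℕ) : Subgroup Gal(Ω/K) :=
  ((Units.map (PadicInt.toZModPow (p := p) n).toMonoidHom).comp (cycChar p K Ω)).ker

end Galois

section Interpolation

variable {p : ℕ} [Fact p.Prime] (lam : ℝ) {K Ω : Type*} [Field K] [Field Ω] [Algebra K Ω]
  {M : Type*} [NormedAddCommGroup M] [NormedSpace ℚ_[p] M] [DistribMulAction Gal(Ω/K) M]
  [ContinuousConstSMul Gal(Ω/K) M] [SMulCommClass Gal(Ω/K) ℚ_[p] M]

/-- `μ ∈ H^1(K_∞, D_lam(Γ, M))` is `Γ`-invariant, and the integral of `χ ^ j` over `Γ_n` against `μ`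
is `x n j` for all `n ≥ 0` and `0 ≤ j ≤ h`. -/
def Interpolates (h : ℕ) (x : ℕ → ℕ → H1 ℚ_[p] (galInf p K Ω) M)
    (μ : H1 ℚ_[p] (galInf p K Ω) (GammaDist lam M (cycChar p K Ω))) : Prop :=
  (∀ g : Gal(Ω/K), H1.conj (R := ℚ_[p]) (X := GammaDist lam M (cycChar p K Ω)) (galInf p K Ω) g μ = μ) ∧
    ∀ n, ∀ j ≤ h,
      H1.integral lam M (cycChar p K Ω) (galInf_le_ker p K Ω) (ballPow p lam n j) μ = x n j

end Interpolation

section Settings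

open IsDedekindDomain

/-- `K^S`, the maximal extension of the number field `K` (inside an algebraic closure) that is
unramified at all finite places outside `S`. -/
noncomputable def maxUnramified (K : Type*) [Field K] [NumberField K]
    (S : Set (HeightOneSpectrum (𝓞 K))) : IntermediateField K (AlgebraicClosure K) :=
  ⨆ (L : IntermediateField K (AlgebraicClosure K))
    (_ : FiniteDimensional K L ∧ ∀ v ∉ S, Algebra.IsUnramifiedIn (𝓞 L) v.asIdeal), L

/-- The two kinds of field extensions `Ω/K` that are considered. -/
inductive GaloisSetting (p : ℕ) [Fact p.Prime] (K : Type*) [Field K] :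
    IntermediateField K (AlgebraicClosure K) → Prop
  /-- `K` is a finite extension of `ℚ_p` and `Ω` is its algebraic closure. -/
  | loc [Algebra ℚ_[p] K] [FiniteDimensional ℚ_[p] K] : GaloisSetting p K ⊤
  /-- `K` is a number field and `Ω = K^S` for a finite set `S` of places containing the places above
  `p` and the infinite places (only the finite places in `S` are listed). -/
  | glob [NumberField K] (S : Set (HeightOneSpectrum (𝓞 K))) (hS : S.Finite)
      (hp : ∀ v : HeightOneSpectrum (𝓞 K), (p : 𝓞 K) ∈ v.asIdeal → v ∈ S) :
      GaloisSetting p K (maxUnramified K S)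

end Settings

end PadicIwasawa

universe u v w

open PadicIwasawa

/-! Invariance forces `∫ x ^ j dμ = χ(g) ^ j g⁻¹ x_{n,j}` over the ball of level `n` around `χ(g)`.
So the data prescribe the integrals of all polynomials of degree at most `h` over all balls meeting
`Γ`, and norm-compatibility says that these integrals are finitely additive (`ballSystem_add`). The
growth hypothesis bounds the integral of the single polynomial `(x - c) ^ h` for each centre `c ∈ Γ`
(`ballInt_sub_pow`). On a ball contained in `Γ` one may vary the centre, and `h + 1` such powers
span the polynomials of degree at most `h` (`exists_eq_sum_sub_pow`). Hence all the prescribed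
integrals have growth of order `lam` (`exists_isBallSystem`).

The distribution is the limit of Riemann sums in which `f` is replaced on each ball by its Lagrange
interpolant of degree at most `h`. For `f` of order `lam` the interpolation error at level `k` is at
most `‖f‖ p ^ (-⌊lam (k + 1)⌋)` (`norm_sub_eval_interpPoly_le`), which exactly balances the growth
of the integrals and keeps the Riemann sums bounded. For polynomials, `lam < h + 1` gives
convergence, and polynomials are dense (`IsBallSystem.exists_distribution`). The same estimates show
that locally polynomial functions of degree at most `h` are dense, whence uniqueness
(`eq_zero_of_locPoly_eq_zero`).

The bound so obtained depends on the conductor `p ^ m₀` of `Γ`. On functions vanishing outside `Γ`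
the dependence is removed: for a minimal `m₀ > 1` every point of `Γ` has neighbours at distance `p ^
(-(m₀ - 1))` outside `Γ`, and extrapolating from the zeros there makes such functions small
(`exists_uniform_extension`).

All this takes place in `H^1(K_∞, M)`, which must be a Banach space. Its coboundaries are closed
because submodules of finite modules over a Noetherian Banach algebra are closed
(`isClosed_submodule`, `isClosed_coboundaries`). Distributions with values in `H^1` are then
compared with classes with values in distributions: the functions of order `lam` have an orthonormal
basis, so functionals on them lift along surjections of Banach spaces (`exists_lift`). This gives
existence by lifting to cocycles, and injectivity by lifting along `M → B^1`.

Finally `Γ` is open in `ℤ_pˣ` (`exists_cycChar_eq_one_add`): its index modulo `p ^ n` is bounded by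
the degree of `K` over `ℚ_p` or `ℚ`, because cyclotomic polynomials of order `p ^ n` are irreducible
there. -/

namespace PadicIwasawa

/-! ### Differences of step `1` and of step `p ^ k`. -/

section ForwardDifferences

open fwdDiff_aux Polynomial

variable {p : ℕ} [Fact p.Prime]

theorem norm_natCast_le_one (n : ℕ) : ‖(n : ℚ_[p])‖ ≤ 1 := by
  simpa using Padic.norm_int_le_one (p := p) (n : ℤ)

theorem norm_intCast_le_pow_of_dvd {z : ℤ} {n : ℕ} (h : (p : ℤ) ^ n ∣ z) :
    ‖(z : ℚ_[p])‖ ≤ ((p : ℝ) ^ n)⁻¹ := by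
  have := (Padic.norm_int_le_pow_iff_dvd z n).2 (by exact_mod_cast h)
  simpa using this

/-- A continuous function on `ℤ_p` whose Mahler coefficients are bounded by `c` is bounded by
`c`. -/
theorem norm_le_of_norm_fwdDiff_zero_le {f : ℤ_[p] → ℚ_[p]} (hf : Continuous f) {c : ℝ}
    (h : ∀ i, ‖(fwdDiff (1 : ℤ_[p]))^[i] f 0‖ ≤ c) (t : ℤ_[p]) : ‖f t‖ ≤ c := by
  have hc : 0 ≤ c := (norm_nonneg _).trans (h 0)
  have hcl : IsClosed {t : ℤ_[p] | ‖f t‖ ≤ c} := isClosed_le hf.norm continuous_const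
  have : (Set.range ((↑) : ℕ → ℤ_[p])) ⊆ {t : ℤ_[p] | ‖f t‖ ≤ c} := by
    rintro _ ⟨n, rfl⟩
    have e := shift_eq_sum_fwdDiff_iter (1 : ℤ_[p]) f n 0
    rw [zero_add, nsmul_one] at e
    rw [Set.mem_ofPred_eq, e]
    refine IsUltrametricDist.norm_sum_le_of_forall_le_of_nonneg hc fun k _ => ?_
    rw [nsmul_eq_mul, norm_mul]
    exact (mul_le_mul (norm_natCast_le_one _) (h k) (norm_nonneg _) zero_le_one).trans
      (one_mul c).le
  exact (hcl.closure_subset_iff.2 this) (PadicInt.denseRange_natCast t)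

theorem continuous_fwdDiff_iter {f : ℤ_[p] → ℚ_[p]} (hf : Continuous f) (q : ℤ_[p]) (s : ℕ) :
    Continuous ((fwdDiff q)^[s] f) := by
  have : (fwdDiff q)^[s] f = fun y => ∑ k ∈ Finset.range (s + 1),
      ((-1 : ℤ) ^ (s - k) * s.choose k) • f (y + k • q) :=
    funext fun y => fwdDiff_iter_eq_sum_shift q f s y
  rw [this]
  fun_prop

/-- The Mahler coefficients of `Δ ^ s f` are those of `f` shifted by `s`, and they control its sup
norm. -/
theorem norm_fwdDiff_iter_le_of_zero {f : ℤ_[p] → ℚ_[p]} (hf : Continuous f) {c : ℝ} {s : ℕ}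
    (h : ∀ n, s ≤ n → ‖(fwdDiff (1 : ℤ_[p]))^[n] f 0‖ ≤ c) (a : ℤ_[p]) :
    ‖(fwdDiff (1 : ℤ_[p]))^[s] f a‖ ≤ c := by
  refine norm_le_of_norm_fwdDiff_zero_le (continuous_fwdDiff_iter hf 1 s) (fun i => ?_) a
  rw [← Function.iterate_add_apply]
  exact h _ (by omega)

/-- Iterated differences do not increase the sup norm. -/
theorem norm_fwdDiff_iter_le {f : ℤ_[p] → ℚ_[p]} {c : ℝ} (h : ∀ x, ‖f x‖ ≤ c) (q : ℤ_[p]) (s : ℕ)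
    (a : ℤ_[p]) : ‖(fwdDiff q)^[s] f a‖ ≤ c := by
  rw [fwdDiff_iter_eq_sum_shift]
  refine IsUltrametricDist.norm_sum_le_of_forall_le_of_nonneg ((norm_nonneg _).trans (h 0))
    fun k _ => ?_
  rw [zsmul_eq_mul, norm_mul]
  exact (mul_le_mul (Padic.norm_int_le_one _) (h _) (norm_nonneg _) zero_le_one).trans
    (one_mul c).le

/-- Translation by `1` is `1 + Δ`, so translation by `q` is its `q`-th power. This turns comparisons
of step sizes into identities between integer polynomials in `Δ`. -/
theorem fwdDiffₗ_natCast (q : ℕ) :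
    fwdDiffₗ ℤ_[p] ℚ_[p] (q : ℤ_[p]) =
      aeval (fwdDiffₗ ℤ_[p] ℚ_[p] 1) (((1 + X) ^ q - 1 : ℤ[X])) := by
  have h1 : (1 + fwdDiffₗ ℤ_[p] ℚ_[p] 1) = shiftₗ ℤ_[p] ℚ_[p] 1 := add_comm _ _
  simp only [map_sub, map_pow, map_add, map_one, aeval_X, h1]
  ext f y
  rw [LinearMap.sub_apply, Pi.sub_apply, shiftₗ_pow_apply]
  simp [fwdDiff]

theorem fwdDiff_iter_natCast (q i : ℕ) (f : ℤ_[p] → ℚ_[p]) :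
    (fwdDiff (q : ℤ_[p]))^[i] f =
      aeval (fwdDiffₗ ℤ_[p] ℚ_[p] 1) (((1 + X) ^ q - 1 : ℤ[X]) ^ i) f := by
  rw [map_pow, ← fwdDiffₗ_natCast, ← coe_fwdDiffₗ_pow]

theorem aeval_fwdDiffₗ_apply (F : ℤ[X]) (f : ℤ_[p] → ℚ_[p]) (x : ℤ_[p]) :
    aeval (fwdDiffₗ ℤ_[p] ℚ_[p] 1) F f x =
      F.sum fun s c => (c : ℚ_[p]) * (fwdDiff (1 : ℤ_[p]))^[s] f x := by
  rw [aeval_def, eval₂_eq_sum, Polynomial.sum, Polynomial.sum, LinearMap.sum_apply,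
    Finset.sum_apply]
  refine Finset.sum_congr rfl fun s _ => ?_
  rw [Module.End.mul_apply, algebraMap_int_eq, eq_intCast, Module.End.intCast_apply,
    Pi.smul_apply, zsmul_eq_mul, ← coe_fwdDiffₗ_pow]

theorem norm_aeval_fwdDiffₗ_le {F : ℤ[X]} {f : ℤ_[p] → ℚ_[p]} {x : ℤ_[p]} {c : ℝ} (hc : 0 ≤ c)
    (h : ∀ s, ‖(F.coeff s : ℚ_[p])‖ * ‖(fwdDiff (1 : ℤ_[p]))^[s] f x‖ ≤ c) :
    ‖aeval (fwdDiffₗ ℤ_[p] ℚ_[p] 1) F f x‖ ≤ c := by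
  rw [aeval_fwdDiffₗ_apply, Polynomial.sum]
  refine IsUltrametricDist.norm_sum_le_of_forall_le_of_nonneg hc fun s _ => ?_
  rw [norm_mul]
  exact h s

theorem norm_aeval_fwdDiffₗ_le_of_le (F : ℤ[X]) {f : ℤ_[p] → ℚ_[p]} {c : ℝ}
    (h : ∀ x, ‖f x‖ ≤ c) (x : ℤ_[p]) : ‖aeval (fwdDiffₗ ℤ_[p] ℚ_[p] 1) F f x‖ ≤ c :=
  norm_aeval_fwdDiffₗ_le ((norm_nonneg _).trans (h 0)) fun s =>
    (mul_le_mul (Padic.norm_int_le_one _) (norm_fwdDiff_iter_le h 1 s x) (norm_nonneg _)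
      zero_le_one).trans (one_mul c).le

/-- For `0 < r ≤ p ^ k` the valuation of `binom(p ^ k, r)` is `k` minus that of `r`, and `r < p ^ l`
has valuation at most `l - 1`. -/
theorem pow_dvd_choose_pow {k l r : ℕ} (hlk : l ≤ k) (hr : r ≠ 0) (hrl : r < p ^ l) :
    p ^ (k - l + 1) ∣ (p ^ k).choose r := by
  have hp : p.Prime := Fact.out
  rcases Nat.lt_or_ge (p ^ k) r with h | hle
  · rw [Nat.choose_eq_zero_of_lt h]; exact dvd_zero _
  have h := Nat.Prime.emultiplicity_choose_prime_pow_add_emultiplicity hp hle hr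
  apply pow_dvd_of_le_emultiplicity
  have h2 : emultiplicity p r < l := by
    rw [emultiplicity_lt_iff_not_dvd]
    exact fun hd => absurd (Nat.le_of_dvd (Nat.pos_of_ne_zero hr) hd) (not_le.2 hrl)
  obtain ⟨a, ha⟩ := ENat.ne_top_iff_exists.1 (ne_top_of_lt h2)
  have hf : emultiplicity p ((p ^ k).choose r) ≠ ⊤ := by
    intro ht
    rw [ht, top_add] at h
    exact absurd h (ENat.natCast_ne_top k).symm
  obtain ⟨b, hb⟩ := ENat.ne_top_iff_exists.1 hf
  rw [← ha, ← hb] at h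
  rw [← ha] at h2
  rw [← hb]
  norm_cast at h h2 ⊢
  omega

/-- In a product of `i` factors, a coefficient of degree below `p ^ l` only involves coefficients of
degree below `p ^ l`, and each factor contributes `p ^ (k - l + 1)`. -/
theorem pow_dvd_coeff_one_add_X_pow_sub_one_pow {k l : ℕ} (hlk : l ≤ k) (i s : ℕ)
    (hs : s < p ^ l) :
    (p : ℤ) ^ ((k - l + 1) * i) ∣ (((1 + X) ^ p ^ k - 1 : ℤ[X]) ^ i).coeff s := by
  induction i generalizing s with
  | zero => simp
  | succ i ih =>
    rw [pow_succ, coeff_mul, mul_add, pow_add, mul_one]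
    refine Finset.dvd_sum fun x hx => ?_
    have hx' : x.1 + x.2 = s := Finset.HasAntidiagonal.mem_antidiagonal.1 hx
    refine mul_dvd_mul (ih _ (by omega)) ?_
    rw [coeff_sub, coeff_one_add_X_pow, coeff_one]
    rcases eq_or_ne x.2 0 with h0 | h0
    · simp [h0]
    · rw [if_neg h0, sub_zero]
      exact_mod_cast pow_dvd_choose_pow hlk h0 (by omega)

theorem floor_add_mul_le {lam : ℝ} (hlam : 0 ≤ lam) {i : ℕ} (hi : lam ≤ i) (l r : ℕ) :
    ⌊lam * ((l + r : ℕ) : ℝ)⌋₊ ≤ r * i + ⌊lam * l⌋₊ := by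
  have h : lam * ((l + r : ℕ) : ℝ) ≤ lam * l + ((r * i : ℕ) : ℝ) := by
    push_cast
    nlinarith [mul_le_mul_of_nonneg_right hi (Nat.cast_nonneg (α := ℝ) r)]
  calc _ ≤ ⌊lam * l + ((r * i : ℕ) : ℝ)⌋₊ := Nat.floor_mono h
    _ = ⌊lam * l⌋₊ + r * i := Nat.floor_add_natCast (by positivity) _
    _ = _ := add_comm _ _

/-- High order differences with step `p ^ k` of functions of order `lam` are small. -/
theorem norm_fwdDiff_pow_iter_le {lam : ℝ} (hlam : 0 ≤ lam) {f : ℤ_[p] → ℚ_[p]}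
    (hf : Continuous f) {c : ℝ}
    (h : ∀ s, ‖(fwdDiff (1 : ℤ_[p]))^[s] f 0‖ ≤ c * ((p : ℝ) ^ ⌊lam * ell p s⌋₊)⁻¹)
    {i : ℕ} (hi : lam ≤ i) (k : ℕ) (a : ℤ_[p]) :
    ‖(fwdDiff ((p : ℤ_[p]) ^ k))^[i] f a‖ ≤ c * ((p : ℝ) ^ ⌊lam * (k + 1 : ℕ)⌋₊)⁻¹ := by
  have hp1 : (1 : ℝ) ≤ p := by exact_mod_cast (Fact.out : p.Prime).one_le
  have hp0 : (0 : ℝ) < p := zero_lt_one.trans_le hp1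
  have hc : 0 ≤ c := by
    have := (norm_nonneg _).trans (h 0)
    exact nonneg_of_mul_nonneg_left this (by positivity)
  have hs : ∀ s, ‖(fwdDiff (1 : ℤ_[p]))^[s] f a‖ ≤ c * ((p : ℝ) ^ ⌊lam * ell p s⌋₊)⁻¹ := by
    intro s
    refine norm_fwdDiff_iter_le_of_zero hf (fun n hn => (h n).trans ?_) a
    gcongr ?_ * (?_)⁻¹
    exact pow_le_pow_right₀ hp1 (floor_ell_mono p lam hn)
  have hq : ((p : ℤ_[p]) ^ k) = ((p ^ k : ℕ) : ℤ_[p]) := by push_cast; rfl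
  rw [hq, fwdDiff_iter_natCast]
  refine norm_aeval_fwdDiffₗ_le (by positivity) fun s => ?_
  -- If `ell p s ≤ k`, the coefficient contributes `(k + 1 - ell p s) * i` powers of `p`, and `i ≥
  -- lam` makes this at least the missing `lam * (k + 1 - ell p s)`. Otherwise `ell p s ≥ k + 1` and
  -- the decay of the difference itself suffices.
  rcases le_or_gt (ell p s) k with hl | hl
  · have hsl := (ell_le_iff p s (ell p s)).1 le_rfl
    have hd := norm_intCast_le_pow_of_dvd
      (pow_dvd_coeff_one_add_X_pow_sub_one_pow (p := p) hl i s hsl)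
    refine (mul_le_mul hd (hs s) (norm_nonneg _) (by positivity)).trans ?_
    rw [mul_left_comm, ← mul_inv, ← pow_add]
    gcongr ?_ * (?_)⁻¹
    refine pow_le_pow_right₀ hp1 ?_
    have := floor_add_mul_le hlam hi (ell p s) (k - ell p s + 1)
    have e : ell p s + (k - ell p s + 1) = k + 1 := by omega
    rwa [e] at this
  · refine (mul_le_mul (Padic.norm_int_le_one _) (hs s) (norm_nonneg _) zero_le_one).trans ?_
    rw [one_mul]
    gcongr ?_ * (?_)⁻¹
    refine pow_le_pow_right₀ hp1 (Nat.floor_mono ?_)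
    gcongr
    exact hl

/-- Frobenius: `(1 + X) ^ (p ^ k) ≡ 1 + X ^ (p ^ k)` modulo `p`. -/
theorem exists_X_pow_eq (p : ℕ) [Fact p.Prime] (k : ℕ) :
    ∃ Q : ℤ[X], (X : ℤ[X]) ^ p ^ k = ((1 + X) ^ p ^ k - 1) + C (p : ℤ) * Q := by
  have : C (p : ℤ) ∣ (X : ℤ[X]) ^ p ^ k - ((1 + X) ^ p ^ k - 1) := by
    rw [C_dvd_iff_dvd_coeff]
    intro r
    rw [coeff_sub, coeff_sub, coeff_X_pow, coeff_one_add_X_pow, coeff_one]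
    rcases eq_or_ne r (p ^ k) with rfl | hr
    · simp [(Fact.out : p.Prime).ne_zero]
    · rcases eq_or_ne r 0 with rfl | h0
      · simp [(pow_ne_zero k (Fact.out : p.Prime).ne_zero).symm]
      · rw [if_neg hr, if_neg h0]
        have := (Fact.out : p.Prime).dvd_choose_pow h0 hr
        simpa using Int.natCast_dvd_natCast.2 this
  obtain ⟨Q, hQ⟩ := this
  exact ⟨Q, by rw [← hQ]; ring⟩

/-- Comparison of differences of step `1` and of step `p ^ k`, for both directions. -/
theorem norm_aeval_pow_le {F G Q : ℤ[X]} (hF : F = G + C (p : ℤ) * Q) {f : ℤ_[p] → ℚ_[p]}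
    {c : ℝ} {s : ℕ} (hc : 0 ≤ c)
    (h : ∀ r, r ≤ s → ∀ x, ‖aeval (fwdDiffₗ ℤ_[p] ℚ_[p] 1) (G ^ r) f x‖ ≤ c * (p : ℝ) ^ (s - r))
    (x : ℤ_[p]) : ‖aeval (fwdDiffₗ ℤ_[p] ℚ_[p] 1) (F ^ s) f x‖ ≤ c := by
  have hp0 : (0 : ℝ) < p := by exact_mod_cast (Fact.out : p.Prime).pos
  rw [hF, add_pow, map_sum, LinearMap.sum_apply, Finset.sum_apply]
  refine IsUltrametricDist.norm_sum_le_of_forall_le_of_nonneg hc fun r hr => ?_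
  have hr' : r ≤ s := Nat.lt_succ_iff.1 (Finset.mem_range.1 hr)
  have e : G ^ r * (C (p : ℤ) * Q) ^ (s - r) * ((s.choose r : ℕ) : ℤ[X]) =
      C ((p : ℤ) ^ (s - r)) * ((Q ^ (s - r) * ((s.choose r : ℕ) : ℤ[X])) * G ^ r) := by
    rw [mul_pow, C_pow]; ring
  rw [e, map_mul, aeval_C, Module.End.mul_apply, algebraMap_int_eq, eq_intCast,
    Module.End.intCast_apply, Pi.smul_apply, zsmul_eq_mul, norm_mul, map_mul, Module.End.mul_apply]
  have h1 := norm_aeval_fwdDiffₗ_le_of_le (Q ^ (s - r) * ((s.choose r : ℕ) : ℤ[X])) (h r hr') x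
  refine (mul_le_mul (norm_intCast_le_pow_of_dvd dvd_rfl) h1 (norm_nonneg _) (by positivity)).trans
    (le_of_eq ?_)
  field_simp

/-- Take the `s`-th power of `X ^ (p ^ k) = ((1 + X) ^ (p ^ k) - 1) + p Q`: a term with only `r`
factors of the first kind carries `p ^ (s - r)`, so its difference may be that much larger. -/
theorem norm_fwdDiff_mul_iter_le_of_pow {f : ℤ_[p] → ℚ_[p]} {c : ℝ} {k s : ℕ} (hc : 0 ≤ c)
    (h : ∀ r, r ≤ s → ∀ x, ‖(fwdDiff ((p : ℤ_[p]) ^ k))^[r] f x‖ ≤ c * (p : ℝ) ^ (s - r))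
    (x : ℤ_[p]) : ‖(fwdDiff (1 : ℤ_[p]))^[p ^ k * s] f x‖ ≤ c := by
  obtain ⟨Q, hQ⟩ := exists_X_pow_eq p k
  have hq : ((p : ℤ_[p]) ^ k) = ((p ^ k : ℕ) : ℤ_[p]) := by push_cast; rfl
  simp only [hq, fwdDiff_iter_natCast] at h
  have := norm_aeval_pow_le hQ hc h x
  rwa [← pow_mul, map_pow, aeval_X, coe_fwdDiffₗ_pow] at this

/-- The same expansion with the roles of the two polynomials exchanged. -/
theorem norm_fwdDiff_pow_iter_le_of_mul {f : ℤ_[p] → ℚ_[p]} {c : ℝ} {k s : ℕ} (hc : 0 ≤ c)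
    (h : ∀ r, r ≤ s → ∀ x, ‖(fwdDiff (1 : ℤ_[p]))^[p ^ k * r] f x‖ ≤ c * (p : ℝ) ^ (s - r))
    (x : ℤ_[p]) : ‖(fwdDiff ((p : ℤ_[p]) ^ k))^[s] f x‖ ≤ c := by
  obtain ⟨Q, hQ⟩ := exists_X_pow_eq p k
  have hQ' : ((1 + X) ^ p ^ k - 1 : ℤ[X]) = X ^ p ^ k + C (p : ℤ) * (-Q) := by
    rw [hQ]; ring
  have hq : ((p : ℤ_[p]) ^ k) = ((p ^ k : ℕ) : ℤ_[p]) := by push_cast; rfl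
  rw [hq, fwdDiff_iter_natCast]
  refine norm_aeval_pow_le hQ' hc (fun r hr y => ?_) x
  rw [← pow_mul, map_pow, aeval_X, coe_fwdDiffₗ_pow]
  exact h r hr y

end ForwardDifferences

end PadicIwasawa

namespace PadicIwasawa

/-! ### Growth of the weight `⌊lam * ell n⌋`. -/

section Growth

variable {p : ℕ} [Fact p.Prime]

theorem lt_pow_ell (p : ℕ) [Fact p.Prime] (n : ℕ) : n < p ^ ell p n := (ell_le_iff p n _).1 le_rfl

theorem ell_le_add_ell_sub {r s : ℕ} (h : r ≤ s) : ell p s ≤ ell p r + ell p (s - r) := by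
  rw [ell_le_iff, pow_add]
  have h1 : r + 1 ≤ p ^ ell p r := lt_pow_ell p r
  have h2 : s - r + 1 ≤ p ^ ell p (s - r) := lt_pow_ell p (s - r)
  have h3 := Nat.mul_le_mul h1 h2
  obtain ⟨t, rfl⟩ := Nat.exists_eq_add_of_le h
  rw [Nat.add_sub_cancel_left] at h3 ⊢
  nlinarith

theorem ell_le_add_ell_div (n k : ℕ) : ell p n ≤ k + ell p (n / p ^ k) := by
  rw [ell_le_iff, pow_add]
  have hq : 0 < p ^ k := pow_pos (Fact.out : p.Prime).pos k
  calc n < p ^ k * (n / p ^ k + 1) := Nat.lt_mul_div_succ n hq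
    _ ≤ _ := Nat.mul_le_mul_left _ (lt_pow_ell p _)

theorem sq_le_four_mul_two_pow (e : ℕ) : (e + 1) ^ 2 ≤ 4 * 2 ^ e := by
  induction e with
  | zero => norm_num
  | succ e ih =>
    rcases Nat.lt_or_ge e 2 with he | he
    · interval_cases e <;> norm_num
    · rw [pow_succ 2 e]
      nlinarith

theorem exists_mul_ell_le (p : ℕ) [Fact p.Prime] (lam : ℝ) :
    ∃ c : ℕ, ∀ t : ℕ, lam * ell p t ≤ t + c := by
  set L := ⌈lam⌉₊
  -- Writing `ell p t = e + 1`, one has `t ≥ 2 ^ e ≥ (e + 1) ^ 2 / 4`, and `L (e + 1) ≤ (e + 1) ^ 2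
  -- / 4 + L ^ 2` because `(e + 1 - 2 L) ^ 2 ≥ 0`.
  refine ⟨L ^ 2, fun t => ?_⟩
  have h1 : L * ell p t ≤ t + L ^ 2 := by
    rcases Nat.eq_zero_or_pos (ell p t) with h0 | hpos
    · rw [h0]; omega
    · obtain ⟨e, he⟩ := Nat.exists_eq_succ_of_ne_zero hpos.ne'
      have h3 : ¬ ell p t ≤ e := by omega
      rw [ell_le_iff, not_lt] at h3
      have h4 : 2 ^ e ≤ p ^ e := Nat.pow_le_pow_left (Fact.out : p.Prime).two_le e
      have h5 := sq_le_four_mul_two_pow e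
      rw [he, Nat.succ_eq_add_one]
      zify at *
      nlinarith [sq_nonneg ((e : ℤ) + 1 - 2 * L)]
  calc lam * ell p t ≤ L * ell p t :=
        mul_le_mul_of_nonneg_right (Nat.le_ceil lam) (Nat.cast_nonneg _)
    _ ≤ t + (L ^ 2 : ℕ) := by exact_mod_cast h1

/-- `ell` is logarithmic, so a linear gain `n / p ^ k - r` absorbs `lam * ell p (n / p ^ k - r)` up
to a constant. That gain is the factor lost when changing step sizes; the constant does not depend
on `k`, and its extra `2` absorbs the rounding of two floors. -/
theorem exists_floor_ell_le (p : ℕ) [Fact p.Prime] {lam : ℝ} (hlam : 0 ≤ lam) :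
    ∃ c : ℕ, ∀ k n r : ℕ, r ≤ n / p ^ k →
      ⌊lam * ell p n⌋₊ ≤ (n / p ^ k - r) + ⌊lam * ell p r⌋₊ + (⌊lam * k⌋₊ + c) := by
  obtain ⟨c, hc⟩ := exists_mul_ell_le p lam
  refine ⟨c + 2, fun k n r hr => ?_⟩
  refine Nat.le_of_lt_succ ((Nat.floor_lt' (Nat.succ_ne_zero _)).2 ?_)
  have h1 : (ell p n : ℝ) ≤ k + (ell p r + ell p (n / p ^ k - r)) := by
    exact_mod_cast (ell_le_add_ell_div n k).trans
      (Nat.add_le_add_left (ell_le_add_ell_sub hr) k)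
  have h2 := mul_le_mul_of_nonneg_left h1 hlam
  have h3 := hc (n / p ^ k - r)
  have h4 := Nat.lt_floor_add_one (lam * k)
  have h5 := Nat.lt_floor_add_one (lam * ell p r)
  rw [Nat.succ_eq_add_one]
  push_cast
  linarith

end Growth

/-! ### The functions of order `lam` as a Banach space with an orthonormal basis. -/

section OrderFunSpace

variable {p : ℕ} [Fact p.Prime] {lam : ℝ}

theorem norm_mahlerCoeff_eq (f : ℤ_[p] → ℚ_[p]) (n : ℕ) :
    ‖mahlerCoeff p lam f n‖ = ‖(fwdDiff (1 : ℤ_[p]))^[n] f 0‖ * (p : ℝ) ^ ⌊lam * ell p n⌋₊ := by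
  rw [mahlerCoeff, norm_div, norm_pow, Padic.norm_p, inv_pow, div_inv_eq_mul]

theorem norm_mahlerCoeff_le_iff (f : ℤ_[p] → ℚ_[p]) (n : ℕ) (c : ℝ) :
    ‖mahlerCoeff p lam f n‖ ≤ c ↔
      ‖(fwdDiff (1 : ℤ_[p]))^[n] f 0‖ ≤ c * ((p : ℝ) ^ ⌊lam * ell p n⌋₊)⁻¹ := by
  have hp0 : (0 : ℝ) < p := by exact_mod_cast (Fact.out : p.Prime).pos
  rw [norm_mahlerCoeff_eq, ← div_eq_mul_inv, le_div_iff₀ (by positivity)]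

theorem norm_fwdDiff_zero_le (f : OrderFun p lam) (n : ℕ) :
    ‖(fwdDiff (1 : ℤ_[p]))^[n] f 0‖ ≤ ‖f‖ * ((p : ℝ) ^ ⌊lam * ell p n⌋₊)⁻¹ :=
  (norm_mahlerCoeff_le_iff f n _).1 (norm_mahlerCoeff_le p lam f n)

theorem OrderFun.continuous (f : OrderFun p lam) : Continuous f := f.1.continuous

@[simp] theorem OrderFun.add_apply (f g : OrderFun p lam) (x : ℤ_[p]) : (f + g) x = f x + g x := rfl
@[simp] theorem OrderFun.sub_apply (f g : OrderFun p lam) (x : ℤ_[p]) : (f - g) x = f x - g x := rfl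
@[simp] theorem OrderFun.zero_apply (x : ℤ_[p]) : (0 : OrderFun p lam) x = 0 := rfl
@[simp] theorem OrderFun.smul_apply (c : ℚ_[p]) (f : OrderFun p lam) (x : ℤ_[p]) :
    (c • f) x = c * f x := rfl

variable (p lam) in
/-- Evaluation of functions of order `lam` at a point, as a linear map. -/
noncomputable def OrderFun.evalₗ (x : ℤ_[p]) : OrderFun p lam →ₗ[ℚ_[p]] ℚ_[p] where
  toFun f := f x
  map_add' _ _ := rfl
  map_smul' _ _ := rfl

theorem OrderFun.sum_apply {ι : Type*} (s : Finset ι) (f : ι → OrderFun p lam) (x : ℤ_[p]) :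
    (∑ i ∈ s, f i) x = ∑ i ∈ s, f i x := map_sum (OrderFun.evalₗ p lam x) f s

variable (p lam) in
/-- The `n`-th normalised Mahler coefficient, as a linear map. -/
noncomputable def mahlerCoeffₗ (n : ℕ) : OrderFun p lam →ₗ[ℚ_[p]] ℚ_[p] where
  toFun f := mahlerCoeff p lam f n
  map_add' f g := mahlerCoeff_add p lam f g n
  map_smul' c f := mahlerCoeff_smul p lam c f n

theorem norm_fwdDiff_iter_le_norm (f : OrderFun p lam) (n : ℕ) (x : ℤ_[p]) :
    ‖(fwdDiff (1 : ℤ_[p]))^[n] f x‖ ≤ ‖f‖ * ((p : ℝ) ^ ⌊lam * ell p n⌋₊)⁻¹ := by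
  have hp1 : (1 : ℝ) ≤ p := by exact_mod_cast (Fact.out : p.Prime).one_le
  refine norm_fwdDiff_iter_le_of_zero f.continuous (fun m hm =>
    (norm_fwdDiff_zero_le f m).trans ?_) x
  gcongr ?_ * (?_)⁻¹
  exact pow_le_pow_right₀ hp1 (floor_ell_mono p lam hm)

theorem OrderFun.norm_apply_le (f : OrderFun p lam) (x : ℤ_[p]) : ‖f x‖ ≤ ‖f‖ := by
  have := norm_fwdDiff_iter_le_norm f 0 x
  simpa [ell] using this

instance : IsUltrametricDist (OrderFun p lam) :=
  IsUltrametricDist.isUltrametricDist_of_forall_norm_add_le_max_norm fun f g => by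
    rw [norm_le_iff p lam _ (by positivity)]
    intro n
    have : mahlerCoeff p lam (f + g : OrderFun p lam) n =
      mahlerCoeff p lam f n + mahlerCoeff p lam g n := mahlerCoeff_add p lam f g n
    rw [this]
    exact (IsUltrametricDist.norm_add_le_max _ _).trans
      (max_le_max (norm_mahlerCoeff_le p lam f n) (norm_mahlerCoeff_le p lam g n))

/-- Multiplying a null sequence by powers of `p` keeps it null, so its Mahler series converges.
Hence the space is isometric to the null sequences, which yields completeness and the basis. -/
theorem coeffMap_surjective : Function.Surjective (coeffMap p lam) := by
  intro b
  have hp : (p : ℚ_[p]) ≠ 0 := by exact_mod_cast (Fact.out : p.Prime).ne_zero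
  have hb : Tendsto b atTop (𝓝 0) := by
    rw [← cocompact_eq_atTop]; exact zero_at_infty b
  have ha : Tendsto (fun n => (p : ℚ_[p]) ^ ⌊lam * ell p n⌋₊ * b n) atTop (𝓝 0) := by
    refine squeeze_zero_norm (fun n => ?_) (tendsto_zero_iff_norm_tendsto_zero.1 hb)
    rw [norm_mul, norm_pow]
    exact mul_le_of_le_one_left (norm_nonneg _)
      (pow_le_one₀ (norm_nonneg _) Padic.norm_p_lt_one.le)
  have key : ∀ n, mahlerCoeff p lam (PadicInt.mahlerSeries (p := p)
      (fun n => (p : ℚ_[p]) ^ ⌊lam * ell p n⌋₊ * b n)) n = b n := fun n => by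
    rw [mahlerCoeff, PadicInt.fwdDiff_mahlerSeries ha]
    field_simp
  refine ⟨⟨PadicInt.mahlerSeries (p := p) (fun n => (p : ℚ_[p]) ^ ⌊lam * ell p n⌋₊ * b n), ?_⟩,
    DFunLike.ext _ _ key⟩
  change Tendsto (mahlerCoeff p lam _) _ _
  rw [funext key]
  exact hb

instance : CompleteSpace (OrderFun p lam) := by
  let e : OrderFun p lam ≃ᵢ C₀(ℕ, ℚ_[p]) :=
    { Equiv.ofBijective (coeffMap p lam) ⟨coeffMap_injective p lam, coeffMap_surjective⟩ with
      isometry_toFun := AddMonoidHomClass.isometry_of_norm (coeffMap p lam) fun f => rfl }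
  exact e.completeSpace

variable (lam) in
/-- The element `p ^ ⌊lam * ell n⌋ * binom(x, n)` of the orthonormal basis of `OrderFun p lam`. -/
noncomputable def basisFun (n : ℕ) : OrderFun p lam :=
  (coeffMap_surjective (p := p) (lam := lam)
    ⟨⟨Pi.single n 1, continuous_of_discreteTopology⟩, by
      rw [cocompact_eq_atTop]
      refine tendsto_const_nhds.congr' ?_
      filter_upwards [eventually_gt_atTop n] with m hm
      simp [hm.ne']⟩).choose

theorem mahlerCoeff_basisFun (n m : ℕ) :
    mahlerCoeff p lam (basisFun (p := p) lam n) m = (Pi.single n 1 : ℕ → ℚ_[p]) m := by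
  have := (coeffMap_surjective (p := p) (lam := lam)
    ⟨⟨Pi.single n 1, continuous_of_discreteTopology⟩, by
      rw [cocompact_eq_atTop]
      refine tendsto_const_nhds.congr' ?_
      filter_upwards [eventually_gt_atTop n] with m hm
      simp [hm.ne']⟩).choose_spec
  exact DFunLike.congr_fun this m

theorem norm_basisFun_le (n : ℕ) : ‖basisFun (p := p) lam n‖ ≤ 1 := by
  rw [norm_le_iff p lam _ zero_le_one]
  intro m
  rw [mahlerCoeff_basisFun]
  rcases eq_or_ne m n with rfl | h
  · simp
  · simp [h]

theorem tendsto_mahlerCoeff (f : OrderFun p lam) :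
    Tendsto (mahlerCoeff p lam f) atTop (𝓝 0) := f.2

theorem hasSum_basisFun (f : OrderFun p lam) :
    HasSum (fun n => mahlerCoeff p lam f n • basisFun lam n) f := by
  have hs : Summable (fun n => mahlerCoeff p lam f n • basisFun (p := p) lam n) := by
    refine NonarchimedeanAddGroup.summable_of_tendsto_cofinite_zero ?_
    rw [Nat.cofinite_eq_atTop]
    refine squeeze_zero_norm (fun n => ?_)
      (tendsto_zero_iff_norm_tendsto_zero.1 (tendsto_mahlerCoeff f))
    rw [norm_smul]
    exact mul_le_of_le_one_right (norm_nonneg _) (norm_basisFun_le n)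
  rw [hs.hasSum_iff_tendsto_nat, Metric.tendsto_atTop]
  intro ε hε
  obtain ⟨N, hN⟩ := Metric.tendsto_atTop.1 (tendsto_mahlerCoeff f) (ε / 2) (by positivity)
  refine ⟨N, fun n hn => lt_of_le_of_lt ?_ (half_lt_self hε)⟩
  rw [dist_eq_norm, norm_le_iff p lam _ (by positivity)]
  intro m
  have e : mahlerCoeff p lam (∑ i ∈ Finset.range n, mahlerCoeff p lam f i • basisFun lam i - f :
      OrderFun p lam) m = (if m < n then mahlerCoeff p lam f m else 0) - mahlerCoeff p lam f m := by
    have e1 : ∀ g : OrderFun p lam, mahlerCoeff p lam g m = mahlerCoeffₗ p lam m g := fun _ => rfl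
    rw [e1, map_sub, map_sum]
    simp only [map_smul]
    simp only [← e1, mahlerCoeff_basisFun,
      Pi.single_apply, smul_eq_mul, mul_ite, mul_one, mul_zero]
    simp
  rw [e]
  split_ifs with h
  · rw [sub_self, norm_zero]; positivity
  · rw [zero_sub, norm_neg]
    simpa using (hN m (hn.trans (not_lt.1 h))).le

end OrderFunSpace

end PadicIwasawa

namespace PadicIwasawa

/-! ### Lifting functionals along surjections. -/

section Lifting

variable {p : ℕ} [Fact p.Prime] {lam : ℝ}
  {X : Type*} [NormedAddCommGroup X] [NormedSpace ℚ_[p] X] [IsUltrametricDist X] [CompleteSpace X]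
  {Y : Type*} [NormedAddCommGroup Y] [NormedSpace ℚ_[p] Y]

/-- Continuous linear maps on the functions of order `lam` lift along surjections. -/
theorem exists_lift (T : X →L[ℚ_[p]] Y) {K : ℝ} (hK : 0 ≤ K)
    (hT : ∀ y, ∃ x, T x = y ∧ ‖x‖ ≤ K * ‖y‖) (φ : OrderFun p lam →L[ℚ_[p]] Y) {R : ℝ}
    (hR : 0 ≤ R) (hφ : ∀ f, ‖φ f‖ ≤ R * ‖f‖) :
    ∃ ψ : OrderFun p lam →L[ℚ_[p]] X, (∀ f, T (ψ f) = φ f) ∧ ∀ f, ‖ψ f‖ ≤ K * R * ‖f‖ := by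
  choose s hs hs' using hT
  -- The section `s` need not be linear: it is applied to the images of basis vectors only, and
  -- linearity comes from expanding `f` in the basis.
  set z : ℕ → X := fun n => s (φ (basisFun lam n))
  have hz : ∀ n, ‖z n‖ ≤ K * R := fun n => (hs' _).trans (by
    refine mul_le_mul_of_nonneg_left ((hφ _).trans ?_) hK
    exact mul_le_of_le_one_right hR (norm_basisFun_le n))
  have hKR : 0 ≤ K * R := mul_nonneg hK hR
  have hsum : ∀ f : OrderFun p lam, Summable fun n => mahlerCoeff p lam f n • z n := fun f => by
    refine NonarchimedeanAddGroup.summable_of_tendsto_cofinite_zero ?_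
    rw [Nat.cofinite_eq_atTop]
    have h0 := (tendsto_zero_iff_norm_tendsto_zero.1 (tendsto_mahlerCoeff f)).mul_const (K * R)
    rw [zero_mul] at h0
    refine squeeze_zero_norm (fun n => ?_) h0
    rw [norm_smul]
    exact mul_le_mul_of_nonneg_left (hz n) (norm_nonneg _)
  let ψ₀ : OrderFun p lam →ₗ[ℚ_[p]] X :=
    { toFun := fun f => ∑' n, mahlerCoeff p lam f n • z n
      map_add' := fun f g => by
        rw [← (hsum f).tsum_add (hsum g)]
        refine tsum_congr fun n => ?_
        rw [← add_smul]
        congr 1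
        exact mahlerCoeff_add p lam f g n
      map_smul' := fun c f => by
        rw [RingHom.id_apply, ← (hsum f).tsum_const_smul]
        refine tsum_congr fun n => ?_
        rw [smul_smul]
        congr 1
        exact mahlerCoeff_smul p lam c f n }
  have hb : ∀ f, ‖ψ₀ f‖ ≤ K * R * ‖f‖ := fun f => by
    refine IsUltrametricDist.norm_tsum_le_of_forall_le_of_nonneg (by positivity) fun n => ?_
    rw [norm_smul, mul_comm]
    exact mul_le_mul (hz n) (norm_mahlerCoeff_le p lam f n) (norm_nonneg _) hKR
  refine ⟨ψ₀.mkContinuous _ hb, fun f => ?_, hb⟩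
  have h1 : HasSum (fun n => mahlerCoeff p lam f n • z n) (ψ₀ f) := (hsum f).hasSum
  have h2 := h1.mapL T
  have h3 := (hasSum_basisFun f).mapL φ
  refine h2.unique ?_
  convert h3 using 2 with n
  rw [map_smul, map_smul, hs]

end Lifting

/-! ### Locally polynomial functions and their norms. -/

section LocallyPolynomialFunctions

variable {p : ℕ} [Fact p.Prime] {lam : ℝ}

/-- When the difference of order `p ^ k * s` is expanded in step-`p ^ k` differences of order `r`
with weights `p ^ (r - s)`, only `r ≤ d` survives, which leaves `p ^ (d - s)`. -/
theorem norm_fwdDiff_iter_le_of_iter_eq_zero {g : ℤ_[p] → ℚ_[p]} {b : ℝ} (hb : ∀ x, ‖g x‖ ≤ b)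
    {k d : ℕ} (hd : (fwdDiff ((p : ℤ_[p]) ^ k))^[d + 1] g = 0) (n : ℕ) (x : ℤ_[p]) :
    ‖(fwdDiff (1 : ℤ_[p]))^[n] g x‖ ≤ b * (p : ℝ) ^ d / (p : ℝ) ^ (n / p ^ k) := by
  have hp1 : (1 : ℝ) ≤ p := by exact_mod_cast (Fact.out : p.Prime).one_le
  have hb0 : 0 ≤ b := (norm_nonneg _).trans (hb 0)
  have hp0 : (0 : ℝ) < p := zero_lt_one.trans_le hp1
  set s := n / p ^ k
  have h1 : ∀ y, ‖(fwdDiff (1 : ℤ_[p]))^[p ^ k * s] g y‖ ≤ b * (p : ℝ) ^ d / (p : ℝ) ^ s := by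
    refine norm_fwdDiff_mul_iter_le_of_pow (by positivity) fun r hr y => ?_
    rcases le_or_gt r d with hrd | hrd
    · refine (norm_fwdDiff_iter_le hb _ r y).trans ?_
      rw [div_mul_eq_mul_div, le_div_iff₀ (by positivity), mul_assoc, ← pow_add]
      exact mul_le_mul_of_nonneg_left (pow_le_pow_right₀ hp1 (by omega)) hb0
    · have : (fwdDiff ((p : ℤ_[p]) ^ k))^[r] g = 0 := by
        obtain ⟨t, rfl⟩ := Nat.exists_eq_add_of_lt hrd
        rw [show d + t + 1 = t + (d + 1) by ring, Function.iterate_add_apply, hd]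
        have := fwdDiff_iter_const_smul ((p : ℤ_[p]) ^ k) (0 : ℚ_[p]) (0 : ℤ_[p] → ℚ_[p]) t
        simpa using this
      rw [this, Pi.zero_apply, norm_zero]
      positivity
  have e : n = n % p ^ k + p ^ k * s := (Nat.mod_add_div n (p ^ k)).symm
  rw [e, Function.iterate_add_apply]
  exact norm_fwdDiff_iter_le h1 1 _ x

theorem mahlerDecay_of_iter_eq_zero {g : ℤ_[p] → ℚ_[p]} {b : ℝ} (hb : ∀ x, ‖g x‖ ≤ b)
    {k d : ℕ} (hd : (fwdDiff ((p : ℤ_[p]) ^ k))^[d + 1] g = 0) : MahlerDecay p g := by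
  have hp1 : (1 : ℝ) ≤ p := by exact_mod_cast (Fact.out : p.Prime).one_le
  have hb0 : 0 ≤ b := (norm_nonneg _).trans (hb 0)
  have hq : 0 < p ^ k := pow_pos (Fact.out : p.Prime).pos k
  refine ⟨b * (p : ℝ) ^ d, by positivity, k, fun s n =>
    (norm_fwdDiff_iter_le_of_iter_eq_zero hb hd _ 0).trans ?_⟩
  refine div_le_div_of_nonneg_left (by positivity) (by positivity) (pow_le_pow_right₀ hp1 ?_)
  rw [Nat.le_div_iff_mul_le hq]
  omega

/-- The decay `p ^ (-(n / p ^ k))` of the differences beats the weight `p ^ ⌊lam * ell n⌋` up to `p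
^ ⌊lam * k⌋`, by `exists_floor_ell_le` with `r = 0`. Independence of `E` from `k` matters for
approximations by locally polynomial functions of growing level. -/
theorem exists_norm_le_of_iter_eq_zero (p : ℕ) [Fact p.Prime] {lam : ℝ} (hlam : 0 ≤ lam) (d : ℕ) :
    ∃ E : ℝ, 0 ≤ E ∧ ∀ (k : ℕ) (g : OrderFun p lam) (b : ℝ), (∀ x, ‖g x‖ ≤ b) →
      (fwdDiff ((p : ℤ_[p]) ^ k))^[d + 1] g = 0 → ‖g‖ ≤ E * b * (p : ℝ) ^ ⌊lam * k⌋₊ := by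
  have hp1 : (1 : ℝ) ≤ p := by exact_mod_cast (Fact.out : p.Prime).one_le
  have hp0 : (0 : ℝ) < p := zero_lt_one.trans_le hp1
  obtain ⟨c, hc⟩ := exists_floor_ell_le p hlam
  refine ⟨(p : ℝ) ^ (d + c), by positivity, fun k g b hb hd => ?_⟩
  have hb0 : 0 ≤ b := (norm_nonneg _).trans (hb 0)
  rw [norm_le_iff p lam _ (by positivity)]
  intro n
  rw [norm_mahlerCoeff_eq]
  have h1 := hc k n 0 (Nat.zero_le _)
  have h0 : ⌊lam * ell p 0⌋₊ = 0 := by simp [ell]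
  rw [h0] at h1
  calc _ ≤ b * (p : ℝ) ^ d / (p : ℝ) ^ (n / p ^ k) *
        (p : ℝ) ^ ((n / p ^ k - 0) + 0 + (⌊lam * k⌋₊ + c)) := by
        refine mul_le_mul (norm_fwdDiff_iter_le_of_iter_eq_zero hb hd n 0)
          (pow_le_pow_right₀ hp1 h1) (by positivity) (by positivity)
    _ = _ := by
        rw [Nat.sub_zero, add_zero, pow_add, pow_add, pow_add]
        field_simp

theorem toZModPow_eq_iff_dvd {n : ℕ} {x y : ℤ_[p]} :
    PadicInt.toZModPow n x = PadicInt.toZModPow n y ↔ (p : ℤ_[p]) ^ n ∣ x - y := by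
  rw [← sub_eq_zero, ← map_sub, ← RingHom.mem_ker, PadicInt.ker_toZModPow,
    Ideal.mem_span_singleton]

theorem toZModPow_add_mul_pow (n : ℕ) (x y : ℤ_[p]) :
    PadicInt.toZModPow n (x + (p : ℤ_[p]) ^ n * y) = PadicInt.toZModPow n x := by
  rw [toZModPow_eq_iff_dvd, add_sub_cancel_left]
  exact dvd_mul_right _ _

theorem isLocallyConstant_toZModPow (n : ℕ) :
    IsLocallyConstant (PadicInt.toZModPow n : ℤ_[p] → ZMod (p ^ n)) := by
  rw [IsLocallyConstant.iff_eventually_eq]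
  intro x
  have hpos : (0 : ℝ) < (p : ℝ) ^ (-n : ℤ) :=
    zpow_pos (by exact_mod_cast (Fact.out : p.Prime).pos) _
  filter_upwards [Metric.closedBall_mem_nhds x hpos] with y hy
  rw [toZModPow_eq_iff_dvd, ← Ideal.mem_span_singleton, ← PadicInt.norm_le_pow_iff_mem_span_pow,
    ← dist_eq_norm]
  exact hy

/-- The function equal to the polynomial `u a` on the residue class of `a` modulo `p ^ n`. -/
noncomputable def locPolyFun (n : ℕ) (u : ZMod (p ^ n) → Polynomial ℚ_[p]) (x : ℤ_[p]) : ℚ_[p] :=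
  (u (PadicInt.toZModPow n x)).eval (x : ℚ_[p])

theorem continuous_locPolyFun (n : ℕ) (u : ZMod (p ^ n) → Polynomial ℚ_[p]) :
    Continuous (locPolyFun n u) := by
  rw [continuous_iff_continuousAt]
  intro x
  have h := (IsLocallyConstant.iff_eventually_eq _).1 (isLocallyConstant_toZModPow (p := p) n) x
  refine ContinuousAt.congr (f := fun y : ℤ_[p] => (u (PadicInt.toZModPow n x)).eval (y : ℚ_[p]))
    ?_ ?_
  · exact ((Polynomial.continuous _).comp continuous_subtype_val).continuousAt
  · filter_upwards [h] with y hy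
    rw [locPolyFun, hy]

/-- Steps of size `p ^ n` stay inside one residue class, where the function is a single polynomial.
-/
theorem fwdDiff_iter_locPolyFun_eq_zero {n d : ℕ} {u : ZMod (p ^ n) → Polynomial ℚ_[p]}
    (hu : ∀ a, (u a).natDegree < d) : (fwdDiff ((p : ℤ_[p]) ^ n))^[d] (locPolyFun n u) = 0 := by
  funext x
  set P : Polynomial ℚ_[p] := (u (PadicInt.toZModPow n x)).comp
    (Polynomial.C (x : ℚ_[p]) + Polynomial.C ((p : ℚ_[p]) ^ n) * Polynomial.X)
  have hP : P.natDegree < d := by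
    have : (Polynomial.C (x : ℚ_[p]) + Polynomial.C ((p : ℚ_[p]) ^ n) * Polynomial.X).natDegree
        ≤ 1 := by
      refine (Polynomial.natDegree_add_le _ _).trans (max_le (by simp) ?_)
      exact (Polynomial.natDegree_C_mul_le _ _).trans Polynomial.natDegree_X_le
    refine lt_of_le_of_lt (Polynomial.natDegree_comp_le.trans
      (Nat.mul_le_mul_left _ this)) ?_
    rw [mul_one]
    exact hu _
  have h := congrFun (Polynomial.fwdDiff_iter_eq_zero_of_degree_lt hP) 0
  rw [fwdDiff_iter_eq_sum_shift] at h
  rw [fwdDiff_iter_eq_sum_shift, Pi.zero_apply]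
  rw [Pi.zero_apply] at h
  rw [← h]
  refine Finset.sum_congr rfl fun k _ => ?_
  congr 1
  rw [locPolyFun, nsmul_eq_mul, mul_comm, toZModPow_add_mul_pow]
  simp [P, Polynomial.eval_comp]

variable (lam) in
/-- The function of order `lam` equal to the polynomial `u a` on the residue class of `a` modulo
`p ^ n`. -/
noncomputable def locPoly (n : ℕ) (u : ZMod (p ^ n) → Polynomial ℚ_[p]) : OrderFun p lam :=
  ⟨⟨locPolyFun n u, continuous_locPolyFun n u⟩, by
    have : NeZero (p ^ n) := ⟨pow_ne_zero n (Fact.out : p.Prime).ne_zero⟩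
    refine MahlerDecay.mem p lam (mahlerDecay_of_iter_eq_zero (k := n)
      (d := Finset.univ.sup fun a => (u a).natDegree)
      (b := ‖(⟨locPolyFun n u, continuous_locPolyFun n u⟩ : C(ℤ_[p], ℚ_[p]))‖)
      (fun x => ContinuousMap.norm_coe_le_norm _ x) ?_)
    exact fwdDiff_iter_locPolyFun_eq_zero fun a =>
      Nat.lt_succ_of_le (Finset.le_sup (f := fun a => (u a).natDegree) (Finset.mem_univ a))⟩

theorem locPoly_apply (n : ℕ) (u : ZMod (p ^ n) → Polynomial ℚ_[p]) (x : ℤ_[p]) :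
    locPoly lam n u x = (u (PadicInt.toZModPow n x)).eval (x : ℚ_[p]) := rfl

theorem exists_norm_locPoly_le (p : ℕ) [Fact p.Prime] {lam : ℝ} (hlam : 0 ≤ lam) (d : ℕ) :
    ∃ E : ℝ, 0 ≤ E ∧ ∀ (k : ℕ) (u : ZMod (p ^ k) → Polynomial ℚ_[p]) (b : ℝ),
      (∀ a, (u a).natDegree ≤ d) → (∀ x, ‖locPoly lam k u x‖ ≤ b) →
      ‖locPoly lam k u‖ ≤ E * b * (p : ℝ) ^ ⌊lam * k⌋₊ := by
  obtain ⟨E, hE, h⟩ := exists_norm_le_of_iter_eq_zero p hlam d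
  exact ⟨E, hE, fun k u b hd hb => h k _ b hb
    (fwdDiff_iter_locPolyFun_eq_zero fun a => Nat.lt_succ_of_le (hd a))⟩

end LocallyPolynomialFunctions

/-! ### Multiplication by periodic functions. -/

section Multiplication

variable {p : ℕ} [Fact p.Prime] {lam : ℝ}

theorem fwdDiff_iter_mul_of_periodic {u f : ℤ_[p] → ℚ_[p]} {q : ℤ_[p]}
    (hu : ∀ x y, u (x + y * q) = u x) (r : ℕ) :
    (fwdDiff q)^[r] (fun x => u x * f x) = fun x => u x * (fwdDiff q)^[r] f x := by
  funext x
  rw [fwdDiff_iter_eq_sum_shift, fwdDiff_iter_eq_sum_shift, Finset.mul_sum]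
  refine Finset.sum_congr rfl fun k _ => ?_
  rw [nsmul_eq_mul, hu, mul_smul_comm]

theorem inv_pow_le_mul {q : ℝ} (hq : 1 ≤ q) {a b c d : ℕ} (h : c ≤ a + b + d) :
    (q ^ a)⁻¹ ≤ q ^ b * ((q ^ c)⁻¹ * q ^ d) := by
  have hq0 : 0 < q := zero_lt_one.trans_le hq
  rw [inv_mul_eq_div, mul_div_assoc', inv_eq_one_div, div_le_div_iff₀ (by positivity)
    (by positivity), one_mul, ← pow_add, ← pow_add]
  exact pow_le_pow_right₀ hq (by omega)

/-- Multiplication by a periodic function preserves the growth condition on coefficients. -/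
theorem exists_norm_mahlerCoeff_mul_le (p : ℕ) [Fact p.Prime] {lam : ℝ} (hlam : 0 ≤ lam) (k : ℕ) :
    ∃ E : ℝ, 0 ≤ E ∧ ∀ (u f : ℤ_[p] → ℚ_[p]) (c : ℝ),
      (∀ x y, u (x + y * (p : ℤ_[p]) ^ k) = u x) → (∀ x, ‖u x‖ ≤ 1) → Continuous f →
      (∀ n, ‖mahlerCoeff p lam f n‖ ≤ c) →
      ∀ n, ‖mahlerCoeff p lam (fun x => u x * f x) n‖ ≤ E * c := by
  have hp1 : (1 : ℝ) ≤ p := by exact_mod_cast (Fact.out : p.Prime).one_le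
  have hp0 : (0 : ℝ) < p := zero_lt_one.trans_le hp1
  obtain ⟨c₀, hc₀⟩ := exists_floor_ell_le p hlam
  refine ⟨(p : ℝ) ^ (c₀ + (⌊lam * k⌋₊ + c₀)), by positivity, fun u f c hu hu1 hf hc n => ?_⟩
  have hc' : 0 ≤ c := (norm_nonneg _).trans (hc 0)
  have h1 : ∀ m x, ‖(fwdDiff (1 : ℤ_[p]))^[m] f x‖ ≤ c * ((p : ℝ) ^ ⌊lam * ell p m⌋₊)⁻¹ := by
    intro m x
    refine norm_fwdDiff_iter_le_of_zero hf (fun l hl =>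
      ((norm_mahlerCoeff_le_iff f l c).1 (hc l)).trans ?_) x
    gcongr ?_ * (?_)⁻¹
    exact pow_le_pow_right₀ hp1 (floor_ell_mono p lam hl)
  -- Passage to step-`p ^ k` differences: `hc₀` at level `0` shows that the permitted loss `p ^ (r -
  -- r')` covers the change of weight from `r'` to `r`, up to `c₀`.
  have h2 : ∀ r x, ‖(fwdDiff ((p : ℤ_[p]) ^ k))^[r] f x‖ ≤
      c * (p : ℝ) ^ c₀ * ((p : ℝ) ^ ⌊lam * ell p r⌋₊)⁻¹ := by
    intro r x
    refine norm_fwdDiff_pow_iter_le_of_mul (by positivity) (fun r' hr' y => (h1 _ y).trans ?_) x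
    have h3 := hc₀ 0 r r' (by simpa using hr')
    have h4 : ⌊lam * ell p r'⌋₊ ≤ ⌊lam * ell p (p ^ k * r')⌋₊ :=
      floor_ell_mono p lam (Nat.le_mul_of_pos_left _ (pow_pos (Fact.out : p.Prime).pos k))
    simp only [pow_zero, Nat.div_one, Nat.cast_zero, mul_zero, Nat.floor_zero, zero_add] at h3
    rw [mul_assoc, mul_assoc]
    refine mul_le_mul_of_nonneg_left ?_ hc'
    exact inv_pow_le_mul hp1 (by omega)
  set s := n / p ^ k
  -- A `p ^ k`-periodic factor commutes with step-`p ^ k` differences. The bound then returns to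
  -- step `1`, at the largest multiple of `p ^ k` not exceeding `n`.
  have h5 : ∀ x, ‖(fwdDiff (1 : ℤ_[p]))^[p ^ k * s] (fun x => u x * f x) x‖ ≤
      (p : ℝ) ^ (c₀ + (⌊lam * k⌋₊ + c₀)) * c * ((p : ℝ) ^ ⌊lam * ell p n⌋₊)⁻¹ := by
    refine norm_fwdDiff_mul_iter_le_of_pow (by positivity) fun r hr x => ?_
    rw [fwdDiff_iter_mul_of_periodic hu, norm_mul]
    refine (mul_le_mul (hu1 x) (h2 r x) (norm_nonneg _) zero_le_one).trans ?_
    have h3 := hc₀ k n r hr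
    rw [one_mul, mul_comm _ c, mul_assoc, mul_assoc, mul_assoc]
    refine mul_le_mul_of_nonneg_left ?_ hc'
    rw [← div_eq_mul_inv, inv_mul_eq_div, mul_div_assoc', div_le_div_iff₀ (by positivity)
      (by positivity), ← pow_add, ← pow_add, ← pow_add]
    exact pow_le_pow_right₀ hp1 (by omega)
  rw [norm_mahlerCoeff_le_iff]
  have e : n = n % p ^ k + p ^ k * s := (Nat.mod_add_div n (p ^ k)).symm
  conv_lhs => rw [e]
  rw [Function.iterate_add_apply]
  exact norm_fwdDiff_iter_le h5 1 _ 0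

end Multiplication

end PadicIwasawa

namespace PadicIwasawa

/-! ### Density of polynomials, and restriction to open sets. -/

section Density

variable {p : ℕ} [Fact p.Prime] {lam : ℝ}

/-- The Mahler series of a basis function has the single term `p ^ ⌊lam * ell n⌋ * binom(x, n)`, so
that finite combinations of basis functions are polynomials. -/
theorem exists_polynomial_basisFun (n : ℕ) :
    ∃ P : Polynomial ℚ_[p], ∀ x : ℤ_[p], basisFun lam n x = P.eval (x : ℚ_[p]) := by
  have hp : (p : ℚ_[p]) ≠ 0 := by exact_mod_cast (Fact.out : p.Prime).ne_zero
  set c : ℚ_[p] := (p : ℚ_[p]) ^ ⌊lam * ell p n⌋₊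
  have hD : ∀ m, (fwdDiff (1 : ℤ_[p]))^[m] (basisFun lam n) 0 = if m = n then c else 0 := by
    intro m
    have h := mahlerCoeff_basisFun (p := p) (lam := lam) n m
    rw [mahlerCoeff, Pi.single_apply, div_eq_iff (pow_ne_zero _ hp)] at h
    rw [h]
    split_ifs with hm
    · rw [one_mul, hm]
    · rw [zero_mul]
  have hv : ∀ x : ℤ_[p], basisFun lam n x = ((Ring.choose x n : ℤ_[p]) : ℚ_[p]) * c := by
    intro x
    have hs := PadicInt.hasSum_mahler (basisFun (p := p) lam n).1
    have h1 := (hs.mapL (ContinuousMap.evalCLM ℚ_[p] x)).tsum_eq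
    rw [tsum_eq_single n] at h1
    · change basisFun lam n x = _
      rw [ContinuousMap.evalCLM_apply, ContinuousMap.evalCLM_apply] at h1
      refine h1.symm.trans ?_
      rw [PadicInt.mahlerTerm_apply, mahler_apply]
      refine (congrArg _ (hD n)).trans ?_
      rw [if_pos rfl]
      rfl
    · intro m hm
      rw [ContinuousMap.evalCLM_apply, PadicInt.mahlerTerm_apply]
      refine (congrArg _ (hD m)).trans ?_
      rw [if_neg hm, smul_zero]
  have hf : (n.factorial : ℚ_[p]) ≠ 0 := Nat.cast_ne_zero.2 n.factorial_ne_zero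
  refine ⟨Polynomial.C (c / n.factorial) * descPochhammer ℚ_[p] n, fun x => ?_⟩
  have h1 := Ring.descPochhammer_eq_factorial_smul_choose x n
  have h2 : (descPochhammer ℚ_[p] n).eval (x : ℚ_[p]) =
      ((n.factorial • Ring.choose x n : ℤ_[p]) : ℚ_[p]) := by
    rw [← h1, ← descPochhammer_map (Int.castRingHom ℚ_[p]), Polynomial.eval_map,
      ← Polynomial.aeval_eq_smeval, Polynomial.aeval_def]
    have h3 := Polynomial.hom_eval₂ (descPochhammer ℤ n) (algebraMap ℤ ℤ_[p])
      (PadicInt.Coe.ringHom (p := p)) x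
    have h4 : (PadicInt.Coe.ringHom (p := p)).comp (algebraMap ℤ ℤ_[p]) = Int.castRingHom ℚ_[p] :=
      RingHom.ext_int _ _
    rw [h4] at h3
    exact h3.symm
  rw [hv, Polynomial.eval_mul, Polynomial.eval_C, h2, nsmul_eq_mul]
  push_cast
  field_simp

variable (lam) in
/-- A polynomial, as a function of order `lam`. -/
noncomputable def polyFun (P : Polynomial ℚ_[p]) : OrderFun p lam := locPoly lam 0 fun _ => P

@[simp] theorem polyFun_apply (P : Polynomial ℚ_[p]) (x : ℤ_[p]) :
    polyFun lam P x = P.eval (x : ℚ_[p]) := rfl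

theorem exists_norm_sub_polyFun_lt (f : OrderFun p lam) {ε : ℝ} (hε : 0 < ε) :
    ∃ P : Polynomial ℚ_[p], ‖f - polyFun lam P‖ < ε := by
  have h := (hasSum_basisFun f).tendsto_sum_nat
  obtain ⟨N, hN⟩ := Metric.tendsto_atTop.1 h ε hε
  choose P hP using exists_polynomial_basisFun (p := p) (lam := lam)
  refine ⟨∑ i ∈ Finset.range N, Polynomial.C (mahlerCoeff p lam f i) * P i, ?_⟩
  have e : polyFun lam (∑ i ∈ Finset.range N, Polynomial.C (mahlerCoeff p lam f i) * P i) =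
      ∑ i ∈ Finset.range N, mahlerCoeff p lam f i • basisFun lam i := by
    refine OrderFun.ext fun x => ?_
    rw [polyFun_apply, Polynomial.eval_finsetSum, OrderFun.sum_apply]
    refine Finset.sum_congr rfl fun i _ => ?_
    rw [Polynomial.eval_mul, Polynomial.eval_C, OrderFun.smul_apply, hP]
  rw [e, ← dist_eq_norm, dist_comm]
  exact hN N le_rfl

/-- Restriction of functions of order `lam` to a union of residue classes. -/
theorem exists_restrict (hlam : 0 ≤ lam) {k : ℕ} {U : Set ℤ_[p]}
    (hU : ∀ x y : ℤ_[p], x + y * (p : ℤ_[p]) ^ k ∈ U ↔ x ∈ U) :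
    ∃ T : OrderFun p lam →L[ℚ_[p]] OrderFun p lam, ∀ f x, T f x = U.indicator f x := by
  classical
  obtain ⟨E, hE, hmul⟩ := exists_norm_mahlerCoeff_mul_le p hlam k
  set u : ℤ_[p] → ℚ_[p] := U.indicator fun _ => 1
  have hu : ∀ x y, u (x + y * (p : ℤ_[p]) ^ k) = u x := fun x y => by
    simp only [u, Set.indicator_apply, hU]
  have hu1 : ∀ x, ‖u x‖ ≤ 1 := fun x => by
    simp only [u, Set.indicator_apply]
    split_ifs <;> simp
  have hmul' := fun (f : OrderFun p lam) => hmul u f ‖f‖ hu hu1 f.continuous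
    (norm_mahlerCoeff_le p lam f)
  have huf : ∀ f : ℤ_[p] → ℚ_[p], (fun x => u x * f x) = U.indicator f := fun f => by
    funext x
    simp only [u, Set.indicator_apply]
    split_ifs <;> simp
  have hcls : ∀ x y : ℤ_[p], PadicInt.toZModPow k x = PadicInt.toZModPow k y → (x ∈ U ↔ y ∈ U) := by
    intro x y h
    obtain ⟨z, hz⟩ := toZModPow_eq_iff_dvd.1 h
    have : x = y + z * (p : ℤ_[p]) ^ k := by rw [mul_comm, ← hz]; ring
    rw [this, hU]
  have hcont : ∀ f : OrderFun p lam, Continuous (U.indicator f) := fun f => by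
    rw [← huf]
    refine Continuous.mul (IsLocallyConstant.continuous ?_) f.continuous
    rw [IsLocallyConstant.iff_eventually_eq]
    intro x
    filter_upwards [(IsLocallyConstant.iff_eventually_eq _).1 (isLocallyConstant_toZModPow k) x]
      with y hy
    simp only [u, Set.indicator_apply, hcls _ _ hy]
  -- The bound `hmul` only shows that the coefficients of the restriction are bounded. That they
  -- tend to zero is clear for polynomials, whose restrictions are locally polynomial, and passes to
  -- all `f` by density.
  have hpoly : ∀ P : Polynomial ℚ_[p],
      Tendsto (mahlerCoeff p lam (U.indicator (polyFun lam P))) atTop (𝓝 0) := by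
    intro P
    set v : ZMod (p ^ k) → Polynomial ℚ_[p] := fun a =>
      if ∃ x ∈ U, PadicInt.toZModPow k x = a then P else 0
    have : U.indicator (polyFun lam P) = locPoly lam k v := by
      funext x
      rw [locPoly_apply, Set.indicator_apply]
      by_cases hx : x ∈ U
      · have hv : v (PadicInt.toZModPow k x) = P := if_pos ⟨x, hx, rfl⟩
        rw [if_pos hx, hv, polyFun_apply]
      · have hv : v (PadicInt.toZModPow k x) = 0 := if_neg fun ⟨y, hy, hyx⟩ =>
          hx ((hcls _ _ hyx).1 hy)
        rw [if_neg hx, hv, Polynomial.eval_zero]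
    rw [this]
    exact tendsto_mahlerCoeff _
  have hmem : ∀ f : OrderFun p lam,
      (⟨U.indicator f, hcont f⟩ : C(ℤ_[p], ℚ_[p])) ∈ orderSubmodule p lam := by
    intro f
    change Tendsto (mahlerCoeff p lam (U.indicator f)) atTop (𝓝 0)
    rw [Metric.tendsto_atTop]
    intro ε hε
    obtain ⟨P, hP⟩ := exists_norm_sub_polyFun_lt f (ε := ε / 2 / (E + 1)) (by positivity)
    obtain ⟨N, hN⟩ := Metric.tendsto_atTop.1 (hpoly P) ε hε
    refine ⟨N, fun n hn => ?_⟩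
    have e : U.indicator f = U.indicator (f - polyFun lam P : OrderFun p lam) +
        U.indicator (polyFun lam P) := by
      rw [← Set.indicator_add']
      congr 1
      funext x
      simp
    rw [dist_zero_right, e, mahlerCoeff_add]
    refine lt_of_le_of_lt (IsUltrametricDist.norm_add_le_max _ _) (max_lt ?_ ?_)
    · have h1 := hmul' (f - polyFun lam P) n
      rw [huf] at h1
      refine lt_of_le_of_lt h1 ?_
      have h2 : E * ‖f - polyFun lam P‖ ≤ E * (ε / 2 / (E + 1)) :=
        mul_le_mul_of_nonneg_left hP.le hE
      have h3 : E * (ε / 2 / (E + 1)) ≤ ε / 2 := by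
        rw [mul_div_assoc', div_le_iff₀ (by positivity)]
        nlinarith
      linarith
    · simpa using hN n hn
  let T₀ : OrderFun p lam →ₗ[ℚ_[p]] OrderFun p lam :=
    { toFun := fun f => ⟨⟨U.indicator f, hcont f⟩, hmem f⟩
      map_add' := fun f g => OrderFun.ext fun x => congrFun (Set.indicator_add' U f g) x
      map_smul' := fun c f => OrderFun.ext fun x => congrFun (Set.indicator_const_smul U c f) x }
  refine ⟨T₀.mkContinuous E fun f => ?_, fun f x => rfl⟩
  rw [norm_le_iff p lam _ (by positivity)]
  intro n
  have h1 := hmul' f n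
  rw [huf] at h1
  exact h1

end Density

/-! ### Lagrange interpolation on balls. -/

section LagrangeInterpolation

variable {p : ℕ} [Fact p.Prime]

open Polynomial in
/-- Polynomials of degree at most `h` are combinations of the powers `(X - c) ^ h`. -/
theorem exists_eq_sum_sub_pow (F : Type*) [NormedField F] [CharZero F] (h : ℕ) :
    ∃ D : ℝ, 0 ≤ D ∧ ∀ (u : F[X]) (b : ℝ), u.natDegree ≤ h →
      (∀ r ≤ h, ‖u.eval (r : F)‖ ≤ b) →
      ∃ w : Fin (h + 1) → F, (∀ c, ‖w c‖ ≤ D * b) ∧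
        u = ∑ c : Fin (h + 1), C (w c) * (X - C ((c : ℕ) : F)) ^ h := by
  set N : Matrix (Fin (h + 1)) (Fin (h + 1)) F := .of fun r c => (((r : ℕ) : F) - (c : ℕ)) ^ h
  set V : Matrix (Fin (h + 1)) (Fin (h + 1)) F := Matrix.vandermonde fun r => ((r : ℕ) : F)
  set W : Matrix (Fin (h + 1)) (Fin (h + 1)) F := Matrix.vandermonde fun r => -((r : ℕ) : F)
  have hV : V.det ≠ 0 := by
    rw [Matrix.det_vandermonde_ne_zero_iff]
    exact fun a b hab => Fin.ext (Nat.cast_injective hab)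
  have hW : W.det ≠ 0 := by
    rw [Matrix.det_vandermonde_ne_zero_iff]
    exact fun a b hab => Fin.ext (Nat.cast_injective (neg_injective hab))
  -- Expanding `(r - c) ^ h` by the binomial theorem factors `N` into a Vandermonde matrix, the
  -- diagonal of binomial coefficients and a column-reversed Vandermonde matrix, all invertible in
  -- characteristic zero.
  have hN : N = V * Matrix.diagonal (fun j : Fin (h + 1) => (h.choose j : F)) *
      (W.submatrix id Fin.revPerm).transpose := by
    ext r c
    rw [Matrix.mul_apply]
    simp only [N, V, W, Matrix.of_apply, Matrix.mul_diagonal, Matrix.vandermonde_apply,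
      Matrix.transpose_apply, Matrix.submatrix_apply, id, Fin.revPerm_apply, Fin.val_rev]
    rw [sub_eq_add_neg, add_pow, ← Fin.sum_univ_eq_sum_range
      (fun m => ((r : ℕ) : F) ^ m * (-((c : ℕ) : F)) ^ (h - m) * (h.choose m : F))]
    refine Finset.sum_congr rfl fun j _ => ?_
    rw [show h + 1 - ((j : ℕ) + 1) = h - j by omega]
    ring
  have hdet : IsUnit N.det := by
    rw [hN, Matrix.det_mul, Matrix.det_mul, Matrix.det_transpose, Matrix.det_permute',
      Matrix.det_diagonal]
    refine isUnit_iff_ne_zero.2 (mul_ne_zero (mul_ne_zero hV ?_) (mul_ne_zero ?_ hW))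
    · exact Finset.prod_ne_zero_iff.2 fun j _ =>
        Nat.cast_ne_zero.2 (Nat.choose_pos (Nat.lt_succ_iff.1 j.2)).ne'
    · exact_mod_cast Units.ne_zero _
  refine ⟨∑ c, ∑ r, ‖N⁻¹ c r‖, by positivity, fun u b hu hb => ?_⟩
  have hb0 : 0 ≤ b := (norm_nonneg _).trans (hb 0 (Nat.zero_le _))
  set v : Fin (h + 1) → F := fun r => u.eval ((r : ℕ) : F)
  refine ⟨N⁻¹.mulVec v, fun c => ?_, ?_⟩
  · refine (norm_sum_le Finset.univ fun r => N⁻¹ c r * v r).trans ?_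
    calc _ ≤ ∑ r, ‖N⁻¹ c r‖ * b := Finset.sum_le_sum fun r _ => by
          rw [norm_mul]
          exact mul_le_mul_of_nonneg_left (hb r (Nat.lt_succ_iff.1 r.2)) (norm_nonneg _)
      _ = (∑ r, ‖N⁻¹ c r‖) * b := (Finset.sum_mul ..).symm
      _ ≤ _ := mul_le_mul_of_nonneg_right
          (Finset.single_le_sum (f := fun c => ∑ r, ‖N⁻¹ c r‖)
            (fun _ _ => Finset.sum_nonneg fun _ _ => norm_nonneg _) (Finset.mem_univ c)) hb0
  · have hv : N.mulVec (N⁻¹.mulVec v) = v := by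
      rw [Matrix.mulVec_mulVec, Matrix.mul_nonsing_inv _ hdet, Matrix.one_mulVec]
    refine Polynomial.eq_of_natDegree_lt_card_of_eval_eq _ _
      (f := fun r : Fin (h + 1) => ((r : ℕ) : F))
      (fun a b hab => Fin.ext (Nat.cast_injective hab)) (fun r => ?_) ?_
    · refine (congrFun hv r).symm.trans ?_
      rw [Matrix.mulVec, dotProduct, Polynomial.eval_finsetSum]
      refine Finset.sum_congr rfl fun c _ => ?_
      simp [N, mul_comm]
    · rw [Fintype.card_fin]
      refine max_lt (Nat.lt_succ_of_le hu) (Nat.lt_succ_of_le ?_)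
      refine Polynomial.natDegree_sum_le_of_forall_le _ _ fun c _ => ?_
      refine (natDegree_C_mul_le _ _).trans ((natDegree_pow_le).trans ?_)
      rw [natDegree_X_sub_C, mul_one]

/-- The polynomial of degree at most `h` agreeing with `f` at `a + p ^ k * i` for `0 ≤ i ≤ h`. -/
noncomputable def interpPoly (h k : ℕ) (a : ℤ_[p]) :
    (ℤ_[p] → ℚ_[p]) →ₗ[ℚ_[p]] Polynomial ℚ_[p] :=
  (Lagrange.interpolate (Finset.range (h + 1))
    (fun i : ℕ => ((a + (p : ℤ_[p]) ^ k * i : ℤ_[p]) : ℚ_[p]))).comp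
    (LinearMap.funLeft ℚ_[p] ℚ_[p] fun i : ℕ => a + (p : ℤ_[p]) ^ k * i)

theorem injective_nodes (k : ℕ) (a : ℤ_[p]) :
    Function.Injective fun i : ℕ => ((a + (p : ℤ_[p]) ^ k * i : ℤ_[p]) : ℚ_[p]) := by
  intro i j hij
  have hp : (p : ℤ_[p]) ≠ 0 := by exact_mod_cast (Fact.out : p.Prime).ne_zero
  have h1 := Subtype.coe_injective hij
  exact Nat.cast_injective (mul_left_cancel₀ (pow_ne_zero k hp) (add_left_cancel h1))

theorem natDegree_interpPoly_le (h k : ℕ) (a : ℤ_[p]) (f : ℤ_[p] → ℚ_[p]) :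
    (interpPoly h k a f).natDegree ≤ h := by
  have := Lagrange.degree_interpolate_lt (s := Finset.range (h + 1))
    (fun i : ℕ => f (a + (p : ℤ_[p]) ^ k * i)) (injective_nodes k a).injOn
  rw [Finset.card_range] at this
  exact Polynomial.natDegree_le_of_degree_le (Order.le_of_lt_succ this)

theorem eval_interpPoly {h k : ℕ} (a : ℤ_[p]) (f : ℤ_[p] → ℚ_[p]) {i : ℕ} (hi : i ≤ h) :
    (interpPoly h k a f).eval ((a + (p : ℤ_[p]) ^ k * i : ℤ_[p]) : ℚ_[p]) =
      f (a + (p : ℤ_[p]) ^ k * i) :=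
  Lagrange.eval_interpolate_at_node (fun i : ℕ => f (a + (p : ℤ_[p]) ^ k * i))
    (injective_nodes k a).injOn (Finset.mem_range.2 (Nat.lt_succ_of_le hi))

theorem eq_interpPoly {h k : ℕ} {a : ℤ_[p]} {f : ℤ_[p] → ℚ_[p]} {u : Polynomial ℚ_[p]}
    (hu : u.natDegree ≤ h) (huf : ∀ i ≤ h, u.eval ((a + (p : ℤ_[p]) ^ k * (i : ℕ) : ℤ_[p]) : ℚ_[p]) =
      f (a + (p : ℤ_[p]) ^ k * i)) : u = interpPoly h k a f := by
  refine Lagrange.eq_interpolate_of_eval_eq _ (injective_nodes k a).injOn ?_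
    fun i hi => huf i (Nat.lt_succ_iff.1 (Finset.mem_range.1 hi))
  rw [Finset.card_range]
  exact lt_of_le_of_lt Polynomial.degree_le_natDegree (by exact_mod_cast Nat.lt_succ_of_le hu)

theorem fwdDiff_iter_comp_affine (f : ℤ_[p] → ℚ_[p]) (a q : ℤ_[p]) (i : ℕ) :
    (fwdDiff (1 : ℤ_[p]))^[i] (fun t => f (a + q * t)) 0 = (fwdDiff q)^[i] f a := by
  rw [fwdDiff_iter_eq_sum_shift, fwdDiff_iter_eq_sum_shift]
  refine Finset.sum_congr rfl fun j _ => ?_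
  simp [mul_comm]

/-- The error of Lagrange interpolation for functions of order `lam`. -/
theorem norm_sub_eval_interpPoly_le {lam : ℝ} (hlam : 0 ≤ lam) {h : ℕ} (hh : lam ≤ h + 1)
    {f : ℤ_[p] → ℚ_[p]} (hf : Continuous f) {c : ℝ}
    (hc : ∀ s, ‖(fwdDiff (1 : ℤ_[p]))^[s] f 0‖ ≤ c * ((p : ℝ) ^ ⌊lam * ell p s⌋₊)⁻¹)
    (k : ℕ) (a t : ℤ_[p]) :
    ‖f (a + (p : ℤ_[p]) ^ k * t) -
        (interpPoly h k a f).eval ((a + (p : ℤ_[p]) ^ k * t : ℤ_[p]) : ℚ_[p])‖ ≤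
      c * ((p : ℝ) ^ ⌊lam * (k + 1 : ℕ)⌋₊)⁻¹ := by
  have hc0 : 0 ≤ c := by
    have hp0 : (0 : ℝ) < p := by exact_mod_cast (Fact.out : p.Prime).pos
    exact nonneg_of_mul_nonneg_left ((norm_nonneg _).trans (hc 0)) (by positivity)
  set P := interpPoly h k a f
  set g : ℤ_[p] → ℚ_[p] := fun x => f x - P.eval (x : ℚ_[p])
  have hg : Continuous g := hf.sub ((Polynomial.continuous _).comp continuous_subtype_val)
  have hgz : ∀ i ≤ h, g (a + (p : ℤ_[p]) ^ k * (i : ℕ)) = 0 := fun i hi => by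
    simp only [g, P]
    rw [eval_interpPoly a f hi, sub_self]
  have hP : ∀ i, h + 1 ≤ i → (fwdDiff ((p : ℤ_[p]) ^ k))^[i]
      (fun x : ℤ_[p] => P.eval (x : ℚ_[p])) = 0 := fun i hi => by
    have := fwdDiff_iter_locPolyFun_eq_zero (n := k) (d := i) (u := fun _ => P)
      (fun _ => lt_of_le_of_lt (natDegree_interpPoly_le h k a f) hi)
    exact this
  refine norm_le_of_norm_fwdDiff_zero_le (f := fun t => g (a + (p : ℤ_[p]) ^ k * t))
    (by fun_prop) (fun i => ?_) t
  -- These are the Mahler coefficients of the error in the coordinate `t`. Up to index `h` they only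
  -- involve the nodes, where the error vanishes. Beyond `h` the interpolant drops out and the order
  -- of the difference exceeds `lam`, so that `norm_fwdDiff_pow_iter_le` applies to `f`.
  rcases Nat.lt_or_ge h i with hi | hi
  · have e : g = f + (-1 : ℚ_[p]) • fun x : ℤ_[p] => P.eval (x : ℚ_[p]) := by
      funext x
      simp [g, sub_eq_add_neg]
    rw [fwdDiff_iter_comp_affine, e, fwdDiff_iter_add, fwdDiff_iter_const_smul, hP i hi,
      smul_zero, add_zero]
    exact norm_fwdDiff_pow_iter_le hlam hf hc (hh.trans (by exact_mod_cast hi)) k a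
  · rw [fwdDiff_iter_eq_sum_shift, Finset.sum_eq_zero, norm_zero]
    · positivity
    · intro j hj
      have hj' : j ≤ h := (Nat.lt_succ_iff.1 (Finset.mem_range.1 hj)).trans hi
      rw [zero_add, nsmul_one, hgz j hj', smul_zero]

end LagrangeInterpolation

end PadicIwasawa

namespace PadicIwasawa

/-! ### Integration against growing systems of ball integrals. -/

section BallSystems

variable {p : ℕ} [Fact p.Prime] {lam : ℝ} {h m₀ : ℕ} {R : ℝ}
  {Y : Type*} [NormedAddCommGroup Y] [NormedSpace ℚ_[p] Y]

theorem toZModPow_val {k : ℕ} (a : ZMod (p ^ k)) :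
    PadicInt.toZModPow k ((a.val : ℕ) : ℤ_[p]) = a := by
  rw [map_natCast, ZMod.natCast_zmod_val]

theorem toZModPow_surjective (k : ℕ) :
    Function.Surjective (PadicInt.toZModPow k : ℤ_[p] → ZMod (p ^ k)) :=
  fun a => ⟨_, toZModPow_val a⟩

/-- A finitely additive system of integrals over the residue classes modulo all `p ^ k` of
polynomials of degree at most `h`, of growth of order `lam` from the level `m₀` on. -/
structure IsBallSystem (lam : ℝ) (h m₀ : ℕ) (R : ℝ)
    (m : ∀ k, ZMod (p ^ k) → Polynomial ℚ_[p] →ₗ[ℚ_[p]] Y) : Prop where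
  nonneg : 0 ≤ R
  add : ∀ k a u, u.natDegree ≤ h →
    m k a u = ∑ b : ZMod (p ^ (k + 1)) with (b.cast : ZMod (p ^ k)) = a, m (k + 1) b u
  bound : ∀ k, m₀ ≤ k → ∀ a u b, u.natDegree ≤ h →
    (∀ i ≤ h, ‖u.eval ((((a.val : ℕ) : ℤ_[p]) + (p : ℤ_[p]) ^ k * (i : ℕ) : ℤ_[p]) : ℚ_[p])‖ ≤ b) →
    ‖m k a u‖ ≤ R * (p : ℝ) ^ ⌊lam * k⌋₊ * b

variable {m : ∀ k, ZMod (p ^ k) → Polynomial ℚ_[p] →ₗ[ℚ_[p]] Y}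

theorem IsBallSystem.sum_eq (hm : IsBallSystem lam h m₀ R m) (n : ℕ)
    (u : ZMod (p ^ n) → Polynomial ℚ_[p]) (hu : ∀ a, (u a).natDegree ≤ h) {k : ℕ} (hk : n ≤ k) :
    ∑ a, m n a (u a) = ∑ b : ZMod (p ^ k), m k b (u b.cast) := by
  induction k, hk using Nat.le_induction with
  | base => simp
  | succ k hk ih =>
    rw [ih, ← Finset.sum_fiberwise (s := Finset.univ)
      (g := fun b : ZMod (p ^ (k + 1)) => (b.cast : ZMod (p ^ k)))]
    refine Finset.sum_congr rfl fun a _ => ?_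
    rw [hm.add k a _ (hu _)]
    refine Finset.sum_congr rfl fun b hb => ?_
    rw [← (Finset.mem_filter.1 hb).2]
    obtain ⟨x, rfl⟩ := toZModPow_surjective (k + 1) b
    rw [PadicInt.cast_toZModPow k (k + 1) k.le_succ, PadicInt.cast_toZModPow n k hk,
      PadicInt.cast_toZModPow n (k + 1) (hk.trans k.le_succ)]

theorem locPoly_cast (lam : ℝ) {n k : ℕ} (hk : n ≤ k) (u : ZMod (p ^ n) → Polynomial ℚ_[p]) :
    locPoly lam n u = locPoly lam k fun b => u b.cast :=
  OrderFun.ext fun x => by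
    rw [locPoly_apply, locPoly_apply, PadicInt.cast_toZModPow n k hk]

/-- The Riemann sums of level `k` of a ball system. -/
noncomputable def riemannSum (m : ∀ k, ZMod (p ^ k) → Polynomial ℚ_[p] →ₗ[ℚ_[p]] Y) (h k : ℕ) :
    (ℤ_[p] → ℚ_[p]) →ₗ[ℚ_[p]] Y :=
  ∑ a, (m k a).comp (interpPoly h k ((a.val : ℕ) : ℤ_[p]))

theorem riemannSum_apply (k : ℕ) (f : ℤ_[p] → ℚ_[p]) :
    riemannSum m h k f = ∑ a, m k a (interpPoly h k ((a.val : ℕ) : ℤ_[p]) f) := by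
  simp [riemannSum]

theorem riemannSum_locPoly (n : ℕ) (u : ZMod (p ^ n) → Polynomial ℚ_[p])
    (hu : ∀ a, (u a).natDegree ≤ h) :
    riemannSum m h n (locPoly lam n u) = ∑ a, m n a (u a) := by
  rw [riemannSum_apply]
  refine Finset.sum_congr rfl fun a _ => ?_
  congr 1
  refine (eq_interpPoly (hu a) fun i _ => ?_).symm
  rw [locPoly_apply, toZModPow_add_mul_pow, toZModPow_val]

theorem IsBallSystem.riemannSum_locPoly_of_le (hm : IsBallSystem lam h m₀ R m) {n k : ℕ}
    (hk : n ≤ k) (u : ZMod (p ^ n) → Polynomial ℚ_[p]) (hu : ∀ a, (u a).natDegree ≤ h) :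
    riemannSum m h k (locPoly lam n u) = ∑ a, m n a (u a) := by
  rw [locPoly_cast lam hk, riemannSum_locPoly k _ fun _ => hu _, hm.sum_eq n u hu hk]

variable [IsUltrametricDist Y]

/-- The interpolant equals `f` at the nodes, which is where `bound` measures polynomials. Only
classes with nonzero integral count; this later gives the support of the distribution. -/
theorem IsBallSystem.norm_riemannSum_le (hm : IsBallSystem lam h m₀ R m) {k : ℕ} (hk : m₀ ≤ k)
    {f : ℤ_[p] → ℚ_[p]} {b : ℝ} (hb : 0 ≤ b)
    (hf : ∀ x, m k (PadicInt.toZModPow k x) ≠ 0 → ‖f x‖ ≤ b) :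
    ‖riemannSum m h k f‖ ≤ R * (p : ℝ) ^ ⌊lam * k⌋₊ * b := by
  have hR := hm.nonneg
  rw [riemannSum_apply]
  refine IsUltrametricDist.norm_sum_le_of_forall_le_of_nonneg (by positivity) fun a _ => ?_
  by_cases ha : m k a = 0
  · rw [ha, LinearMap.zero_apply, norm_zero]
    positivity
  · refine hm.bound k hk a _ b (natDegree_interpPoly_le _ _ _ _) fun i hi => ?_
    rw [eval_interpPoly _ _ hi]
    refine hf _ ?_
    rwa [toZModPow_add_mul_pow, toZModPow_val]

/-- By additivity both sums can be written at level `k + 1`. At the nodes of that level the two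
interpolants differ by the level-`k` interpolation error of `f`. -/
theorem IsBallSystem.norm_riemannSum_succ_sub_le (hm : IsBallSystem lam h m₀ R m) {k : ℕ}
    (hk : m₀ ≤ k) {f : ℤ_[p] → ℚ_[p]} {e : ℝ} (he : 0 ≤ e)
    (hf : ∀ a t : ℤ_[p], ‖f (a + (p : ℤ_[p]) ^ k * t) -
      (interpPoly h k a f).eval ((a + (p : ℤ_[p]) ^ k * t : ℤ_[p]) : ℚ_[p])‖ ≤ e) :
    ‖riemannSum m h (k + 1) f - riemannSum m h k f‖ ≤
      R * (p : ℝ) ^ ⌊lam * (k + 1 : ℕ)⌋₊ * e := by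
  have hR := hm.nonneg
  rw [riemannSum_apply, riemannSum_apply, hm.sum_eq k (fun a => interpPoly h k ((a.val : ℕ) : ℤ_[p]) f)
    (fun a => natDegree_interpPoly_le _ _ _ _) k.le_succ, ← Finset.sum_sub_distrib]
  refine IsUltrametricDist.norm_sum_le_of_forall_le_of_nonneg (by positivity) fun b _ => ?_
  rw [← map_sub]
  refine hm.bound (k + 1) (hk.trans k.le_succ) b _ e ((Polynomial.natDegree_sub_le _ _).trans
    (max_le (natDegree_interpPoly_le _ _ _ _) (natDegree_interpPoly_le _ _ _ _))) fun i hi => ?_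
  rw [Polynomial.eval_sub, eval_interpPoly _ _ hi]
  set x : ℤ_[p] := ((b.val : ℕ) : ℤ_[p]) + (p : ℤ_[p]) ^ (k + 1) * (i : ℕ)
  set a : ZMod (p ^ k) := b.cast
  have hxa : PadicInt.toZModPow k x = PadicInt.toZModPow k ((a.val : ℕ) : ℤ_[p]) := by
    rw [toZModPow_val]
    have : x = ((b.val : ℕ) : ℤ_[p]) + (p : ℤ_[p]) ^ k * ((p : ℤ_[p]) * (i : ℕ)) := by
      simp only [x]; ring
    rw [this, toZModPow_add_mul_pow,
      ← PadicInt.cast_toZModPow k (k + 1) k.le_succ, toZModPow_val]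
  obtain ⟨t, ht⟩ := toZModPow_eq_iff_dvd.1 hxa
  have hx : x = ((a.val : ℕ) : ℤ_[p]) + (p : ℤ_[p]) ^ k * t := by rw [← ht]; ring
  rw [hx]
  exact hf _ t

/-- A ball system integrates all functions of order `lam`. -/
theorem IsBallSystem.exists_distribution [CompleteSpace Y] (hlam : 0 ≤ lam) (hh : lam < h + 1)
    (hm : IsBallSystem lam h m₀ R m) :
    ∃ φ : OrderFun p lam →L[ℚ_[p]] Y,
      (∀ f : OrderFun p lam, Tendsto (fun k => riemannSum m h k f) atTop (𝓝 (φ f))) ∧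
      (∀ f : OrderFun p lam, ∀ k, m₀ ≤ k → ‖φ f - riemannSum m h k f‖ ≤ R * ‖f‖) ∧
      ∀ n (u : ZMod (p ^ n) → Polynomial ℚ_[p]), (∀ a, (u a).natDegree ≤ h) →
        φ (locPoly lam n u) = ∑ a, m n a (u a) := by
  have hR := hm.nonneg
  have hp1 : (1 : ℝ) < p := by exact_mod_cast (Fact.out : p.Prime).one_lt
  have hp0 : (0 : ℝ) < p := zero_lt_one.trans hp1
  -- The two powers of `p` cancel exactly, so the steps are bounded; this alone does not make them
  -- tend to zero.
  have hstep : ∀ f : OrderFun p lam, ∀ k, m₀ ≤ k →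
      ‖riemannSum m h (k + 1) f - riemannSum m h k f‖ ≤ R * ‖f‖ := by
    intro f k hk
    have h1 := norm_sub_eval_interpPoly_le hlam hh.le f.continuous (norm_fwdDiff_zero_le f) k
    refine (hm.norm_riemannSum_succ_sub_le hk (by positivity) h1).trans (le_of_eq ?_)
    field_simp
  -- A polynomial is also of order `h + 1`, with interpolation error `p ^ (-(h + 1) (k + 1))` up to
  -- a constant, and `lam < h + 1` makes the steps decay geometrically.
  have hpoly : ∀ P : Polynomial ℚ_[p], Tendsto (fun k => riemannSum m h (k + 1) (polyFun lam P) -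
      riemannSum m h k (polyFun lam P)) atTop (𝓝 0) := by
    intro P
    set c := ‖polyFun ((h + 1 : ℕ) : ℝ) P‖
    have h1 := fun k => norm_sub_eval_interpPoly_le (h := h) (Nat.cast_nonneg (h + 1))
      (by push_cast; exact le_rfl)
      (polyFun ((h + 1 : ℕ) : ℝ) P).continuous
      (norm_fwdDiff_zero_le (polyFun ((h + 1 : ℕ) : ℝ) P)) k
    have h2 : Tendsto (fun k : ℕ => R * c * ((p : ℝ) ^ (lam - (h + 1))) ^ (k + 1)) atTop (𝓝 0) := by
      have : (p : ℝ) ^ (lam - (h + 1)) < 1 :=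
        Real.rpow_lt_one_of_one_lt_of_neg hp1 (by linarith)
      have h3 := (tendsto_pow_atTop_nhds_zero_of_lt_one (by positivity) this).comp
        (tendsto_add_atTop_nat 1)
      simpa using h3.const_mul (R * c)
    refine squeeze_zero_norm' ?_ h2
    filter_upwards [eventually_ge_atTop m₀] with k hk
    refine (hm.norm_riemannSum_succ_sub_le hk (by positivity) (h1 k)).trans ?_
    have e1 : ⌊((h + 1 : ℕ) : ℝ) * ((k + 1 : ℕ) : ℝ)⌋₊ = (h + 1) * (k + 1) := by
      rw [← Nat.cast_mul, Nat.floor_natCast]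
    rw [e1]
    have h4 : (p : ℝ) ^ ⌊lam * (k + 1 : ℕ)⌋₊ ≤ (p : ℝ) ^ (lam * (k + 1 : ℕ)) := by
      rw [← Real.rpow_natCast]
      exact Real.rpow_le_rpow_of_exponent_le hp1.le (Nat.floor_le (by positivity))
    have h5 : ((p : ℝ) ^ (lam - (h + 1))) ^ (k + 1) =
        (p : ℝ) ^ (lam * (k + 1 : ℕ)) * ((p : ℝ) ^ ((h + 1) * (k + 1)))⁻¹ := by
      rw [← Real.rpow_natCast, ← Real.rpow_natCast, ← Real.rpow_mul hp0.le, ← Real.rpow_neg hp0.le,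
        ← Real.rpow_add hp0]
      congr 1
      push_cast
      ring
    rw [h5]
    calc _ = R * c * ((p : ℝ) ^ ⌊lam * (k + 1 : ℕ)⌋₊ * ((p : ℝ) ^ ((h + 1) * (k + 1)))⁻¹) := by
          simp only [c]; ring
      _ ≤ _ := by gcongr
  have hdiff : ∀ f : OrderFun p lam, Tendsto (fun k => riemannSum m h (k + 1) f -
      riemannSum m h k f) atTop (𝓝 0) := by
    intro f
    rw [Metric.tendsto_atTop]
    intro ε hε
    obtain ⟨P, hP⟩ := exists_norm_sub_polyFun_lt f (ε := ε / (R + 1)) (by positivity)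
    obtain ⟨N, hN⟩ := Metric.tendsto_atTop.1 (hpoly P) ε hε
    refine ⟨max N m₀, fun k hk => ?_⟩
    have e : ∀ l, riemannSum m h l f = riemannSum m h l (f - polyFun lam P : OrderFun p lam) +
        riemannSum m h l (polyFun lam P) := fun l => by
      rw [← map_add]
      congr 1
      funext x
      simp
    rw [dist_zero_right, e, e, add_sub_add_comm]
    refine lt_of_le_of_lt (IsUltrametricDist.norm_add_le_max _ _) (max_lt ?_ ?_)
    · refine lt_of_le_of_lt (hstep _ k ((le_max_right _ _).trans hk)) ?_
      have h2 : R * ‖f - polyFun lam P‖ ≤ R * (ε / (R + 1)) :=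
        mul_le_mul_of_nonneg_left hP.le hR
      have h3 : R * (ε / (R + 1)) < ε := by
        rw [mul_div_assoc', div_lt_iff₀ (by positivity)]
        nlinarith
      exact h2.trans_lt h3
    · simpa using hN k ((le_max_left _ _).trans hk)
  have hlim : ∀ f : OrderFun p lam, ∃ y, Tendsto (fun k => riemannSum m h k f) atTop (𝓝 y) :=
    fun f => cauchySeq_tendsto_of_complete
      (NonarchimedeanAddGroup.cauchySeq_of_tendsto_sub_nhds_zero (hdiff f))
  choose φ₀ hφ₀ using hlim
  -- By the ultrametric inequality the bound on one step holds between any two levels.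
  have hbd : ∀ (f : OrderFun p lam) k, m₀ ≤ k → ∀ l, k ≤ l →
      ‖riemannSum m h l f - riemannSum m h k f‖ ≤ R * ‖f‖ := by
    intro f k hk l hl
    induction l, hl using Nat.le_induction with
    | base => rw [sub_self, norm_zero]; positivity
    | succ l hl ih =>
      rw [← sub_add_sub_cancel]
      exact (IsUltrametricDist.norm_add_le_max _ _).trans (max_le (hstep f l (hk.trans hl)) ih)
  have hclose : ∀ f, ∀ k, m₀ ≤ k → ‖φ₀ f - riemannSum m h k f‖ ≤ R * ‖f‖ := by
    intro f k hk
    refine le_of_tendsto ((hφ₀ f).sub_const _).norm ?_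
    filter_upwards [eventually_ge_atTop k] with l hl
    exact hbd f k hk l hl
  let φ₁ : OrderFun p lam →ₗ[ℚ_[p]] Y :=
    { toFun := φ₀
      map_add' := fun f g => by
        refine tendsto_nhds_unique (hφ₀ (f + g)) (((hφ₀ f).add (hφ₀ g)).congr fun k => ?_)
        rw [← map_add]
        rfl
      map_smul' := fun c f => by
        refine tendsto_nhds_unique (hφ₀ (c • f)) (((hφ₀ f).const_smul c).congr fun k => ?_)
        rw [← map_smul]
        rfl }
  have hφb : ∀ f, ‖φ₁ f‖ ≤ (R + R * (p : ℝ) ^ ⌊lam * m₀⌋₊) * ‖f‖ := by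
    intro f
    have h1 := hclose f m₀ le_rfl
    have h2 := hm.norm_riemannSum_le le_rfl (norm_nonneg f) fun x _ => f.norm_apply_le x
    calc ‖φ₁ f‖ = ‖(φ₀ f - riemannSum m h m₀ f) + riemannSum m h m₀ f‖ := by
          rw [sub_add_cancel]; rfl
      _ ≤ _ := norm_add_le _ _
      _ ≤ _ := by rw [add_mul]; exact add_le_add h1 h2
  refine ⟨φ₁.mkContinuous _ hφb, hφ₀, hclose, fun n u hu => ?_⟩
  refine tendsto_nhds_unique (hφ₀ _) (tendsto_const_nhds.congr' ?_)
  filter_upwards [eventually_ge_atTop n] with k hk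
  rw [hm.riemannSum_locPoly_of_le hk u hu]

/-- A distribution of order `lam` is determined by its values on locally polynomial functions of
degree at most `h`. -/
theorem eq_zero_of_locPoly_eq_zero {Y : Type*} [NormedAddCommGroup Y] [NormedSpace ℚ_[p] Y]
    (hlam : 0 ≤ lam) (hh : lam < h + 1)
    {ψ : OrderFun p lam →L[ℚ_[p]] Y} (n₀ : ℕ)
    (hψ : ∀ n, n₀ ≤ n → ∀ u : ZMod (p ^ n) → Polynomial ℚ_[p], (∀ a, (u a).natDegree ≤ h) →
      ψ (locPoly lam n u) = 0) : ψ = 0 := by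
  have hp1 : (1 : ℝ) < p := by exact_mod_cast (Fact.out : p.Prime).one_lt
  have hp0 : (0 : ℝ) < p := zero_lt_one.trans hp1
  -- The level-`k` interpolants of `P` converge to `P` in the norm of order `lam`: the sup error is
  -- `O(p ^ (-(h + 1) k))`, and passing to the norm of order `lam` costs `p ^ (lam * k)`, with a
  -- constant depending on the degree of `P` but not on `k`.
  have hpoly : ∀ P : Polynomial ℚ_[p], ψ (polyFun lam P) = 0 := by
    intro P
    obtain ⟨E, hE, hloc⟩ := exists_norm_locPoly_le p hlam (max P.natDegree h)
    set c := ‖polyFun ((h + 1 : ℕ) : ℝ) P‖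
    have h1 := fun k => norm_sub_eval_interpPoly_le (h := h) (Nat.cast_nonneg (h + 1))
      (by push_cast; exact le_rfl)
      (polyFun ((h + 1 : ℕ) : ℝ) P).continuous
      (norm_fwdDiff_zero_le (polyFun ((h + 1 : ℕ) : ℝ) P)) k
    set I : ∀ k, ZMod (p ^ k) → Polynomial ℚ_[p] := fun k a =>
      interpPoly h k ((a.val : ℕ) : ℤ_[p]) (polyFun ((h + 1 : ℕ) : ℝ) P)
    have e : ∀ k, polyFun lam P - locPoly lam k (I k) = locPoly lam k fun a => P - I k a :=
      fun k => OrderFun.ext fun x => by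
        rw [OrderFun.sub_apply, locPoly_apply, locPoly_apply, Polynomial.eval_sub, polyFun_apply]
    have hb : ∀ k x, ‖locPoly lam k (fun a => P - I k a) x‖ ≤
        c * ((p : ℝ) ^ ((h + 1) * (k + 1)))⁻¹ := by
      intro k x
      set a := PadicInt.toZModPow k x
      have hxa : PadicInt.toZModPow k x = PadicInt.toZModPow k ((a.val : ℕ) : ℤ_[p]) := by
        rw [toZModPow_val]
      obtain ⟨t, ht⟩ := toZModPow_eq_iff_dvd.1 hxa
      have hx : x = ((a.val : ℕ) : ℤ_[p]) + (p : ℤ_[p]) ^ k * t := by rw [← ht]; ring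
      have h2 := h1 k ((a.val : ℕ) : ℤ_[p]) t
      rw [← hx, ← Nat.cast_mul, Nat.floor_natCast] at h2
      rwa [locPoly_apply, Polynomial.eval_sub]
    have hnorm : ∀ k, ‖polyFun lam P - locPoly lam k (I k)‖ ≤
        E * c * ((p : ℝ) ^ (lam - (h + 1))) ^ k := by
      intro k
      rw [e]
      refine (hloc k _ _ (fun a => (Polynomial.natDegree_sub_le _ _).trans
        (max_le_max le_rfl (natDegree_interpPoly_le _ _ _ _))) (hb k)).trans ?_
      have h4 : (p : ℝ) ^ ⌊lam * k⌋₊ ≤ (p : ℝ) ^ (lam * k) := by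
        rw [← Real.rpow_natCast]
        exact Real.rpow_le_rpow_of_exponent_le hp1.le (Nat.floor_le (by positivity))
      have h5 : ((p : ℝ) ^ (lam - (h + 1))) ^ k =
          ((p : ℝ) ^ ((h + 1) * k))⁻¹ * (p : ℝ) ^ (lam * k) := by
        rw [← Real.rpow_natCast, ← Real.rpow_natCast, ← Real.rpow_mul hp0.le,
          ← Real.rpow_neg hp0.le, ← Real.rpow_add hp0]
        congr 1
        push_cast
        ring
      rw [h5, ← mul_assoc, ← mul_assoc]
      have h6 : ((p : ℝ) ^ ((h + 1) * (k + 1)))⁻¹ ≤ ((p : ℝ) ^ ((h + 1) * k))⁻¹ :=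
        inv_anti₀ (by positivity) (pow_le_pow_right₀ hp1.le (Nat.mul_le_mul_left _ k.le_succ))
      gcongr
    have hlim : Tendsto (fun k => locPoly lam k (I k)) atTop (𝓝 (polyFun lam P)) := by
      rw [tendsto_iff_norm_sub_tendsto_zero]
      have : (p : ℝ) ^ (lam - (h + 1)) < 1 :=
        Real.rpow_lt_one_of_one_lt_of_neg hp1 (by linarith)
      have h3 := (tendsto_pow_atTop_nhds_zero_of_lt_one (by positivity) this).const_mul (E * c)
      rw [mul_zero] at h3
      refine squeeze_zero (fun _ => norm_nonneg _) (fun k => ?_) h3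
      rw [norm_sub_rev]
      exact hnorm k
    refine tendsto_nhds_unique ((ψ.continuous.tendsto _).comp hlim) (tendsto_const_nhds.congr' ?_)
    filter_upwards [eventually_ge_atTop n₀] with k hk
    exact (hψ k hk _ fun a => natDegree_interpPoly_le _ _ _ _).symm
  have hcl : IsClosed {f : OrderFun p lam | ψ f = 0} := isClosed_eq ψ.continuous continuous_const
  ext f
  refine closure_minimal (s := Set.range (polyFun lam)) ?_ hcl (Metric.mem_closure_iff.2 ?_)
  · rintro _ ⟨P, rfl⟩
    exact hpoly P
  · intro ε hε
    obtain ⟨P, hP⟩ := exists_norm_sub_polyFun_lt f hε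
    exact ⟨_, ⟨P, rfl⟩, by rwa [dist_eq_norm]⟩

/-- Lagrange extrapolation to `0` from the points `1 + p r`. These nodes are units, and the weights
depend only on `p` and `h`. -/
theorem exists_extrapolation_weights (p : ℕ) [Fact p.Prime] (h : ℕ) :
    ∃ w : ℕ → ℚ_[p], ∀ P : Polynomial ℚ_[p], P.natDegree ≤ h →
      P.eval 0 = ∑ r ∈ Finset.range (h + 1), w r * P.eval (1 + (p : ℚ_[p]) * r) := by
  have hp : (p : ℚ_[p]) ≠ 0 := by exact_mod_cast (Fact.out : p.Prime).ne_zero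
  set v : ℕ → ℚ_[p] := fun r => 1 + (p : ℚ_[p]) * r
  have hv : Function.Injective v := fun a b hab =>
    Nat.cast_injective (mul_left_cancel₀ hp (add_left_cancel hab))
  refine ⟨fun r => (Lagrange.basis (Finset.range (h + 1)) v r).eval 0, fun P hP => ?_⟩
  have hdeg : P.degree < (Finset.range (h + 1)).card := by
    rw [Finset.card_range]
    exact lt_of_le_of_lt Polynomial.degree_le_natDegree (by exact_mod_cast Nat.lt_succ_of_le hP)
  conv_lhs => rw [Lagrange.eq_interpolate hv.injOn hdeg, Lagrange.interpolate_apply,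
    Polynomial.eval_finsetSum]
  refine Finset.sum_congr rfl fun r _ => ?_
  rw [Polynomial.eval_mul, Polynomial.eval_C, mul_comm]

/-- The restriction to functions supported in `S` of the distribution attached to a ball system
on `S` is bounded uniformly in the level of `S`. -/
theorem exists_uniform_extension (p : ℕ) [Fact p.Prime] {lam : ℝ} {h : ℕ} (hlam : 0 ≤ lam)
    (hh : lam < h + 1) :
    ∃ E : ℝ, 0 ≤ E ∧ ∀ {Y : Type*} [NormedAddCommGroup Y] [NormedSpace ℚ_[p] Y]
      [IsUltrametricDist Y] {m₀ : ℕ} {R : ℝ}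
      {m : ∀ k, ZMod (p ^ k) → Polynomial ℚ_[p] →ₗ[ℚ_[p]] Y} (_ : IsBallSystem lam h m₀ R m)
      (φ : OrderFun p lam →L[ℚ_[p]] Y) (_ : ∀ f, ‖φ f - riemannSum m h m₀ f‖ ≤ R * ‖f‖)
      (S : Set ℤ_[p]) (_ : ∀ x, m m₀ (PadicInt.toZModPow m₀ x) ≠ 0 → x ∈ S)
      (_ : m₀ ≤ 1 ∨ ∀ x ∈ S, ∀ t : ℤ_[p], ¬ (p : ℤ_[p]) ∣ t → x + (p : ℤ_[p]) ^ (m₀ - 1) * t ∉ S),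
      ∃ φ' : OrderFun p lam →L[ℚ_[p]] Y, (∀ f, ‖φ' f‖ ≤ E * R * ‖f‖) ∧
        ∀ f, (∀ x, x ∉ S → f x = 0) → φ' f = φ f := by
  have hp1 : (1 : ℝ) ≤ p := by exact_mod_cast (Fact.out : p.Prime).one_le
  have hp0 : (0 : ℝ) < p := zero_lt_one.trans_le hp1
  obtain ⟨w, hw⟩ := exists_extrapolation_weights p h
  set W : ℝ := ∑ r ∈ Finset.range (h + 1), ‖w r‖
  have hW : 0 ≤ W := Finset.sum_nonneg fun _ _ => norm_nonneg _
  refine ⟨2 + W + (p : ℝ) ^ ⌊lam⌋₊, by positivity, fun {Y} _ _ _ {m₀ R m} hm φ hφ S hS hm₀ => ?_⟩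
  have hR := hm.nonneg
  rcases Nat.lt_or_ge 1 m₀ with hlt | hle
  swap
  -- For `m₀ ≤ 1` the factor `p ^ ⌊lam * m₀⌋` is at most `p ^ ⌊lam⌋`, so `φ` itself is bounded
  -- uniformly.
  · refine ⟨φ, fun f => ?_, fun _ _ => rfl⟩
    have h2 := hm.norm_riemannSum_le le_rfl (norm_nonneg f) fun x _ => f.norm_apply_le x
    have h3 : (p : ℝ) ^ ⌊lam * m₀⌋₊ ≤ (p : ℝ) ^ ⌊lam⌋₊ := by
      refine pow_le_pow_right₀ hp1 (Nat.floor_mono ?_)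
      exact mul_le_of_le_one_right hlam (by exact_mod_cast hle)
    calc ‖φ f‖ = ‖(φ f - riemannSum m h m₀ f) + riemannSum m h m₀ f‖ := by rw [sub_add_cancel]
      _ ≤ R * ‖f‖ + R * (p : ℝ) ^ ⌊lam * m₀⌋₊ * ‖f‖ := (norm_add_le _ _).trans (add_le_add (hφ f) h2)
      _ ≤ R * ‖f‖ + R * (p : ℝ) ^ ⌊lam⌋₊ * ‖f‖ := by gcongr
      _ ≤ _ := by
          have : 0 ≤ (1 + W) * (R * ‖f‖) := by positivity
          nlinarith
  have hm₀' := hm₀.resolve_left (not_le.2 hlt)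
  set k := m₀ - 1
  have hk : k + 1 = m₀ := by omega
  -- `Q f x` extrapolates to `x` from the points `x + p ^ (m₀ - 1) * (1 + p r)`. For `x ∈ S` these
  -- lie outside `S`, so `Q f` vanishes on `S` if `f` vanishes outside `S`. For every `f` the error
  -- `f - Q f` is `O(‖f‖ p ^ (-⌊lam * m₀⌋))`. Hence subtracting the Riemann sum of `Q f` from `φ f`
  -- changes nothing on functions supported in `S`.
  let Q : (ℤ_[p] → ℚ_[p]) →ₗ[ℚ_[p]] (ℤ_[p] → ℚ_[p]) :=
    ∑ r ∈ Finset.range (h + 1), w r • LinearMap.funLeft ℚ_[p] ℚ_[p]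
      (fun x : ℤ_[p] => x + (p : ℤ_[p]) ^ k * (1 + (p : ℤ_[p]) * (r : ℕ)))
  have hQ : ∀ f x, Q f x = ∑ r ∈ Finset.range (h + 1),
      w r * f (x + (p : ℤ_[p]) ^ k * (1 + (p : ℤ_[p]) * (r : ℕ))) := fun f x => by
    simp [Q, LinearMap.funLeft_apply]
  have hQf : ∀ (f : OrderFun p lam) x, ‖(f - Q f : ℤ_[p] → ℚ_[p]) x‖ ≤
      (1 + W) * (‖f‖ * ((p : ℝ) ^ ⌊lam * m₀⌋₊)⁻¹) := by
    intro f x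
    set ε := ‖f‖ * ((p : ℝ) ^ ⌊lam * m₀⌋₊)⁻¹
    have hε : 0 ≤ ε := by positivity
    have h1 := norm_sub_eval_interpPoly_le hlam hh.le f.continuous (norm_fwdDiff_zero_le f) k x
    rw [hk] at h1
    set P := interpPoly h k x f
    set P' : Polynomial ℚ_[p] := P.comp
      (Polynomial.C (x : ℚ_[p]) + Polynomial.C ((p : ℚ_[p]) ^ k) * Polynomial.X)
    have hP' : P'.natDegree ≤ h := by
      have : (Polynomial.C (x : ℚ_[p]) + Polynomial.C ((p : ℚ_[p]) ^ k) * Polynomial.X).natDegree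
          ≤ 1 := by
        refine (Polynomial.natDegree_add_le _ _).trans (max_le (by simp) ?_)
        exact (Polynomial.natDegree_C_mul_le _ _).trans Polynomial.natDegree_X_le
      refine (Polynomial.natDegree_comp_le.trans (Nat.mul_le_mul_left _ this)).trans ?_
      rw [mul_one]
      exact natDegree_interpPoly_le _ _ _ _
    have hev : ∀ t : ℤ_[p], P'.eval (t : ℚ_[p]) =
        P.eval ((x + (p : ℤ_[p]) ^ k * t : ℤ_[p]) : ℚ_[p]) := fun t => by
      simp [P', Polynomial.eval_comp]
    have h2 := hw P' hP'
    set e : ℤ_[p] → ℚ_[p] := fun t => f (x + (p : ℤ_[p]) ^ k * t) - P'.eval (t : ℚ_[p])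
    have he : ∀ t, ‖e t‖ ≤ ε := fun t => by
      simp only [e, hev]
      exact h1 t
    have hfe : (f - Q f : ℤ_[p] → ℚ_[p]) x =
        e 0 - ∑ r ∈ Finset.range (h + 1), w r * e (1 + (p : ℤ_[p]) * (r : ℕ)) := by
      rw [Pi.sub_apply, hQ]
      simp only [e, mul_sub, Finset.sum_sub_distrib]
      have h3 : ∑ r ∈ Finset.range (h + 1),
          w r * P'.eval ((1 + (p : ℤ_[p]) * (r : ℕ) : ℤ_[p]) : ℚ_[p]) = P'.eval 0 := by
        rw [h2]
        push_cast
        rfl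
      rw [h3]
      simp
    rw [hfe, add_mul, one_mul]
    refine (norm_sub_le _ _).trans (add_le_add (he 0) ((norm_sum_le _ _).trans ?_))
    rw [Finset.sum_mul]
    refine Finset.sum_le_sum fun r _ => ?_
    rw [norm_mul]
    exact mul_le_mul_of_nonneg_left (he _) (norm_nonneg _)
  let coe : OrderFun p lam →ₗ[ℚ_[p]] (ℤ_[p] → ℚ_[p]) :=
    { toFun := fun f => f
      map_add' := fun _ _ => rfl
      map_smul' := fun _ _ => rfl }
  let φ₀ : OrderFun p lam →ₗ[ℚ_[p]] Y :=
    (φ : OrderFun p lam →ₗ[ℚ_[p]] Y) - ((riemannSum m h m₀).comp Q).comp coe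
  have hφ₀ : ∀ f, φ₀ f = φ f - riemannSum m h m₀ (Q f) := fun _ => rfl
  -- The factor `p ^ ⌊lam * m₀⌋` in the bound for the Riemann sum cancels against the extrapolation
  -- error, which removes `m₀` from the constant.
  have hφb : ∀ f, ‖φ₀ f‖ ≤ (2 + W + (p : ℝ) ^ ⌊lam⌋₊) * R * ‖f‖ := by
    intro f
    have h1 : φ₀ f = (φ f - riemannSum m h m₀ f) + riemannSum m h m₀ (f - Q f) := by
      rw [hφ₀, map_sub]
      abel
    have h2 := hm.norm_riemannSum_le le_rfl (by positivity) fun x _ => hQf f x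
    have h3 : R * (p : ℝ) ^ ⌊lam * m₀⌋₊ * ((1 + W) * (‖f‖ * ((p : ℝ) ^ ⌊lam * m₀⌋₊)⁻¹)) =
        (1 + W) * R * ‖f‖ := by
      field_simp
    rw [h1]
    refine (norm_add_le _ _).trans ((add_le_add (hφ f) (h2.trans_eq h3)).trans ?_)
    have : 0 ≤ (p : ℝ) ^ ⌊lam⌋₊ * (R * ‖f‖) := by positivity
    nlinarith
  refine ⟨φ₀.mkContinuous _ hφb, hφb, fun f hf => ?_⟩
  change φ₀ f = φ f
  rw [hφ₀, sub_eq_self, ← norm_le_zero_iff]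
  have h2 := hm.norm_riemannSum_le (f := Q f) le_rfl le_rfl fun x hx => by
    rw [hQ, Finset.sum_eq_zero, norm_zero]
    intro r _
    rw [hf _ (hm₀' x (hS x hx) _ ?_), mul_zero]
    intro hd
    have h1 : (p : ℤ_[p]) ∣ 1 := by
      have := dvd_sub hd (dvd_mul_right (p : ℤ_[p]) ((r : ℕ) : ℤ_[p]))
      rwa [add_sub_cancel_right] at this
    exact PadicInt.prime_p.not_isUnit (isUnit_of_dvd_one h1)
  simpa using h2

end BallSystems

end PadicIwasawa

namespace PadicIwasawa

/-! ### From norm-compatible systems to ball systems. -/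

section Equivariance

variable {p : ℕ} [Fact p.Prime] {lam : ℝ} {G : Type*} [Group G] {χ : G →* ℤ_[p]ˣ}
  {Y : Type*} [NormedAddCommGroup Y] [NormedSpace ℚ_[p] Y]

/-- The function `x ^ j` on the residue class of `a`, extended by zero. -/
noncomputable def monoBall (lam : ℝ) (n : ℕ) (a : ZMod (p ^ n)) (j : ℕ) : OrderFun p lam :=
  locPoly lam n (Pi.single a (Polynomial.X ^ j))

theorem monoBall_apply (n : ℕ) (a : ZMod (p ^ n)) (j : ℕ) (x : ℤ_[p]) :
    monoBall lam n a j x = if PadicInt.toZModPow n x = a then (x : ℚ_[p]) ^ j else 0 := by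
  rw [monoBall, locPoly_apply, Pi.single_apply]
  split_ifs <;> simp

theorem locPoly_eq_sum_monoBall {h n : ℕ} (u : ZMod (p ^ n) → Polynomial ℚ_[p])
    (hu : ∀ a, (u a).natDegree ≤ h) :
    locPoly lam n u = ∑ a, ∑ j ∈ Finset.range (h + 1), (u a).coeff j • monoBall lam n a j := by
  refine OrderFun.ext fun x => ?_
  simp only [OrderFun.sum_apply, OrderFun.smul_apply, monoBall_apply]
  rw [Finset.sum_eq_single (PadicInt.toZModPow n x)]
  · simp only [if_pos]
    rw [locPoly_apply, Polynomial.eval_eq_sum_range' (Nat.lt_succ_of_le (hu _))]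
  · intro a _ ha
    refine Finset.sum_eq_zero fun j _ => ?_
    rw [if_neg ha.symm, mul_zero]
  · exact fun hx => absurd (Finset.mem_univ _) hx

open scoped Classical in
theorem ballPow_apply (n j : ℕ) (x : ℤ_[p]) :
    ballPow p lam n j x = if (p : ℤ_[p]) ^ n ∣ x - 1 then (x : ℚ_[p]) ^ j else 0 :=
  Set.indicator_apply {x : ℤ_[p] | (p : ℤ_[p]) ^ n ∣ x - 1} (fun x => (x : ℚ_[p]) ^ j) x

theorem ballPow_eq_monoBall (n j : ℕ) : ballPow p lam n j = monoBall lam n 1 j :=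
  OrderFun.ext fun x => by
    have hiff := toZModPow_eq_iff_dvd (n := n) (x := x) (y := 1)
    rw [map_one] at hiff
    rw [monoBall_apply]
    by_cases hx : PadicInt.toZModPow n x = 1
    · rw [if_pos hx]
      exact (ballPow_apply n j x).trans (if_pos (hiff.1 hx))
    · rw [if_neg hx]
      exact (ballPow_apply n j x).trans (if_neg (mt hiff.2 hx))

theorem dilateL_monoBall (g : G) (n : ℕ) (a : ZMod (p ^ n)) (j : ℕ) :
    dilateL p lam (χ g)⁻¹.1 (monoBall lam n a j) =
      ((((χ g : ℤ_[p]) : ℚ_[p]) ^ j)⁻¹) •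
        monoBall lam n (PadicInt.toZModPow n (χ g : ℤ_[p]) * a) j := by
  refine OrderFun.ext fun x => ?_
  rw [dilateL_apply, OrderFun.smul_apply, monoBall_apply, monoBall_apply]
  have hiff : PadicInt.toZModPow n ((χ g)⁻¹.1 * x) = a ↔
      PadicInt.toZModPow n x = PadicInt.toZModPow n (χ g : ℤ_[p]) * a := by
    constructor
    · rintro rfl
      rw [← map_mul, Units.mul_inv_cancel_left]
    · intro hx
      rw [map_mul, hx, ← mul_assoc, ← map_mul, Units.inv_mul, map_one, one_mul]
  simp only [hiff]
  split_ifs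
  · rw [PadicInt.coe_mul, mul_pow]
    congr 1
    rw [← inv_pow]
    congr 1
    refine eq_inv_of_mul_eq_one_left ?_
    rw [← PadicInt.coe_mul, Units.inv_mul, PadicInt.coe_one]
  · rw [mul_zero]

theorem coe_unit_ne_zero (u : ℤ_[p]ˣ) : ((u : ℤ_[p]) : ℚ_[p]) ≠ 0 := fun h =>
  u.ne_zero (Subtype.ext h)

theorem norm_coe_unit (u : ℤ_[p]ˣ) : ‖((u : ℤ_[p]) : ℚ_[p])‖ = 1 := by
  rw [← PadicInt.norm_def]
  exact PadicInt.norm_units u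

/-- Every ball meeting the image of `χ` is a translate of the ball around `1`, so an invariant
distribution is known on it from its integrals over `Γ_n`. -/
theorem monoBall_eq_smul_dilateL (g : G) (n j : ℕ) :
    monoBall lam n (PadicInt.toZModPow n (χ g : ℤ_[p])) j =
      ((χ g : ℤ_[p]) : ℚ_[p]) ^ j • dilateL p lam (χ g)⁻¹.1 (ballPow p lam n j) := by
  rw [ballPow_eq_monoBall, dilateL_monoBall, smul_smul, mul_one,
    mul_inv_cancel₀ (pow_ne_zero _ (coe_unit_ne_zero _)), one_smul]

/-- A distribution of order `lam` supported in the image of `χ` is determined by the integrals of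
the translates of `χ ^ j` over balls. -/
theorem eq_zero_of_dilateL_ballPow_eq_zero {h : ℕ} (hlam : 0 ≤ lam) (hh : lam < h + 1)
    {ψ : OrderFun p lam →L[ℚ_[p]] Y} (hsupp : ∀ f, (∀ x ∈ imageSet χ, f x = 0) → ψ f = 0)
    (hψ : ∀ g : G, ∀ n, ∀ j ≤ h, ψ (dilateL p lam (χ g)⁻¹.1 (ballPow p lam n j)) = 0) : ψ = 0 := by
  refine eq_zero_of_locPoly_eq_zero hlam hh 0 fun n _ u hu => ?_
  rw [locPoly_eq_sum_monoBall u hu, map_sum]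
  refine Finset.sum_eq_zero fun a _ => ?_
  rw [map_sum]
  refine Finset.sum_eq_zero fun j hj => ?_
  rw [map_smul]
  by_cases ha : ∃ g, PadicInt.toZModPow n (χ g : ℤ_[p]) = a
  · obtain ⟨g, rfl⟩ := ha
    rw [monoBall_eq_smul_dilateL, map_smul, hψ g n j (Nat.lt_succ_iff.1 (Finset.mem_range.1 hj)),
      smul_zero, smul_zero]
  · rw [hsupp, smul_zero]
    rintro _ ⟨g, rfl⟩
    rw [monoBall_apply, if_neg fun hg => ha ⟨g, hg⟩]

/-- The elements of `G` on which `χ` is congruent to `1` modulo `p ^ n`. -/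
noncomputable def levelKer (χ : G →* ℤ_[p]ˣ) (n : ℕ) : Subgroup G :=
  ((Units.map (PadicInt.toZModPow (p := p) n).toMonoidHom).comp χ).ker

theorem div_mem_levelKer {n : ℕ} {g g' : G} :
    g * g'⁻¹ ∈ levelKer χ n ↔
      PadicInt.toZModPow n (χ g : ℤ_[p]) = PadicInt.toZModPow n (χ g' : ℤ_[p]) := by
  rw [levelKer, MonoidHom.mem_ker, map_mul, map_inv, mul_inv_eq_one, Units.ext_iff]
  rfl

variable (χ) in
/-- The integral of a polynomial over the ball of level `k` around `χ g`, for the invariant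
distribution interpolating the elements `y k j`. -/
noncomputable def ballInt (T : Representation ℚ_[p] G Y) (y : ℕ → ℕ → Y) (h k : ℕ) (g : G) :
    Polynomial ℚ_[p] →ₗ[ℚ_[p]] Y :=
  ∑ j ∈ Finset.range (h + 1), (Polynomial.lcoeff ℚ_[p] j).smulRight
    (((χ g : ℤ_[p]) : ℚ_[p]) ^ j • T g⁻¹ (y k j))

variable {T : Representation ℚ_[p] G Y} {y : ℕ → ℕ → Y} {h : ℕ}

theorem ballInt_apply (k : ℕ) (g : G) (u : Polynomial ℚ_[p]) :
    ballInt χ T y h k g u = ∑ j ∈ Finset.range (h + 1),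
      u.coeff j • ((χ g : ℤ_[p]) : ℚ_[p]) ^ j • T g⁻¹ (y k j) := by
  simp [ballInt]

open Classical in
variable (χ) in
/-- The integrals of polynomials over all residue classes attached to the elements `y k j`. -/
noncomputable def ballSystem (T : Representation ℚ_[p] G Y) (y : ℕ → ℕ → Y) (h k : ℕ)
    (a : ZMod (p ^ k)) : Polynomial ℚ_[p] →ₗ[ℚ_[p]] Y :=
  if H : ∃ g, PadicInt.toZModPow k (χ g : ℤ_[p]) = a then ballInt χ T y h k H.choose else 0

/-- Changing `g` by an element of `Γ_k` multiplies `T g⁻¹ (y k j)` by a `j`-th power of `χ`, which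
the factor `χ g ^ j` undoes. So the integral depends only on the ball. -/
theorem ballInt_congr (hy : ∀ n, ∀ j ≤ h, ∀ g ∈ levelKer χ n,
      T g (y n j) = ((χ g : ℤ_[p]) : ℚ_[p]) ^ j • y n j) {k : ℕ} {g g' : G}
    (hg : PadicInt.toZModPow k (χ g : ℤ_[p]) = PadicInt.toZModPow k (χ g' : ℤ_[p])) :
    ballInt χ T y h k g = ballInt χ T y h k g' := by
  refine LinearMap.ext fun u => ?_
  rw [ballInt_apply, ballInt_apply]
  refine Finset.sum_congr rfl fun j hj => ?_
  have hj' : j ≤ h := Nat.lt_succ_iff.1 (Finset.mem_range.1 hj)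
  have h1 := hy k j hj' _ (div_mem_levelKer.2 hg.symm)
  have h2 : T g⁻¹ (y k j) = T g'⁻¹ (T (g' * g⁻¹) (y k j)) := by
    rw [← Module.End.mul_apply, ← map_mul]
    congr 3
    group
  rw [h2, h1, map_smul, smul_smul (_ ^ j) (_ ^ j), ← mul_pow, map_mul, map_inv, Units.val_mul,
    PadicInt.coe_mul]
  congr 4
  have : ((χ g : ℤ_[p]) : ℚ_[p]) * (((χ g)⁻¹ : ℤ_[p]ˣ) : ℤ_[p]) = 1 := by
    rw [← PadicInt.coe_mul, Units.mul_inv, PadicInt.coe_one]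
  linear_combination ((χ g' : ℤ_[p]) : ℚ_[p]) * this

theorem ballSystem_eq (hy : ∀ n, ∀ j ≤ h, ∀ g ∈ levelKer χ n,
      T g (y n j) = ((χ g : ℤ_[p]) : ℚ_[p]) ^ j • y n j) {k : ℕ} (g : G) :
    ballSystem χ T y h k (PadicInt.toZModPow k (χ g : ℤ_[p])) = ballInt χ T y h k g := by
  have H : ∃ g', PadicInt.toZModPow k (χ g' : ℤ_[p]) = PadicInt.toZModPow k (χ g : ℤ_[p]) :=
    ⟨g, rfl⟩
  rw [ballSystem, dif_pos H]
  exact ballInt_congr hy H.choose_spec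

theorem ballSystem_eq_zero {k : ℕ} {a : ZMod (p ^ k)}
    (ha : ¬ ∃ g, PadicInt.toZModPow k (χ g : ℤ_[p]) = a) : ballSystem χ T y h k a = 0 :=
  dif_neg ha

/-- Above the class of `χ g` modulo `p ^ k`, the classes modulo `p ^ (k + 1)` meeting the image are
those of `χ (γ⁻¹ g)`, one for each coset `γ` of `Γ_{k+1}` in `Γ_k`. The sum over them is the norm
relation translated by `g⁻¹`; the other classes contribute zero. -/
theorem ballSystem_add (hy : ∀ n, ∀ j ≤ h, ∀ g ∈ levelKer χ n,
      T g (y n j) = ((χ g : ℤ_[p]) : ℚ_[p]) ^ j • y n j)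
    (hcomp : ∀ n, ∀ j ≤ h, ∑ᶠ γ : levelKer χ n ⧸ (levelKer χ (n + 1)).subgroupOf (levelKer χ n),
      (((χ (γ.out : G) : ℤ_[p]) : ℚ_[p]) ^ j)⁻¹ • T (γ.out : G) (y (n + 1) j) = y n j)
    (k : ℕ) (a : ZMod (p ^ k)) (u : Polynomial ℚ_[p]) :
    ballSystem χ T y h k a u = ∑ b : ZMod (p ^ (k + 1)) with (b.cast : ZMod (p ^ k)) = a,
      ballSystem χ T y h (k + 1) b u := by
  by_cases ha : ∃ g, PadicInt.toZModPow k (χ g : ℤ_[p]) = a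
  swap
  · rw [ballSystem_eq_zero ha, LinearMap.zero_apply, Finset.sum_eq_zero]
    intro b hb
    rw [ballSystem_eq_zero, LinearMap.zero_apply]
    rintro ⟨g, rfl⟩
    refine ha ⟨g, ?_⟩
    rw [← (Finset.mem_filter.1 hb).2, PadicInt.cast_toZModPow k (k + 1) k.le_succ]
  obtain ⟨g, rfl⟩ := ha
  set Q := levelKer χ k ⧸ (levelKer χ (k + 1)).subgroupOf (levelKer χ k)
  let e : Q → ZMod (p ^ (k + 1)) := fun γ =>
    PadicInt.toZModPow (k + 1) (χ ((γ.out : G)⁻¹ * g) : ℤ_[p])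
  have he : Function.Injective e := by
    intro γ γ' hγ
    rw [← Quotient.out_eq γ, ← Quotient.out_eq γ']
    refine QuotientGroup.eq.2 ?_
    rw [Subgroup.mem_subgroupOf]
    have h1 := div_mem_levelKer.2 hγ
    have h2 : ((γ.out : G)⁻¹ * g) * ((γ'.out : G)⁻¹ * g)⁻¹ = (γ.out : G)⁻¹ * (γ'.out : G) := by
      group
    rwa [h2] at h1
  -- Finiteness is needed to read the `finsum` in `hcomp` as an ordinary sum over the cosets.
  have : Finite Q := Finite.of_injective e he
  have := Fintype.ofFinite Q
  rw [ballSystem_eq hy, ballInt_apply]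
  have h1 : ∀ γ : Q, ballSystem χ T y h (k + 1) (e γ) u =
      ∑ j ∈ Finset.range (h + 1), u.coeff j • ((χ g : ℤ_[p]) : ℚ_[p]) ^ j • T g⁻¹
        ((((χ (γ.out : G) : ℤ_[p]) : ℚ_[p]) ^ j)⁻¹ • T (γ.out : G) (y (k + 1) j)) := by
    intro γ
    rw [ballSystem_eq hy, ballInt_apply]
    refine Finset.sum_congr rfl fun j _ => ?_
    rw [map_smul, smul_smul (_ ^ j), ← Module.End.mul_apply, ← map_mul, mul_inv_rev, inv_inv,
      map_mul, map_inv, Units.val_mul, PadicInt.coe_mul, mul_pow, mul_comm (_ ^ j)]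
    congr 4
    rw [← inv_pow]
    congr 1
    refine eq_inv_of_mul_eq_one_left ?_
    rw [← PadicInt.coe_mul, Units.inv_mul, PadicInt.coe_one]
  have h2 : ∑ γ : Q, ballSystem χ T y h (k + 1) (e γ) u =
      ∑ b : ZMod (p ^ (k + 1)) with (b.cast : ZMod (p ^ k)) = PadicInt.toZModPow k (χ g : ℤ_[p]),
        ballSystem χ T y h (k + 1) b u := by
    refine Finset.sum_of_injOn e he.injOn ?_ ?_ fun _ _ => rfl
    · intro γ _
      simp only [Finset.coe_filter, Finset.mem_univ, true_and, Set.mem_ofPred_eq, e]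
      rw [PadicInt.cast_toZModPow k (k + 1) k.le_succ, ← div_mem_levelKer, mul_inv_cancel_right]
      exact inv_mem γ.out.2
    · intro b hb hb'
      rw [ballSystem_eq_zero, LinearMap.zero_apply]
      rintro ⟨g', rfl⟩
      have hb1 := (Finset.mem_filter.1 hb).2
      rw [PadicInt.cast_toZModPow k (k + 1) k.le_succ, eq_comm, ← div_mem_levelKer] at hb1
      refine hb' ⟨(⟨g * g'⁻¹, hb1⟩ : levelKer χ k), Finset.mem_coe.2 (Finset.mem_univ _), ?_⟩
      simp only [e]
      rw [← div_mem_levelKer]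
      have h3 : ((⟨g * g'⁻¹, hb1⟩ : levelKer χ k) : Q).out⁻¹ * ⟨g * g'⁻¹, hb1⟩ ∈
          (levelKer χ (k + 1)).subgroupOf (levelKer χ k) :=
        QuotientGroup.eq.1 (Quotient.out_eq _)
      rw [Subgroup.mem_subgroupOf] at h3
      simpa [mul_assoc] using h3
  rw [← h2, Finset.sum_congr rfl fun γ _ => h1 γ, Finset.sum_comm]
  refine Finset.sum_congr rfl fun j hj => ?_
  have hj' : j ≤ h := Nat.lt_succ_iff.1 (Finset.mem_range.1 hj)
  rw [← Finset.smul_sum, ← Finset.smul_sum, ← map_sum, ← finsum_eq_sum_of_fintype, hcomp k j hj']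

/-- This identifies the combination in the growth hypothesis: up to a unit and a translation it is
the integral of `(x - χ g) ^ h` over the ball around `χ g`. -/
theorem ballInt_sub_pow (k : ℕ) (g : G) :
    ballInt χ T y h k g ((Polynomial.X - Polynomial.C ((χ g : ℤ_[p]) : ℚ_[p])) ^ h) =
      (-((χ g : ℤ_[p]) : ℚ_[p])) ^ h • T g⁻¹ (∑ j ∈ Finset.range (h + 1),
        ((-1 : ℚ_[p]) ^ j * (h.choose j : ℚ_[p])) • y k j) := by
  rw [ballInt_apply, map_sum, Finset.smul_sum]
  refine Finset.sum_congr rfl fun j hj => ?_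
  obtain ⟨i, rfl⟩ := Nat.exists_eq_add_of_le (Nat.lt_succ_iff.1 (Finset.mem_range.1 hj))
  rw [map_smul, smul_smul, smul_smul, sub_eq_add_neg, ← Polynomial.C_neg,
    Polynomial.coeff_X_add_C_pow, Nat.add_sub_cancel_left]
  congr 1
  rw [pow_add, neg_pow _ j, show (-1 : ℚ_[p]) ^ j * ((χ g : ℤ_[p]) : ℚ_[p]) ^ j *
    (-((χ g : ℤ_[p]) : ℚ_[p])) ^ i * ((-1) ^ j * ((j + i).choose j : ℚ_[p])) =
    ((-1 : ℚ_[p]) ^ j * (-1) ^ j) * (((χ g : ℤ_[p]) : ℚ_[p]) ^ j *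
    (-((χ g : ℤ_[p]) : ℚ_[p])) ^ i * ((j + i).choose j : ℚ_[p])) by ring, ← mul_pow]
  norm_num
  ring

open Polynomial in
/-- The ball system attached to a norm-compatible system of growth of order `lam`. -/
theorem exists_isBallSystem (p : ℕ) [Fact p.Prime] (h : ℕ) :
    ∃ D : ℝ, 0 ≤ D ∧ ∀ {lam : ℝ} {G : Type*} [Group G] {χ : G →* ℤ_[p]ˣ}
      {Y : Type*} [NormedAddCommGroup Y] [NormedSpace ℚ_[p] Y] [IsUltrametricDist Y]
      {T : Representation ℚ_[p] G Y} {y : ℕ → ℕ → Y} {m₀ : ℕ} {B κ : ℝ}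
      (_ : ∀ n, ∀ j ≤ h, ∀ g ∈ levelKer χ n,
        T g (y n j) = ((χ g : ℤ_[p]) : ℚ_[p]) ^ j • y n j)
      (_ : ∀ n, ∀ j ≤ h, ∑ᶠ γ : levelKer χ n ⧸ (levelKer χ (n + 1)).subgroupOf (levelKer χ n),
        (((χ (γ.out : G) : ℤ_[p]) : ℚ_[p]) ^ j)⁻¹ • T (γ.out : G) (y (n + 1) j) = y n j)
      (_ : ∀ n, ‖((p : ℚ_[p]) ^ (h * n))⁻¹ • ∑ j ∈ Finset.range (h + 1),
        ((-1 : ℚ_[p]) ^ j * (h.choose j : ℚ_[p])) • y n j‖ ≤ κ * (p : ℝ) ^ ⌊lam * n⌋₊)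
      (_ : 0 ≤ B) (_ : 0 ≤ κ) (_ : ∀ g v, ‖T g v‖ ≤ B * ‖v‖)
      (_ : ∀ s : ℤ_[p], ∃ g, (χ g : ℤ_[p]) = 1 + (p : ℤ_[p]) ^ m₀ * s),
      IsBallSystem lam h m₀ (D * κ * B) (ballSystem χ T y h) := by
  obtain ⟨D, hD, hpow⟩ := exists_eq_sum_sub_pow ℚ_[p] h
  have hp0 : (0 : ℝ) < p := by exact_mod_cast (Fact.out : p.Prime).pos
  have hp : (p : ℚ_[p]) ≠ 0 := by exact_mod_cast (Fact.out : p.Prime).ne_zero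
  refine ⟨D, hD, fun {lam G} _ {χ Y} _ _ _ {T y m₀ B κ} hy hcomp hgr hB hC hT hΓ =>
    ⟨by positivity, fun k a u _ => ballSystem_add hy hcomp k a u, fun k hk a u b hu hb => ?_⟩⟩
  have hb0 : 0 ≤ b := (norm_nonneg _).trans (hb 0 (Nat.zero_le _))
  by_cases ha : ∃ g, PadicInt.toZModPow k (χ g : ℤ_[p]) = a
  swap
  · rw [ballSystem_eq_zero ha, LinearMap.zero_apply, norm_zero]
    positivity
  obtain ⟨g, hg⟩ := ha
  set α : ℤ_[p] := ((a.val : ℕ) : ℤ_[p])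
  have hα : PadicInt.toZModPow k α = a := toZModPow_val a
  -- `v` is `u` in the coordinate `t`, where `x = α + p ^ k t`; the hypothesis at the nodes bounds
  -- `v` at `0, …, h`.
  set v : ℚ_[p][X] := u.comp (C (α : ℚ_[p]) + C ((p : ℚ_[p]) ^ k) * X)
  have hv : v.natDegree ≤ h := by
    have : (C (α : ℚ_[p]) + C ((p : ℚ_[p]) ^ k) * X).natDegree ≤ 1 := by
      refine (natDegree_add_le _ _).trans (max_le (by simp) ?_)
      exact (natDegree_C_mul_le _ _).trans natDegree_X_le
    refine (natDegree_comp_le.trans (Nat.mul_le_mul_left _ this)).trans ?_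
    rwa [mul_one]
  obtain ⟨w, hw, hvw⟩ := hpow v b hv fun r hr => by
    have := hb r hr
    simpa [v, eval_comp] using this
  -- Undoing the change of coordinate turns `(t - c) ^ h` into `p ^ (-h k)` times the power `(x - (α
  -- + p ^ k c)) ^ h`. This scalar is the one in the growth hypothesis.
  have hu' : u = ∑ c : Fin (h + 1), (w c * ((p : ℚ_[p]) ^ (h * k))⁻¹) •
      (X - C ((α + (p : ℤ_[p]) ^ k * (c : ℕ) : ℤ_[p]) : ℚ_[p])) ^ h := by
    have h1 : u = v.comp (C ((p : ℚ_[p]) ^ k)⁻¹ * (X - C (α : ℚ_[p]))) := by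
      simp only [v, comp_assoc, add_comp, mul_comp, C_comp, X_comp]
      rw [← mul_assoc, ← C_mul, mul_inv_cancel₀ (pow_ne_zero _ hp), C_1, one_mul,
        add_sub_cancel, comp_X]
    rw [h1, hvw, Polynomial.sum_comp]
    refine Finset.sum_congr rfl fun c _ => ?_
    have h2 : (X - C ((α + (p : ℤ_[p]) ^ k * (c : ℕ) : ℤ_[p]) : ℚ_[p]) : ℚ_[p][X]) =
        C ((p : ℚ_[p]) ^ k) * (C ((p : ℚ_[p]) ^ k)⁻¹ * (X - C (α : ℚ_[p])) - C ((c : ℕ) : ℚ_[p])) := by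
      rw [mul_sub, ← mul_assoc, ← C_mul, mul_inv_cancel₀ (pow_ne_zero _ hp), C_1, one_mul]
      push_cast
      rw [C_add, C_mul]
      ring
    rw [h2, mul_pow, ← C_pow, ← pow_mul, mul_comm k h, smul_eq_C_mul, ← mul_assoc, ← C_mul,
      mul_assoc, inv_mul_cancel₀ (pow_ne_zero _ hp), mul_one]
    simp
  rw [hu', map_sum]
  refine IsUltrametricDist.norm_sum_le_of_forall_le_of_nonneg (by positivity) fun c _ => ?_
  -- All the centres are values of `χ`, because `k ≥ m₀` and the image contains `1 + p ^ m₀ ℤ_p`.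
  obtain ⟨gc, hgc⟩ : ∃ g', (χ g' : ℤ_[p]) = α + (p : ℤ_[p]) ^ k * (c : ℕ) := by
    obtain ⟨t, ht⟩ := toZModPow_eq_iff_dvd.1 (hα.trans hg.symm)
    obtain ⟨s, hs⟩ := hΓ (((χ g)⁻¹ : ℤ_[p]ˣ) * ((p : ℤ_[p]) ^ (k - m₀) * (t + (c : ℕ))))
    refine ⟨g * s, ?_⟩
    have e : (p : ℤ_[p]) ^ k = (p : ℤ_[p]) ^ m₀ * (p : ℤ_[p]) ^ (k - m₀) := by
      rw [← pow_add]; congr 1; omega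
    have hinv : (χ g : ℤ_[p]) * ((χ g)⁻¹ : ℤ_[p]ˣ) = 1 := Units.mul_inv _
    rw [map_mul, Units.val_mul, hs, eq_add_of_sub_eq ht, e]
    linear_combination ((p : ℤ_[p]) ^ m₀ * ((p : ℤ_[p]) ^ (k - m₀) * (t + (c : ℕ)))) * hinv
  have hca : PadicInt.toZModPow k (χ gc : ℤ_[p]) = a := by
    rw [hgc, toZModPow_add_mul_pow, hα]
  rw [map_smul, ← hgc, ← hca, ballSystem_eq hy, ballInt_sub_pow, smul_comm, mul_smul,
    ← map_smul, norm_smul, norm_smul, norm_pow, norm_neg, norm_coe_unit, one_pow, one_mul]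
  calc _ ≤ (D * b) * (B * (κ * (p : ℝ) ^ ⌊lam * k⌋₊)) := by
        refine mul_le_mul (hw c) ((hT _ _).trans ?_) (norm_nonneg _) (by positivity)
        exact mul_le_mul_of_nonneg_left (hgr k) hB
    _ = _ := by ring

end Equivariance

end PadicIwasawa

namespace PadicIwasawa

/-! ### Closed submodules over Noetherian Banach algebras. -/

section NoetherianBanach

theorem completeSpace_linftyOp_matrix (A : Type*) [NormedCommRing A] [CompleteSpace A] (n : ℕ) :
    @CompleteSpace (Matrix (Fin n) (Fin n) A)
      (Matrix.linftyOpNormedRing : NormedRing (Matrix (Fin n) (Fin n) A)).toUniformSpace := by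
  exact (inferInstance : CompleteSpace (Fin n → Fin n → A))

/-- Neumann series for the operator norm given by the largest row sum. -/
theorem isUnit_one_sub_matrix {A : Type*} [NormedCommRing A] [CompleteSpace A] {n : ℕ}
    {a : Matrix (Fin n) (Fin n) A} (ha : ∀ i, ∑ j, ‖a i j‖ < 1) : IsUnit (1 - a) := by
  let R : NormedRing (Matrix (Fin n) (Fin n) A) := Matrix.linftyOpNormedRing
  have := completeSpace_linftyOp_matrix A n
  refine isUnit_one_sub_of_norm_lt_one ?_
  rw [Matrix.linfty_opNorm_def, ← NNReal.coe_one, NNReal.coe_lt_coe,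
    Finset.sup_lt_iff zero_lt_one]
  intro i _
  rw [← NNReal.coe_lt_coe, NNReal.coe_sum]
  exact ha i

/-- The relation reads `y = (1 - a) x`, and inverting `1 - a` expresses `x` through `y`. It serves
as a Nakayama argument in which `a` is small instead of in the radical. -/
theorem mem_span_of_isUnit_one_sub {A M : Type*} [CommRing A] [AddCommGroup M] [Module A M]
    {n : ℕ} (a : Matrix (Fin n) (Fin n) A)
    (ha : IsUnit (1 - a)) {x y : Fin n → M} (hxy : ∀ i, x i - y i = ∑ j, a i j • x j) (i : Fin n) :
    x i ∈ Submodule.span A (Set.range y) := by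
  obtain ⟨b, hb⟩ := ha.exists_left_inv
  have h1 : x i = ∑ j, b i j • y j := by
    have h2 : ∀ j, y j = ∑ k, (1 - a) j k • x k := fun j => by
      have := hxy j
      simp only [Matrix.sub_apply, sub_smul, Finset.sum_sub_distrib, ← this, Matrix.one_apply,
        ite_smul, one_smul, zero_smul, Finset.sum_ite_eq, Finset.mem_univ, if_true]
      abel
    calc x i = ∑ k, (b * (1 - a)) i k • x k := by
          simp [hb, Matrix.one_apply, ite_smul]
      _ = ∑ j, b i j • y j := by
          simp only [Matrix.mul_apply, Finset.sum_smul, h2, Finset.smul_sum, smul_smul]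
          rw [Finset.sum_comm]
  rw [h1]
  exact Submodule.sum_mem _ fun j _ => Submodule.smul_mem _ _ (Submodule.subset_span ⟨j, rfl⟩)

/-- Submodules of a finite Banach module over a Noetherian Banach algebra are closed. -/
theorem isClosed_submodule (p : ℕ) [Fact p.Prime] {A : Type*} [NormedCommRing A]
    [NormedAlgebra ℚ_[p] A] [CompleteSpace A] {M : Type*} [NormedAddCommGroup M]
    [NormedSpace ℚ_[p] M] [CompleteSpace M] [Module A M] [IsScalarTower ℚ_[p] A M]
    [IsBoundedSMul A M] [IsNoetherianRing A] [Module.Finite A M] (N : Submodule A M) :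
    IsClosed (N : Set M) := by
  set N' := N.topologicalClosure
  have hN' : IsClosed (N' : Set M) := N.isClosed_topologicalClosure
  have : CompleteSpace N' := hN'.completeSpace_coe
  obtain ⟨n, s, hs⟩ := Submodule.fg_iff_exists_fin_generating_family.1 (IsNoetherian.noetherian N')
  have hsN' : ∀ i, s i ∈ N' := fun i => hs ▸ Submodule.subset_span ⟨i, rfl⟩
  let N'' : Submodule ℚ_[p] M := N'.restrictScalars ℚ_[p]
  have : CompleteSpace N'' := hN'.completeSpace_coe
  let π₀ : (Fin n → A) →ₗ[ℚ_[p]] N'' :=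
    { toFun := fun a => ⟨∑ i, a i • s i,
        N'.sum_mem fun i _ => N'.smul_mem _ (hsN' i)⟩
      map_add' := fun a b => Subtype.ext (by simp [add_smul, Finset.sum_add_distrib])
      map_smul' := fun c a => Subtype.ext (by simp [Finset.smul_sum, smul_assoc]) }
  have hπ₀ : Continuous π₀ := by
    refine Continuous.subtype_mk ?_ _
    fun_prop
  let π : (Fin n → A) →L[ℚ_[p]] N'' := ⟨π₀, hπ₀⟩
  have hsurj : Function.Surjective π := by
    rintro ⟨y, hy⟩
    have hy' : y ∈ Submodule.span A (Set.range s) := by rw [hs]; exact hy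
    obtain ⟨c, hc⟩ := (Submodule.mem_span_range_iff_exists_fun A).1 hy'
    exact ⟨c, Subtype.ext hc⟩
  -- Open mapping theorem: elements of the closure have coordinates in the generators `s` of size at
  -- most `K` times their norm.
  obtain ⟨K, hK, hpre⟩ := π.exists_preimage_norm_le hsurj
  -- With generators approximated by elements of `N` to this precision, the coefficient matrix has
  -- row sums at most `n / (2 (n + 1))`.
  have hε : 0 < (2 * (K * (n + 1)))⁻¹ := by positivity
  have happ : ∀ i, ∃ y ∈ N, ‖s i - y‖ < (2 * (K * (n + 1)))⁻¹ := fun i => by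
    have h1 : s i ∈ closure (N : Set M) := hsN' i
    obtain ⟨y, hy, hy'⟩ := Metric.mem_closure_iff.1 h1 _ hε
    exact ⟨y, hy, by rwa [← dist_eq_norm]⟩
  choose y hyN hy using happ
  have hcoef : ∀ i, ∃ a : Fin n → A, s i - y i = ∑ j, a j • s j ∧
      ‖a‖ ≤ K * (2 * (K * (n + 1)))⁻¹ := fun i => by
    obtain ⟨a, ha, ha'⟩ := hpre ⟨s i - y i, N'.sub_mem (hsN' i) (N.le_topologicalClosure (hyN i))⟩
    exact ⟨a, (congrArg Subtype.val ha).symm,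
      ha'.trans (mul_le_mul_of_nonneg_left (hy i).le hK.le)⟩
  choose a ha ha' using hcoef
  have hnorm : ∀ i, ∑ j, ‖Matrix.of a i j‖ < 1 := fun i => by
    calc ∑ j, ‖a i j‖ ≤ ∑ _j : Fin n, K * (2 * (K * (n + 1)))⁻¹ :=
          Finset.sum_le_sum fun j _ => (norm_le_pi_norm (a i) j).trans (ha' i)
      _ = n / (2 * (n + 1)) := by
          simp only [Finset.sum_const, Finset.card_univ, Fintype.card_fin, nsmul_eq_mul]
          field_simp
      _ < 1 := by
          rw [div_lt_one (by positivity)]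
          linarith [(Nat.cast_nonneg n : (0 : ℝ) ≤ n)]
  have hmem := mem_span_of_isUnit_one_sub (Matrix.of a) (isUnit_one_sub_matrix hnorm)
    (x := s) (y := y) ha
  have hle : N' ≤ N := by
    rw [← hs, Submodule.span_le]
    rintro _ ⟨i, rfl⟩
    refine (Submodule.span_le.2 ?_) (hmem i)
    rintro _ ⟨j, rfl⟩
    exact hyN j
  rwa [← le_antisymm hle N.le_topologicalClosure]

end NoetherianBanach

/-! ### The Banach space of cocycles, and closedness of the coboundaries. -/

section ContinuousCocycles

variable (p : ℕ) [Fact p.Prime] (H : Type*) [Group H] [TopologicalSpace H]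
  [CompactSpace H] (M : Type*) [NormedAddCommGroup M] [NormedSpace ℚ_[p] M]
  [DistribMulAction H M] [ContinuousSMul H M] [SMulCommClass H ℚ_[p] M]

/-- Continuous cocycles on a compact group, as a subspace of the continuous functions. -/
def cocycleSubmodule : Submodule ℚ_[p] C(H, M) where
  carrier := {z | ∀ g h, z (g * h) = z g + g • z h}
  zero_mem' := fun g h => by simp
  add_mem' := by
    intro y z hy hz g h
    simp only [ContinuousMap.add_apply, hy g h, hz g h, smul_add]
    abel
  smul_mem' := by
    intro c z hz g h
    simp only [ContinuousMap.smul_apply, hz g h, smul_add, smul_comm g c]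

theorem isClosed_cocycleSubmodule : IsClosed (cocycleSubmodule p H M : Set C(H, M)) := by
  have : (cocycleSubmodule p H M : Set C(H, M)) =
      ⋂ (g : H) (h : H), {z : C(H, M) | z (g * h) = z g + g • z h} := by
    ext z
    simp only [Set.mem_iInter]
    rfl
  rw [this]
  refine isClosed_iInter fun g => isClosed_iInter fun h => isClosed_eq ?_ ?_
  · fun_prop
  · exact (continuous_eval_const g).add
      ((continuous_eval_const h).const_smul g)

/-- The Banach space of continuous cocycles on a compact group. -/
def Cocycles : Type _ := ↥(cocycleSubmodule p H M)

noncomputable instance : NormedAddCommGroup (Cocycles p H M) :=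
  inferInstanceAs (NormedAddCommGroup ↥(cocycleSubmodule p H M))

noncomputable instance : NormedSpace ℚ_[p] (Cocycles p H M) :=
  inferInstanceAs (NormedSpace ℚ_[p] ↥(cocycleSubmodule p H M))

instance [CompleteSpace M] : CompleteSpace (Cocycles p H M) :=
  (isClosed_cocycleSubmodule p H M).completeSpace_coe

instance [IsUltrametricDist M] : IsUltrametricDist (Cocycles p H M) :=
  inferInstanceAs (IsUltrametricDist ((cocycleSubmodule p H M : Set C(H, M)) : Type _))

variable {p H M} in
theorem continuous_cocycle_eval (h : H) : Continuous fun z : Cocycles p H M => z.1 h :=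
  (continuous_eval_const h).comp continuous_subtype_val

/-- The comparison of the two models of the space of continuous cocycles. -/
def cocyclesEquiv : Cocycles p H M ≃ₗ[ℚ_[p]] Z1 ℚ_[p] H M where
  toFun z := ⟨fun h => z.1 h, z.1.continuous, z.2⟩
  invFun z := ⟨⟨z.1, z.2.1⟩, z.2.2⟩
  map_add' _ _ := rfl
  map_smul' _ _ := rfl
  left_inv _ := rfl
  right_inv _ := rfl

/-- The coboundary map as a linear map to continuous cocycles. -/
noncomputable def coboundary : M →L[ℚ_[p]] Cocycles p H M where
  toFun m := ⟨⟨fun h => h • m - m, by fun_prop⟩, fun g h => by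
    simp only [ContinuousMap.coe_mk, mul_smul, smul_sub]
    abel⟩
  map_add' m m' := Subtype.ext (ContinuousMap.ext fun h => by
    change h • (m + m') - (m + m') = (h • m - m) + (h • m' - m')
    rw [smul_add]
    abel)
  map_smul' c m := Subtype.ext (ContinuousMap.ext fun h => by
    change h • c • m - c • m = c • (h • m - m)
    rw [smul_sub, smul_comm h c])
  cont := by
    refine Continuous.subtype_mk ?_ _
    refine ContinuousMap.continuous_of_continuous_uncurry _ ?_
    change Continuous fun x : M × H => x.2 • x.1 - x.1
    fun_prop

variable {p H M}

variable (p H M) in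
/-- The coboundaries among the continuous cocycles. -/
noncomputable def coboundaries : Submodule ℚ_[p] (Cocycles p H M) :=
  LinearMap.range (coboundary p H M).toLinearMap

theorem mem_coboundaries {z : Cocycles p H M} :
    z ∈ coboundaries p H M ↔ cocyclesEquiv p H M z ∈ B1 ℚ_[p] H M := by
  constructor
  · rintro ⟨m, rfl⟩
    exact ⟨m, fun _ => rfl⟩
  · rintro ⟨m, hm⟩
    exact ⟨m, Subtype.ext (ContinuousMap.ext fun h => (hm h).symm)⟩

theorem map_coboundaries :
    (coboundaries p H M).map (cocyclesEquiv p H M).toLinearMap = B1 ℚ_[p] H M := by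
  ext z
  constructor
  · rintro ⟨w, hw, rfl⟩
    exact mem_coboundaries.1 hw
  · intro hz
    exact ⟨(cocyclesEquiv p H M).symm z, mem_coboundaries.2 (by simpa using hz), by simp⟩

/-- If coboundaries of `m n` converge to `z`, the `m n` need not converge. But by noetherianity
finitely many operators `h - 1` generate all of them over `A`. They form a map `δ` from `M` to a
finite power of `M`, whose range is closed by `isClosed_submodule`. A preimage `m₀` of the limit of
`δ (m n)` then has coboundary `z`. -/
theorem isClosed_coboundaries [CompleteSpace M] (A : Type*) [NormedCommRing A]
    [NormedAlgebra ℚ_[p] A] [CompleteSpace A] [IsNoetherianRing A] [Module A M]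
    [IsScalarTower ℚ_[p] A M] [IsBoundedSMul A M] [Module.Finite A M] [Module.Free A M]
    [SMulCommClass H A M] : IsClosed (coboundaries p H M : Set (Cocycles p H M)) := by
  classical
  let d : H → (M →ₗ[A] M) := fun h => DistribSMul.toLinearMap A M h - LinearMap.id
  have hd : ∀ h m, d h m = h • m - m := fun h m => rfl
  obtain ⟨F, hF, hspan⟩ := (Submodule.fg_span_iff_fg_span_finset_subset (R := A) (Set.range d)).1
    (IsNoetherian.noetherian _)
  let δ : M →ₗ[A] (F → M) := LinearMap.pi fun f => f.1
  have hδc : Continuous δ := by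
    refine continuous_pi fun f => ?_
    obtain ⟨h, hh⟩ := hF f.2
    change Continuous fun m => f.1 m
    rw [← hh]
    change Continuous fun m : M => h • m - m
    fun_prop
  have hcl := isClosed_submodule p (LinearMap.range δ)
  let W : Submodule ℚ_[p] (F → M) := (LinearMap.range δ).restrictScalars ℚ_[p]
  have : CompleteSpace W := hcl.completeSpace_coe
  let δ' : M →L[ℚ_[p]] W :=
    { toFun := fun m => ⟨δ m, m, rfl⟩
      map_add' := fun _ _ => Subtype.ext (map_add δ _ _)
      map_smul' := fun c m => Subtype.ext ((δ.restrictScalars ℚ_[p]).map_smul c m)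
      cont := hδc.subtype_mk _ }
  have hδ' : Function.Surjective δ' := by
    rintro ⟨_, m, rfl⟩
    exact ⟨m, rfl⟩
  have hcoord : ∀ h : H, ∃ c : F → A, ∀ m : M, h • m - m = ∑ f, c f • δ m f := fun h => by
    have h1 : d h ∈ Submodule.span A (F : Set (M →ₗ[A] M)) := by
      rw [← hspan]; exact Submodule.subset_span ⟨h, rfl⟩
    have h2 : d h ∈ Submodule.span A (Set.range fun f : F => f.1) := by
      simpa using h1
    obtain ⟨c, hc⟩ := (Submodule.mem_span_range_iff_exists_fun A).1 h2
    refine ⟨c, fun m => ?_⟩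
    rw [← hd, ← hc]
    simp [δ]
  choose c hc using hcoord
  choose e he using fun f : F => hF f.2
  refine isClosed_of_closure_subset fun z hz => ?_
  obtain ⟨u, hu, hlim⟩ := mem_closure_iff_seq_limit.1 hz
  choose m hm using hu
  have hev : ∀ h : H, Tendsto (fun n => h • m n - m n) atTop (𝓝 (z.1 h)) := fun h => by
    have h2 := ((continuous_cocycle_eval h).tendsto z).comp hlim
    refine h2.congr fun n => ?_
    rw [Function.comp_apply, ← hm n]
    rfl
  have hlimδ : Tendsto (fun n => δ (m n)) atTop (𝓝 fun f => z.1 (e f)) := by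
    refine tendsto_pi_nhds.2 fun f => ?_
    refine (hev (e f)).congr fun n => ?_
    rw [← hd, he]
    rfl
  obtain ⟨m₀, hm₀⟩ : (fun f => z.1 (e f)) ∈ LinearMap.range δ :=
    hcl.mem_of_tendsto hlimδ (Eventually.of_forall fun n => ⟨m n, rfl⟩)
  refine ⟨m₀, Subtype.ext (ContinuousMap.ext fun h => ?_)⟩
  change h • m₀ - m₀ = z.1 h
  refine tendsto_nhds_unique ?_ (hev h)
  simp only [hc h]
  refine tendsto_finsetSum _ fun f _ => ?_
  have h3 : Tendsto (fun n => δ (m n) f) atTop (𝓝 (δ m₀ f)) := by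
    rw [hm₀]
    exact tendsto_pi_nhds.1 hlimδ f
  exact h3.const_smul _

end ContinuousCocycles

end PadicIwasawa

namespace PadicIwasawa

/-! ### `H^1` with its quotient norm and the conjugation action. -/

section NormedCohomology

variable (p : ℕ) [Fact p.Prime] (H : Type*) [Group H] [TopologicalSpace H]
  [CompactSpace H] (M : Type*) [NormedAddCommGroup M] [NormedSpace ℚ_[p] M]
  [DistribMulAction H M] [ContinuousSMul H M] [SMulCommClass H ℚ_[p] M]

variable [hB : IsClosed (coboundaries p H M : Set (Cocycles p H M))]

/-- The first cohomology group with the quotient norm. -/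
def NormedH1 (p : ℕ) [Fact p.Prime] (H : Type*) [Group H] [TopologicalSpace H]
    [CompactSpace H] (M : Type*) [NormedAddCommGroup M] [NormedSpace ℚ_[p] M]
    [DistribMulAction H M] [ContinuousSMul H M] [SMulCommClass H ℚ_[p] M] : Type _ :=
  Cocycles p H M ⧸ coboundaries p H M

noncomputable instance : NormedAddCommGroup (NormedH1 p H M) :=
  inferInstanceAs (NormedAddCommGroup (Cocycles p H M ⧸ coboundaries p H M))

noncomputable instance : NormedSpace ℚ_[p] (NormedH1 p H M) :=
  inferInstanceAs (NormedSpace ℚ_[p] (Cocycles p H M ⧸ coboundaries p H M))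

instance [CompleteSpace M] : CompleteSpace (NormedH1 p H M) :=
  inferInstanceAs (CompleteSpace (Cocycles p H M ⧸ coboundaries p H M))

/-- The projection from cocycles. -/
noncomputable def NormedH1.mk : Cocycles p H M →ₗ[ℚ_[p]] NormedH1 p H M :=
  (coboundaries p H M).mkQ

/-- The comparison with the algebraic quotient. -/
noncomputable def normedH1Equiv : NormedH1 p H M ≃ₗ[ℚ_[p]] H1 ℚ_[p] H M :=
  Submodule.Quotient.equiv (coboundaries p H M) _ (cocyclesEquiv p H M) map_coboundaries

variable {p H M}

theorem NormedH1.norm_mk_le (z : Cocycles p H M) : ‖NormedH1.mk p H M z‖ ≤ ‖z‖ :=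
  Submodule.Quotient.norm_mk_le _ _

theorem NormedH1.norm_mk_lt (x : NormedH1 p H M) {ε : ℝ} (hε : 0 < ε) :
    ∃ z, NormedH1.mk p H M z = x ∧ ‖z‖ < ‖x‖ + ε :=
  Submodule.Quotient.norm_mk_lt (S := coboundaries p H M) x hε

theorem normedH1Equiv_mk (z : Cocycles p H M) :
    normedH1Equiv p H M (NormedH1.mk p H M z) = (B1 ℚ_[p] H M).mkQ (cocyclesEquiv p H M z) :=
  rfl

theorem normedH1Equiv_symm_mkQ (z : Z1 ℚ_[p] H M) :
    (normedH1Equiv p H M).symm ((B1 ℚ_[p] H M).mkQ z) =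
      NormedH1.mk p H M ((cocyclesEquiv p H M).symm z) := by
  rw [LinearEquiv.symm_apply_eq, normedH1Equiv_mk, LinearEquiv.apply_symm_apply]

omit hB in
theorem norm_apply_le_norm_cocycle (z : Cocycles p H M) (h : H) : ‖z.1 h‖ ≤ ‖z‖ :=
  z.1.norm_coe_le_norm h

omit hB in
theorem norm_cocycle_le {z : Cocycles p H M} {c : ℝ} (hc : 0 ≤ c) (h : ∀ h, ‖z.1 h‖ ≤ c) :
    ‖z‖ ≤ c :=
  (ContinuousMap.norm_le _ hc).2 h

theorem norm_normedH1Equiv_symm_le {c : H1 ℚ_[p] H M} {r : ℝ≥0}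
    (hc : H1.seminorm (fun m : M => ‖m‖ₑ) c ≤ r) : ‖(normedH1Equiv p H M).symm c‖ ≤ r := by
  refine le_of_forall_pos_le_add fun ε hε => ?_
  have h1 : H1.seminorm (fun m : M => ‖m‖ₑ) c < (r + ε.toNNReal : ℝ≥0) := by
    refine hc.trans_lt ?_
    rw [ENNReal.coe_lt_coe]
    exact lt_add_of_pos_right _ (Real.toNNReal_pos.2 hε)
  simp only [H1.seminorm, iInf_lt_iff] at h1
  obtain ⟨z, rfl, hz⟩ := h1
  rw [normedH1Equiv_symm_mkQ]
  refine (NormedH1.norm_mk_le _).trans (norm_cocycle_le (by positivity) fun h => ?_)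
  have h2 : ‖z.1 h‖ₑ ≤ (r + ε.toNNReal : ℝ≥0) :=
    (le_iSup (fun h => ‖z.1 h‖ₑ) h).trans hz.le
  rw [enorm_le_coe, ← NNReal.coe_le_coe, NNReal.coe_add, Real.coe_toNNReal _ hε.le] at h2
  exact h2

/-- The infimum defining the quotient norm need not be attained; the factor `2` is the price of
choosing a cocycle and enters the final constant. -/
theorem exists_norm_le_two_mul (y : NormedH1 p H M) :
    ∃ z, NormedH1.mk p H M z = y ∧ ‖z‖ ≤ 2 * ‖y‖ := by
  by_cases hy : y = 0
  · exact ⟨0, by rw [hy, map_zero], by rw [norm_zero]; positivity⟩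
  · obtain ⟨z, hz, hz'⟩ := NormedH1.norm_mk_lt y (norm_pos_iff.2 hy)
    exact ⟨z, hz, by linarith⟩

instance [IsUltrametricDist M] : IsUltrametricDist (NormedH1 p H M) := by
  refine IsUltrametricDist.isUltrametricDist_of_forall_norm_add_le_max_norm fun x y => ?_
  refine le_of_forall_pos_le_add fun ε hε => ?_
  obtain ⟨a, rfl, ha⟩ := NormedH1.norm_mk_lt x hε
  obtain ⟨b, rfl, hb⟩ := NormedH1.norm_mk_lt y hε
  rw [← map_add]
  refine (NormedH1.norm_mk_le _).trans ((IsUltrametricDist.norm_add_le_max a b).trans ?_)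
  rw [← max_add_add_right]
  exact max_le_max ha.le hb.le

end NormedCohomology

section Conjugation

variable {R G X : Type*} [CommRing R] [Group G] [AddCommGroup X] [DistribMulAction G X]
  {N : Subgroup G} [N.Normal] [TopologicalSpace G] [IsTopologicalGroup G] [TopologicalSpace X]
  [IsTopologicalAddGroup X] [Module R X] [ContinuousConstSMul R X] [SMulCommClass G R X]
  [ContinuousConstSMul G X]

theorem H1.conj_mkQ (g : G) (z : Z1 R N X) :
    H1.conj (R := R) (X := X) N g ((B1 R N X).mkQ z) = (B1 R N X).mkQ (Z1.conj N g z) := rfl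

theorem H1.conj_one (c : H1 R N X) : H1.conj (R := R) (X := X) N 1 c = c := by
  obtain ⟨z, rfl⟩ := (B1 R N X).mkQ_surjective c
  rw [H1.conj_mkQ]
  congr 1
  refine Subtype.ext (funext fun h => ?_)
  change (1 : G) • z.1 (conjElt N 1 h) = z.1 h
  rw [one_smul]
  have h1 : conjElt N 1 h = h := Subtype.ext (show (1 : G)⁻¹ * h.1 * 1 = h.1 by simp)
  rw [h1]

theorem H1.conj_mul (g g' : G) (c : H1 R N X) :
    H1.conj (R := R) (X := X) N (g * g') c = H1.conj (R := R) (X := X) N g (H1.conj (R := R) (X := X) N g' c) := by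
  obtain ⟨z, rfl⟩ := (B1 R N X).mkQ_surjective c
  rw [H1.conj_mkQ, H1.conj_mkQ, H1.conj_mkQ]
  congr 1
  refine Subtype.ext (funext fun h => ?_)
  change (g * g') • z.1 (conjElt N (g * g') h) = g • g' • z.1 (conjElt N g' (conjElt N g h))
  rw [mul_smul]
  have h1 : conjElt N (g * g') h = conjElt N g' (conjElt N g h) :=
    Subtype.ext (show (g * g')⁻¹ * h.1 * (g * g') = g'⁻¹ * (g⁻¹ * h.1 * g) * g' by group)
  rw [h1]

end Conjugation

section NormedConjugation

variable {p : ℕ} [Fact p.Prime] {G : Type*} [Group G] [TopologicalSpace G] [IsTopologicalGroup G]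
  {N : Subgroup G} [N.Normal] [CompactSpace N] {M : Type*} [NormedAddCommGroup M]
  [NormedSpace ℚ_[p] M] [DistribMulAction G M] [ContinuousSMul G M] [SMulCommClass G ℚ_[p] M]
  [hB : IsClosed (coboundaries p N M : Set (Cocycles p N M))]

variable (p N M) in
/-- The conjugation action on the normed model of `H^1(N, M)`. -/
noncomputable def normedConjRep : Representation ℚ_[p] G (NormedH1 p N M) where
  toFun g := (normedH1Equiv p N M).symm.toLinearMap ∘ₗ H1.conj (R := ℚ_[p]) (X := M) N g ∘ₗ
    (normedH1Equiv p N M).toLinearMap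
  map_one' := LinearMap.ext fun y => by simp [H1.conj_one]
  map_mul' g g' := LinearMap.ext fun y => by simp [H1.conj_mul]

theorem normedConjRep_apply (g : G) (y : NormedH1 p N M) :
    normedConjRep p N M g y =
      (normedH1Equiv p N M).symm (H1.conj (R := ℚ_[p]) (X := M) N g (normedH1Equiv p N M y)) := rfl

theorem norm_normedConjRep_le {B : ℝ} (hB : 0 ≤ B) (hBM : ∀ (g : G) (m : M), ‖g • m‖ ≤ B * ‖m‖)
    (g : G) (y : NormedH1 p N M) : ‖normedConjRep p N M g y‖ ≤ B * ‖y‖ := by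
  -- The error stays inside the product with `B` and is removed by a limit, so that `B = 0` needs no
  -- separate treatment.
  have key : ∀ ε > 0, ‖normedConjRep p N M g y‖ ≤ B * (‖y‖ + ε) := fun ε hε => by
    obtain ⟨z, rfl, hz⟩ := NormedH1.norm_mk_lt y hε
    rw [normedConjRep_apply, normedH1Equiv_mk, H1.conj_mkQ, normedH1Equiv_symm_mkQ]
    refine (NormedH1.norm_mk_le _).trans
      ((norm_cocycle_le (c := B * ‖z‖) (by positivity) fun h => ?_).trans
        (mul_le_mul_of_nonneg_left hz.le hB))
    exact (hBM g _).trans (mul_le_mul_of_nonneg_left (norm_apply_le_norm_cocycle z _) hB)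
  have hlim : Tendsto (fun ε : ℝ => B * (‖y‖ + ε)) (𝓝[>] 0) (𝓝 (B * (‖y‖ + 0))) :=
    Tendsto.mono_left (Continuous.tendsto (by fun_prop) 0) nhdsWithin_le_nhds
  rw [add_zero] at hlim
  exact ge_of_tendsto hlim (eventually_mem_nhdsWithin.mono key)

end NormedConjugation

/-! ### Classes with values in distributions, and distributions with values in classes. -/

section DistributionClasses

variable {p : ℕ} [Fact p.Prime] {lam : ℝ} {G : Type*} [Group G] [TopologicalSpace G]
  [IsTopologicalGroup G] {N : Subgroup G} [CompactSpace N] {M : Type*}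
  [NormedAddCommGroup M] [NormedSpace ℚ_[p] M] [DistribMulAction G M] [ContinuousSMul G M]
  [SMulCommClass G ℚ_[p] M] {χ : G →* ℤ_[p]ˣ}

theorem smul_gammaDist_apply (hN : N ≤ χ.ker) (h : N) (μ : GammaDist lam M χ)
    (f : OrderFun p lam) : (h • μ).1 f = h • μ.1 f := by
  have h1 : χ (h : G) = 1 := hN h.2
  change (h : G) • μ.1 (dilateL p lam (χ (h : G))⁻¹.1 f) = (h : G) • μ.1 f
  rw [h1, inv_one, Units.val_one, dilateL_one]

theorem gammaDist_apply_eq (μ : GammaDist lam M χ) {f f' : OrderFun p lam}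
    (hf : ∀ x ∈ imageSet χ, f x = f' x) : μ.1 f = μ.1 f' := by
  rw [← sub_eq_zero, ← map_sub]
  exact μ.2 _ fun x hx => by rw [OrderFun.sub_apply, hf x hx, sub_self]

/-- Distributions carry only the topology of pointwise convergence, so continuity of `f ↦ (h ↦
z(h)(f))` for the sup norm of cocycles is not immediate. It follows from the closed graph theorem,
as each `z(h)` and each evaluation at `h` is continuous. -/
theorem exists_integralCLM [CompleteSpace M] (hN : N ≤ χ.ker)
    (z : Z1 ℚ_[p] N (GammaDist lam M χ)) :
    ∃ L : OrderFun p lam →L[ℚ_[p]] Cocycles p N M, ∀ f,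
      H1.integral lam M χ hN f ((B1 ℚ_[p] N (GammaDist lam M χ)).mkQ z) =
        (B1 ℚ_[p] N M).mkQ (cocyclesEquiv p N M (L f)) ∧ ∀ h, (L f).1 h = (z.1 h).1 f := by
  let L₀ : OrderFun p lam →ₗ[ℚ_[p]] Cocycles p N M :=
    { toFun := fun f => ⟨⟨fun h => (z.1 h).1 f, (GammaDist.continuous_eval χ f).comp z.2.1⟩,
        fun g h => by
          change (z.1 (g * h)).1 f = (z.1 g).1 f + g • (z.1 h).1 f
          rw [z.2.2, ← smul_gammaDist_apply hN]
          rfl⟩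
      map_add' := fun f f' => Subtype.ext (ContinuousMap.ext fun h => map_add (z.1 h).1 f f')
      map_smul' := fun a f => Subtype.ext (ContinuousMap.ext fun h => map_smul (z.1 h).1 a f) }
  have hL₀ : Continuous L₀ := by
    refine LinearMap.continuous_of_seq_closed_graph _ fun u f w hu hw => ?_
    refine Subtype.ext (ContinuousMap.ext fun h => ?_)
    refine tendsto_nhds_unique (((continuous_cocycle_eval h).tendsto w).comp hw) ?_
    have h1 : Continuous fun f => (z.1 h).1 f :=
      ContinuousLinearMap.continuous (show OrderFun p lam →L[ℚ_[p]] M from (z.1 h).1)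
    exact (h1.tendsto f).comp hu
  exact ⟨⟨L₀, hL₀⟩, fun f => ⟨rfl, fun _ => rfl⟩⟩

/-- A class with values in distributions is determined by its integrals. -/
theorem H1.eq_zero_of_integral_eq_zero [CompleteSpace M] [IsUltrametricDist M] (hN : N ≤ χ.ker)
    (hB : IsClosed (coboundaries p N M : Set (Cocycles p N M)))
    {T : OrderFun p lam →L[ℚ_[p]] OrderFun p lam}
    (hT : ∀ f x, T f x = (imageSet χ).indicator f x)
    {c : H1 ℚ_[p] N (GammaDist lam M χ)} (hc : ∀ f, H1.integral lam M χ hN f c = 0) : c = 0 := by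
  obtain ⟨z, rfl⟩ := (B1 ℚ_[p] N (GammaDist lam M χ)).mkQ_surjective c
  obtain ⟨L₀, hL₀⟩ := exists_integralCLM hN z
  have hmem : ∀ f, L₀ f ∈ coboundaries p N M := fun f => by
    rw [mem_coboundaries, ← Submodule.Quotient.mk_eq_zero, ← Submodule.mkQ_apply, ← (hL₀ f).1]
    exact hc f
  have : CompleteSpace (coboundaries p N M) := hB.completeSpace_coe
  let L : OrderFun p lam →L[ℚ_[p]] coboundaries p N M :=
    L₀.codRestrict _ hmem
  let δ : M →L[ℚ_[p]] coboundaries p N M :=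
    (coboundary p N M).codRestrict _ fun m => ⟨m, rfl⟩
  have hδ : Function.Surjective δ := by
    rintro ⟨_, m, rfl⟩
    exact ⟨m, rfl⟩
  -- The coboundary map from `M` is a surjection of Banach spaces, hence open. Lifting `L` along it
  -- chooses the elements of `M` that trivialise the cocycles `L f` linearly and continuously in
  -- `f`.
  obtain ⟨K, hK, hpre⟩ := δ.exists_preimage_norm_le hδ
  obtain ⟨ψ, hψ, -⟩ := exists_lift δ hK.le hpre L (norm_nonneg L) L.le_opNorm
  have hψ' : ∀ (f : OrderFun p lam) (h : N), h • ψ f - ψ f = (z.1 h).1 f := fun f h =>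
    (congrArg (fun w : coboundaries p N M => w.1.1 h) (hψ f)).trans ((hL₀ f).2 h)
  rw [Submodule.mkQ_apply, Submodule.Quotient.mk_eq_zero]
  have hTsupp : ∀ f, (∀ x ∈ imageSet χ, f x = 0) → T f = 0 := fun f hf => OrderFun.ext fun x => by
    rw [hT, OrderFun.zero_apply]
    by_cases hx : x ∈ imageSet χ
    · rw [Set.indicator_of_mem hx, hf x hx]
    · rw [Set.indicator_of_notMem hx]
  -- The lift `ψ` need not be supported in `Γ`; composition with the restriction `T` repairs this.
  let ν : GammaDist lam M χ := ⟨(show OrderFun p lam →L[ℚ_[p]] M from ψ.comp T), fun f hf => by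
    change ψ (T f) = 0
    rw [hTsupp f hf, map_zero]⟩
  refine ⟨ν, fun h => GammaDist.ext fun f => ?_⟩
  have h1 : (z.1 h).1 f = (z.1 h).1 (T f) := gammaDist_apply_eq _ fun x hx => by
    rw [hT, Set.indicator_of_mem hx]
  rw [h1, ← hψ' (T f) h]
  exact congrArg (fun m => m - ν.1 f) (smul_gammaDist_apply hN h ν f).symm

theorem distNorm_le {U : Set ℤ_[p]} {μ : OrderFun p lam →Lₚₜ[ℚ_[p]] M} {r : ℝ≥0}
    (h : ∀ f, (∀ x, x ∉ U → f x = 0) → ‖μ f‖ ≤ r * ‖f‖) : distNorm U μ ≤ r := by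
  refine iSup₂_le fun f hf => ENNReal.div_le_of_le_mul ?_
  have := h f hf
  rw [← coe_nnnorm, ← coe_nnnorm, ← NNReal.coe_mul, NNReal.coe_le_coe] at this
  rw [enorm_eq_nnnorm, enorm_eq_nnnorm, ← ENNReal.coe_mul, ENNReal.coe_le_coe]
  exact this

/-- A distribution with values in `H^1(N, M)` that is supported in `Γ` comes from a class with
values in distributions. -/
theorem exists_class_of_distribution [CompleteSpace M] [IsUltrametricDist M] (hN : N ≤ χ.ker)
    [hB : IsClosed (coboundaries p N M : Set (Cocycles p N M))]
    {T : OrderFun p lam →L[ℚ_[p]] OrderFun p lam}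
    (hT : ∀ f x, T f x = (imageSet χ).indicator f x)
    (φ φ' : OrderFun p lam →L[ℚ_[p]] NormedH1 p N M)
    (hφ : ∀ f, (∀ x ∈ imageSet χ, f x = 0) → φ f = 0)
    (hφ' : ∀ f, (∀ x, x ∉ imageSet χ → f x = 0) → φ' f = φ f)
    {R : ℝ≥0} (hR : ∀ f, ‖φ' f‖ ≤ R * ‖f‖) :
    ∃ c : H1 ℚ_[p] N (GammaDist lam M χ),
      (∀ f, H1.integral lam M χ hN f c = normedH1Equiv p N M (φ f)) ∧
      H1.seminorm (fun ν : GammaDist lam M χ => distNorm (imageSet χ) ν.1) c ≤ (2 * R : ℝ≥0) ∧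
      H1.seminorm (fun ν : GammaDist lam M χ => distNorm Set.univ ν.1) c ≤
        (2 * R * ‖T‖₊ : ℝ≥0) := by
  let π : Cocycles p N M →L[ℚ_[p]] NormedH1 p N M :=
    LinearMap.mkContinuous (NormedH1.mk p N M) 1 fun z => by
      rw [one_mul]; exact NormedH1.norm_mk_le _
  -- The map lifted to cocycles is `φ'` and not `φ`: it agrees with `φ` on functions vanishing
  -- outside `Γ` and has the better norm.
  obtain ⟨ψ, hψ, hψ'⟩ := exists_lift π zero_le_two exists_norm_le_two_mul φ' R.2 hR
  have hTsupp : ∀ f, (∀ x ∈ imageSet χ, f x = 0) → T f = 0 := fun f hf => OrderFun.ext fun x => by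
    rw [hT, OrderFun.zero_apply]
    by_cases hx : x ∈ imageSet χ
    · rw [Set.indicator_of_mem hx, hf x hx]
    · rw [Set.indicator_of_notMem hx]
  have hTid : ∀ f, (∀ x, x ∉ imageSet χ → f x = 0) → T f = f := fun f hf => OrderFun.ext fun x => by
    rw [hT]
    by_cases hx : x ∈ imageSet χ
    · rw [Set.indicator_of_mem hx]
    · rw [Set.indicator_of_notMem hx, hf x hx]
  let ev : N → Cocycles p N M →L[ℚ_[p]] M := fun h =>
    { toFun := fun w => w.1 h
      map_add' := fun _ _ => rfl
      map_smul' := fun _ _ => rfl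
      cont := continuous_cocycle_eval h }
  -- Composition with `T` enforces support in `Γ`. It fixes functions vanishing outside `Γ`, so that
  -- only the norm on all functions acquires the factor `‖T‖`.
  let z₀ : N → GammaDist lam M χ := fun h =>
    ⟨(show OrderFun p lam →L[ℚ_[p]] M from (ev h).comp (ψ.comp T)), fun f hf => by
      change (ψ (T f)).1 h = 0
      rw [hTsupp f hf, map_zero]
      rfl⟩
  have hz₀ : ∀ h f, (z₀ h).1 f = (ψ (T f)).1 h := fun h f => rfl
  let z : Z1 ℚ_[p] N (GammaDist lam M χ) := ⟨z₀, (GammaDist.continuous_iff χ).2 fun f =>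
      (ψ (T f)).1.continuous, fun g h => GammaDist.ext fun f => by
        change (z₀ (g * h)).1 f = (z₀ g).1 f + (g • z₀ h).1 f
        rw [smul_gammaDist_apply hN, hz₀, hz₀, hz₀]
        exact (ψ (T f)).2 g h⟩
  refine ⟨(B1 ℚ_[p] N (GammaDist lam M χ)).mkQ z, fun f => ?_, ?_, ?_⟩
  · have h1 : φ f = φ' (T f) := by
      rw [hφ' (T f) fun x hx => by rw [hT, Set.indicator_of_notMem hx], ← sub_eq_zero, ← map_sub]
      refine hφ _ fun x hx => ?_
      rw [OrderFun.sub_apply, hT, Set.indicator_of_mem hx, sub_self]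
    rw [h1, ← hψ]
    rfl
  · refine iInf₂_le_of_le z rfl (iSup_le fun h => distNorm_le fun f hf => ?_)
    change ‖(ψ (T f)).1 h‖ ≤ _
    rw [hTid f hf]
    exact (norm_apply_le_norm_cocycle _ _).trans (hψ' f)
  · refine iInf₂_le_of_le z rfl (iSup_le fun h => distNorm_le fun f _ => ?_)
    change ‖(ψ (T f)).1 h‖ ≤ _
    refine (norm_apply_le_norm_cocycle _ _).trans ((hψ' _).trans ?_)
    calc 2 * (R : ℝ) * ‖T f‖ ≤ 2 * (R : ℝ) * (‖T‖ * ‖f‖) :=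
          mul_le_mul_of_nonneg_left (T.le_opNorm f) (mul_nonneg zero_le_two R.2)
      _ = _ := by
          push_cast
          ring

variable [N.Normal]

theorem H1.integral_conj (hN : N ≤ χ.ker) (f : OrderFun p lam) (g : G)
    (c : H1 ℚ_[p] N (GammaDist lam M χ)) :
    H1.integral lam M χ hN f (H1.conj (R := ℚ_[p]) (X := GammaDist lam M χ) N g c) =
      H1.conj (R := ℚ_[p]) (X := M) N g (H1.integral lam M χ hN (dilateL p lam (χ g)⁻¹.1 f) c) := by
  obtain ⟨z, rfl⟩ := (B1 ℚ_[p] N (GammaDist lam M χ)).mkQ_surjective c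
  rfl

end DistributionClasses

end PadicIwasawa

namespace PadicIwasawa

/-! ### The conductor of `Γ`. -/

section ImageSet

variable {p : ℕ} [Fact p.Prime] {G : Type*} [Group G] {χ : G →* ℤ_[p]ˣ}

theorem add_mul_pow_mem_imageSet {m : ℕ}
    (hΓ : ∀ s : ℤ_[p], ∃ g, (χ g : ℤ_[p]) = 1 + (p : ℤ_[p]) ^ m * s) (x y : ℤ_[p]) :
    x + y * (p : ℤ_[p]) ^ m ∈ imageSet χ ↔ x ∈ imageSet χ := by
  have key : ∀ x y : ℤ_[p], x ∈ imageSet χ → x + y * (p : ℤ_[p]) ^ m ∈ imageSet χ := by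
    rintro _ y ⟨g, rfl⟩
    obtain ⟨g', hg'⟩ := hΓ ((χ g)⁻¹.1 * y)
    refine ⟨g * g', ?_⟩
    have : (χ g : ℤ_[p]) * (χ g)⁻¹.1 = 1 := Units.mul_inv _
    change ((χ (g * g') : ℤ_[p]ˣ) : ℤ_[p]) = _
    rw [map_mul, Units.val_mul, hg']
    linear_combination ((p : ℤ_[p]) ^ m * y) * this
  refine ⟨fun h => ?_, key x y⟩
  have := key _ (-y) h
  rwa [neg_mul, add_neg_cancel_right] at this

theorem dvd_one_add_pow_sub {R : Type*} [CommRing R] (a : R) (k : ℕ) :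
    a ^ 2 ∣ (1 + a) ^ k - (1 + k * a) := by
  induction k with
  | zero => simp
  | succ k ih =>
    obtain ⟨c, hc⟩ := ih
    refine ⟨c * (1 + a) + k, ?_⟩
    rw [pow_succ, eq_add_of_sub_eq hc]
    push_cast
    ring

/-- If the image of `χ` meets `1 + p ^ m ℤ_p` outside `1 + p ^ (m + 1) ℤ_p`, and contains the
latter, it contains the former. -/
theorem exists_eq_one_add_of_not_dvd {m : ℕ} (hm : 1 ≤ m)
    (hΓ : ∀ s : ℤ_[p], ∃ g, (χ g : ℤ_[p]) = 1 + (p : ℤ_[p]) ^ (m + 1) * s) {t : ℤ_[p]}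
    (ht : ¬ (p : ℤ_[p]) ∣ t) {g₀ : G} (hg₀ : (χ g₀ : ℤ_[p]) = 1 + (p : ℤ_[p]) ^ m * t)
    (s : ℤ_[p]) : ∃ g, (χ g : ℤ_[p]) = 1 + (p : ℤ_[p]) ^ m * s := by
  have htu : IsUnit t := by
    rw [PadicInt.isUnit_iff]
    by_contra h
    exact ht ((PadicInt.norm_lt_one_iff_dvd t).1 (lt_of_le_of_ne (PadicInt.norm_le_one t) h))
  obtain ⟨t', ht'⟩ := htu.exists_right_inv
  -- With `k ≡ s / t` modulo `p`, the value `(1 + p ^ m t) ^ k` is `1 + p ^ m s` modulo `p ^ (m +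
  -- 1)`; the quadratic term is negligible because `m ≥ 1`.
  obtain ⟨k, hk⟩ : ∃ k : ℕ, (p : ℤ_[p]) ∣ s * t' - k := by
    refine ⟨(PadicInt.toZModPow 1 (s * t')).val, ?_⟩
    have := toZModPow_eq_iff_dvd (n := 1) (x := s * t')
      (y := (((PadicInt.toZModPow 1 (s * t')).val : ℕ) : ℤ_[p]))
    rw [toZModPow_val] at this
    simpa only [pow_one] using this.1 rfl
  obtain ⟨d, hd⟩ := hk
  obtain ⟨e, he⟩ := dvd_one_add_pow_sub ((p : ℤ_[p]) ^ m * t) k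
  have hmem : (χ (g₀ ^ k) : ℤ_[p]) ∈ imageSet χ := ⟨_, rfl⟩
  obtain ⟨r, hr⟩ : ∃ r : ℤ_[p], 1 + (p : ℤ_[p]) ^ m * s =
      (χ (g₀ ^ k) : ℤ_[p]) + r * (p : ℤ_[p]) ^ (m + 1) := by
    refine ⟨d * t - (p : ℤ_[p]) ^ (m - 1) * t ^ 2 * e, ?_⟩
    have h1 : (p : ℤ_[p]) ^ (m - 1) * (p : ℤ_[p]) ^ (m + 1) = ((p : ℤ_[p]) ^ m) ^ 2 := by
      rw [← pow_add, ← pow_mul]; congr 1; omega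
    rw [map_pow, Units.val_pow_eq_pow_val, hg₀, eq_add_of_sub_eq he]
    linear_combination (-(p : ℤ_[p]) ^ m * s) * ht' + ((p : ℤ_[p]) ^ m * t) * hd + (e * t ^ 2) * h1
  rw [hr]
  exact (add_mul_pow_mem_imageSet hΓ _ _).2 hmem

/-- The least `m` works: two values of `χ` differing by `p ^ (m - 1)` times a unit would put all of
`1 + p ^ (m - 1) ℤ_p` into the image, by `exists_eq_one_add_of_not_dvd`. That argument requires `m -
1 ≥ 1`, whence the first alternative. -/
theorem exists_conductor (hΓ : ∃ m : ℕ, ∀ s : ℤ_[p], ∃ g, (χ g : ℤ_[p]) = 1 + (p : ℤ_[p]) ^ m * s) :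
    ∃ m, (∀ s : ℤ_[p], ∃ g, (χ g : ℤ_[p]) = 1 + (p : ℤ_[p]) ^ m * s) ∧
      (m ≤ 1 ∨ ∀ x ∈ imageSet χ, ∀ t : ℤ_[p], ¬ (p : ℤ_[p]) ∣ t →
        x + (p : ℤ_[p]) ^ (m - 1) * t ∉ imageSet χ) := by
  classical
  refine ⟨Nat.find hΓ, Nat.find_spec hΓ, ?_⟩
  by_contra! hcon
  obtain ⟨h1, x, ⟨g, rfl⟩, t, ht, g', hg'⟩ := hcon
  obtain ⟨m, hm⟩ : ∃ m, Nat.find hΓ = m + 1 := ⟨Nat.find hΓ - 1, by omega⟩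
  have hspec := Nat.find_spec hΓ
  rw [hm] at hspec hg'
  rw [Nat.add_sub_cancel] at hg'
  refine Nat.find_min hΓ (m := m) (by omega) fun s => ?_
  refine exists_eq_one_add_of_not_dvd (by omega) hspec (t := (χ g)⁻¹.1 * t) ?_
    (g₀ := g⁻¹ * g') ?_ s
  · rwa [(Units.isUnit _).dvd_mul_left]
  · have h2 : (χ g)⁻¹.1 * (χ g : ℤ_[p]) = 1 := Units.inv_mul _
    have h3 : (χ g' : ℤ_[p]) = (χ g : ℤ_[p]) + (p : ℤ_[p]) ^ m * t := hg'
    rw [map_mul, map_inv, Units.val_mul, h3]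
    linear_combination h2

end ImageSet

/-! ### Uniqueness. -/

section Interpolation

variable {p : ℕ} [Fact p.Prime] {lam : ℝ} {G : Type*} [Group G] [TopologicalSpace G]
  [IsTopologicalGroup G] {N : Subgroup G} [N.Normal] {M : Type*}
  [NormedAddCommGroup M] [NormedSpace ℚ_[p] M] [DistribMulAction G M] [ContinuousSMul G M]
  [SMulCommClass G ℚ_[p] M] {χ : G →* ℤ_[p]ˣ}

theorem H1.conj_inv_conj (g : G) (c : H1 ℚ_[p] N M) :
    H1.conj (R := ℚ_[p]) (X := M) N g⁻¹ (H1.conj (R := ℚ_[p]) (X := M) N g c) = c := by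
  rw [← H1.conj_mul, inv_mul_cancel, H1.conj_one]

theorem integral_dilateL_ballPow_of_conj_eq [CompactSpace N] {h : ℕ} (hN : N ≤ χ.ker)
    {x : ℕ → ℕ → H1 ℚ_[p] N M} {ν : H1 ℚ_[p] N (GammaDist lam M χ)}
    (hν : ∀ g : G, H1.conj (R := ℚ_[p]) (X := GammaDist lam M χ) N g ν = ν)
    (hx : ∀ n, ∀ j ≤ h, H1.integral lam M χ hN (ballPow p lam n j) ν = x n j) (g : G) (n j : ℕ)
    (hj : j ≤ h) : H1.integral lam M χ hN (dilateL p lam (χ g)⁻¹.1 (ballPow p lam n j)) ν =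
      H1.conj (R := ℚ_[p]) (X := M) N g⁻¹ (x n j) := by
  have h1 := H1.integral_conj hN (ballPow p lam n j) g ν
  rw [hν, hx n j hj] at h1
  rw [h1, H1.conj_inv_conj]

/-- The difference of the classes gives a functional with values in `H^1(N, M)`, which vanishes by
density of locally polynomial functions; `H1.eq_zero_of_integral_eq_zero` then kills the class
itself. -/
theorem H1.eq_of_integral_dilateL_ballPow_eq [CompactSpace N] [CompleteSpace M]
    [IsUltrametricDist M] {h : ℕ} (hlam : 0 ≤ lam) (hh : lam < h + 1) (hN : N ≤ χ.ker)
    (hB : IsClosed (coboundaries p N M : Set (Cocycles p N M)))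
    {T : OrderFun p lam →L[ℚ_[p]] OrderFun p lam}
    (hT : ∀ f x, T f x = (imageSet χ).indicator f x)
    {c c' : H1 ℚ_[p] N (GammaDist lam M χ)}
    (hcc : ∀ g : G, ∀ n, ∀ j ≤ h,
      H1.integral lam M χ hN (dilateL p lam (χ g)⁻¹.1 (ballPow p lam n j)) c =
      H1.integral lam M χ hN (dilateL p lam (χ g)⁻¹.1 (ballPow p lam n j)) c') : c = c' := by
  rw [← sub_eq_zero]
  refine H1.eq_zero_of_integral_eq_zero hN hB hT fun f => ?_
  obtain ⟨z, hz⟩ := (B1 ℚ_[p] N (GammaDist lam M χ)).mkQ_surjective (c - c')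
  obtain ⟨L, hL⟩ := exists_integralCLM hN z
  let π : Cocycles p N M →L[ℚ_[p]] NormedH1 p N M :=
    LinearMap.mkContinuous (NormedH1.mk p N M) 1 fun z => by
      rw [one_mul]; exact NormedH1.norm_mk_le _
  have hπ : ∀ f, normedH1Equiv p N M (π (L f)) = H1.integral lam M χ hN f (c - c') := fun f => by
    rw [← hz, (hL f).1]
    rfl
  have h0 : π.comp L = 0 := by
    refine eq_zero_of_dilateL_ballPow_eq_zero hlam hh (χ := χ) (fun f hf => ?_) fun g n j hj => ?_
    · have : L f = 0 := Subtype.ext (ContinuousMap.ext fun n => ((hL f).2 n).trans ((z.1 n).2 f hf))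
      rw [ContinuousLinearMap.comp_apply, this, map_zero]
    · rw [ContinuousLinearMap.comp_apply, ← (normedH1Equiv p N M).map_eq_zero_iff, hπ, map_sub,
        hcc g n j hj, sub_self]
  rw [← hπ, ← ContinuousLinearMap.comp_apply, h0, ContinuousLinearMap.zero_apply, map_zero]

end Interpolation

/-! ### Existence and norm bounds. -/

section Existence

/-- Existence of the interpolating class, with bounds for its norms. -/
theorem exists_bounded_class (p : ℕ) [Fact p.Prime] {lam : ℝ} (hlam : 0 ≤ lam) {h : ℕ}
    (hh : lam < h + 1) :
    ∃ D : ℝ≥0, ∀ {G : Type u} [Group G] [TopologicalSpace G] [IsTopologicalGroup G]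
      {N : Subgroup G} [N.Normal] [CompactSpace N] {M : Type w} [NormedAddCommGroup M]
      [NormedSpace ℚ_[p] M] [CompleteSpace M] [IsUltrametricDist M] [DistribMulAction G M]
      [ContinuousSMul G M] [SMulCommClass G ℚ_[p] M] {χ : G →* ℤ_[p]ˣ} (hN : N ≤ χ.ker)
      (_ : IsClosed (coboundaries p N M : Set (Cocycles p N M)))
      (_ : ∃ m : ℕ, ∀ s : ℤ_[p], ∃ g, (χ g : ℤ_[p]) = 1 + (p : ℤ_[p]) ^ m * s)
      {T : OrderFun p lam →L[ℚ_[p]] OrderFun p lam}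
      (_ : ∀ f x, T f x = (imageSet χ).indicator f x)
      {x : ℕ → ℕ → H1 ℚ_[p] N M} {C B : ℝ≥0}
      (_ : ∀ n, ∀ j ≤ h, ∀ g ∈ levelKer χ n,
        H1.conj (R := ℚ_[p]) (X := M) N g (x n j) = ((χ g : ℤ_[p]) : ℚ_[p]) ^ j • x n j)
      (_ : ∀ n, ∀ j ≤ h, ∑ᶠ γ : levelKer χ n ⧸ (levelKer χ (n + 1)).subgroupOf (levelKer χ n),
        (((χ (γ.out : G) : ℤ_[p]) : ℚ_[p]) ^ j)⁻¹ •
          H1.conj (R := ℚ_[p]) (X := M) N (γ.out : G) (x (n + 1) j) = x n j)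
      (_ : ∀ n, H1.seminorm (fun m : M => ‖m‖ₑ) (((p : ℚ_[p]) ^ (h * n))⁻¹ •
        ∑ j ∈ Finset.range (h + 1), ((-1 : ℚ_[p]) ^ j * (h.choose j : ℚ_[p])) • x n j) ≤
          (C : ℝ≥0∞) * (p : ℝ≥0∞) ^ ⌊lam * n⌋₊)
      (_ : ∀ (g : G) (m : M), ‖g • m‖ ≤ B * ‖m‖),
      ∃ μ : H1 ℚ_[p] N (GammaDist lam M χ),
        (∀ g : G, ∀ n, ∀ j ≤ h,
          H1.integral lam M χ hN (dilateL p lam (χ g)⁻¹.1 (ballPow p lam n j)) μ =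
            H1.conj (R := ℚ_[p]) (X := M) N g⁻¹ (x n j)) ∧
        H1.seminorm (fun ν : GammaDist lam M χ => distNorm (imageSet χ) ν.1) μ ≤
          (D * C * B : ℝ≥0) ∧
        H1.seminorm (fun ν : GammaDist lam M χ => distNorm Set.univ ν.1) μ ≤
          (D * ‖T‖₊ * C * B : ℝ≥0) := by
  obtain ⟨D₁, hD₁, hball⟩ := exists_isBallSystem.{u, max u w} p h
  obtain ⟨E, hE, hext⟩ := exists_uniform_extension.{max u w} p hlam hh
  lift D₁ to ℝ≥0 using hD₁
  lift E to ℝ≥0 using hE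
  -- `D₁` comes from the ball system, `E` from the extension with norm independent of the conductor,
  -- and `2` from lifting classes to cocycles.
  refine ⟨2 * E * D₁, fun {G} _ _ _ {N} _ _ {M} _ _ _ _ _ _ _ {χ} hN hcl hΓ {T} hT {x C B}
    hx hcomp hgr hBM => ?_⟩
  obtain ⟨m₀, hm₀, hmin⟩ := exists_conductor hΓ
  set e := (normedH1Equiv p N M).symm with he
  set y : ℕ → ℕ → NormedH1 p N M := fun n j => e (x n j)
  have hconj : ∀ g c, normedConjRep p N M g (e c) =
      e (H1.conj (R := ℚ_[p]) (X := M) N g c) := fun g c => by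
    rw [normedConjRep_apply, he, LinearEquiv.apply_symm_apply]
  have hy : ∀ n, ∀ j ≤ h, ∀ g ∈ levelKer χ n,
      normedConjRep p N M g (y n j) = ((χ g : ℤ_[p]) : ℚ_[p]) ^ j • y n j := fun n j hj g hg => by
    rw [hconj, hx n j hj g hg, map_smul]
  have hycomp : ∀ n, ∀ j ≤ h,
      ∑ᶠ γ : levelKer χ n ⧸ (levelKer χ (n + 1)).subgroupOf (levelKer χ n),
        (((χ (γ.out : G) : ℤ_[p]) : ℚ_[p]) ^ j)⁻¹ •
          normedConjRep p N M (γ.out : G) (y (n + 1) j) = y n j := fun n j hj => by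
    simp only [y]
    rw [← hcomp n j hj, AddEquivClass.map_finsum e]
    exact finsum_congr fun γ => by rw [hconj, map_smul]
  have hygr : ∀ n, ‖((p : ℚ_[p]) ^ (h * n))⁻¹ • ∑ j ∈ Finset.range (h + 1),
      ((-1 : ℚ_[p]) ^ j * (h.choose j : ℚ_[p])) • y n j‖ ≤ C * (p : ℝ) ^ ⌊lam * n⌋₊ := fun n => by
    have h1 := norm_normedH1Equiv_symm_le (r := C * (p : ℝ≥0) ^ ⌊lam * n⌋₊)
      ((hgr n).trans_eq (by push_cast; rfl))
    rw [map_smul, map_sum] at h1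
    simp only [map_smul] at h1
    exact_mod_cast h1
  have hsys := hball (lam := lam) hy hycomp hygr B.2 C.2 (norm_normedConjRep_le B.2 hBM) hm₀
  set m := ballSystem χ (normedConjRep p N M) y h
  have hsupp : ∀ k, m₀ ≤ k → ∀ x, m k (PadicInt.toZModPow k x) ≠ 0 → x ∈ imageSet χ := by
    intro k hk x hmx
    by_contra hxn
    refine hmx (ballSystem_eq_zero ?_)
    rintro ⟨g, hg⟩
    obtain ⟨t, ht⟩ := toZModPow_eq_iff_dvd.1 hg.symm
    refine hxn ?_
    have h2 : x = (χ g : ℤ_[p]) + ((p : ℤ_[p]) ^ (k - m₀) * t) * (p : ℤ_[p]) ^ m₀ := by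
      have h3 : (p : ℤ_[p]) ^ (k - m₀) * (p : ℤ_[p]) ^ m₀ = (p : ℤ_[p]) ^ k := by
        rw [← pow_add, Nat.sub_add_cancel hk]
      linear_combination ht - t * h3
    rw [h2]
    exact (add_mul_pow_mem_imageSet hm₀ _ _).2 ⟨g, rfl⟩
  obtain ⟨φ, hφlim, hφclose, hφpoly⟩ := hsys.exists_distribution hlam hh
  obtain ⟨φ', hφ', hφφ'⟩ := hext hsys φ (fun f => hφclose f m₀ le_rfl) (imageSet χ)
    (hsupp m₀ le_rfl) hmin
  -- From level `m₀` on, balls meeting `Γ` lie in `Γ`, so the Riemann sums of a function vanishing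
  -- on `Γ` are zero.
  have hφsupp : ∀ f, (∀ x ∈ imageSet χ, f x = 0) → φ f = 0 := fun f hf => by
    refine tendsto_nhds_unique (hφlim f) (tendsto_const_nhds.congr' ?_)
    filter_upwards [eventually_ge_atTop m₀] with k hk
    have := hsys.norm_riemannSum_le hk (f := f) le_rfl fun x hx => by
      rw [hf x (hsupp k hk x hx), norm_zero]
    rw [mul_zero] at this
    exact (norm_le_zero_iff.1 this).symm
  have hφint : ∀ g : G, ∀ n, ∀ j ≤ h, φ (dilateL p lam (χ g)⁻¹.1 (ballPow p lam n j)) =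
      normedConjRep p N M g⁻¹ (y n j) := fun g n j hj => by
    have h1 : φ (monoBall lam n (PadicInt.toZModPow n (χ g : ℤ_[p])) j) =
        ((χ g : ℤ_[p]) : ℚ_[p]) ^ j • normedConjRep p N M g⁻¹ (y n j) := by
      rw [monoBall, hφpoly, Finset.sum_eq_single (PadicInt.toZModPow n (χ g : ℤ_[p]))]
      · rw [Pi.single_eq_same, show m n _ = _ from ballSystem_eq hy g, ballInt_apply, Finset.sum_eq_single j]
        · simp
        · intro i _ hij
          rw [Polynomial.coeff_X_pow, if_neg hij, zero_smul]
        · intro hj'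
          exact absurd (Finset.mem_range.2 (Nat.lt_succ_of_le hj)) hj'
      · intro a _ ha
        rw [Pi.single_eq_of_ne ha, map_zero]
      · exact fun hn => absurd (Finset.mem_univ _) hn
      · intro a
        by_cases ha : a = PadicInt.toZModPow n (χ g : ℤ_[p])
        · subst ha
          rw [Pi.single_eq_same, Polynomial.natDegree_X_pow]
          exact hj
        · rw [Pi.single_eq_of_ne ha, Polynomial.natDegree_zero]
          exact Nat.zero_le _
    rw [monoBall_eq_smul_dilateL, map_smul] at h1
    exact smul_right_injective _ (pow_ne_zero j (coe_unit_ne_zero (χ g))) h1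
  obtain ⟨μ, hμ, hμ₁, hμ₂⟩ := exists_class_of_distribution hN hT φ φ' hφsupp hφφ'
    (R := E * (D₁ * C * B)) (fun f => by exact_mod_cast hφ' f)
  refine ⟨μ, fun g n j hj => ?_, hμ₁.trans_eq ?_, hμ₂.trans_eq ?_⟩
  · rw [hμ, hφint g n j hj, hconj, he, LinearEquiv.apply_symm_apply]
  · congr 1
    ring
  · congr 1
    ring

/-- The interpolation theorem for a compact group with a character of open image. -/
theorem exists_unique_interpolating_class (p : ℕ) [Fact p.Prime] {lam : ℝ} (hlam : 0 ≤ lam)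
    {h : ℕ} (hh : lam < h + 1) :
    ∃ (D : ℝ≥0) (D' : Set ℤ_[p] → ℝ≥0), ∀ {G : Type u} [Group G] [TopologicalSpace G]
      [IsTopologicalGroup G] [CompactSpace G] {N : Subgroup G} [N.Normal] [CompactSpace N]
      {M : Type w} [NormedAddCommGroup M] [NormedSpace ℚ_[p] M] [CompleteSpace M]
      [IsUltrametricDist M] [DistribMulAction G M] [ContinuousSMul G M] [SMulCommClass G ℚ_[p] M]
      {χ : G →* ℤ_[p]ˣ} (hN : N ≤ χ.ker)
      (_ : IsClosed (coboundaries p N M : Set (Cocycles p N M)))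
      (_ : ∃ m : ℕ, ∀ s : ℤ_[p], ∃ g, (χ g : ℤ_[p]) = 1 + (p : ℤ_[p]) ^ m * s)
      {x : ℕ → ℕ → H1 ℚ_[p] N M} {C : ℝ≥0}
      (_ : ∀ n, ∀ j ≤ h, ∀ g ∈ levelKer χ n,
        H1.conj (R := ℚ_[p]) (X := M) N g (x n j) = ((χ g : ℤ_[p]) : ℚ_[p]) ^ j • x n j)
      (_ : ∀ n, ∀ j ≤ h, ∑ᶠ γ : levelKer χ n ⧸ (levelKer χ (n + 1)).subgroupOf (levelKer χ n),
        (((χ (γ.out : G) : ℤ_[p]) : ℚ_[p]) ^ j)⁻¹ •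
          H1.conj (R := ℚ_[p]) (X := M) N (γ.out : G) (x (n + 1) j) = x n j)
      (_ : ∀ n, H1.seminorm (fun m : M => ‖m‖ₑ) (((p : ℚ_[p]) ^ (h * n))⁻¹ •
        ∑ j ∈ Finset.range (h + 1), ((-1 : ℚ_[p]) ^ j * (h.choose j : ℚ_[p])) • x n j) ≤
          (C : ℝ≥0∞) * (p : ℝ≥0∞) ^ ⌊lam * n⌋₊),
      ∃ μ : H1 ℚ_[p] N (GammaDist lam M χ),
        ((∀ g : G, H1.conj (R := ℚ_[p]) (X := GammaDist lam M χ) N g μ = μ) ∧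
          ∀ n, ∀ j ≤ h, H1.integral lam M χ hN (ballPow p lam n j) μ = x n j) ∧
        (∀ ν : H1 ℚ_[p] N (GammaDist lam M χ),
          ((∀ g : G, H1.conj (R := ℚ_[p]) (X := GammaDist lam M χ) N g ν = ν) ∧
            ∀ n, ∀ j ≤ h, H1.integral lam M χ hN (ballPow p lam n j) ν = x n j) → ν = μ) ∧
        ∀ B : ℝ≥0, (∀ (g : G) (m : M), ‖g • m‖ ≤ B * ‖m‖) →
          H1.seminorm (fun ν : GammaDist lam M χ => distNorm (imageSet χ) ν.1) μ ≤
            (D * C * B : ℝ≥0) ∧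
          H1.seminorm (fun ν : GammaDist lam M χ => distNorm Set.univ ν.1) μ ≤
            (D' (imageSet χ) * C * B : ℝ≥0) := by
  classical
  obtain ⟨D, hD⟩ := exists_bounded_class.{u, w} p hlam hh
  -- The restriction operator is determined by the set `S`, so its norm may enter a constant
  -- depending on `Γ`; `0` is a default for sets without such an operator.
  refine ⟨D, fun S => if hS : ∃ T : OrderFun p lam →L[ℚ_[p]] OrderFun p lam,
    ∀ f x, T f x = S.indicator f x then D * ‖hS.choose‖₊ else 0, fun {G} _ _ _ _ {N} _ _ {M} _ _ _ _
    _ _ _ {χ} hN hcl hΓ {x C} hx hcomp hgr => ?_⟩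
  have hS : ∃ T : OrderFun p lam →L[ℚ_[p]] OrderFun p lam,
      ∀ f x, T f x = (imageSet χ).indicator f x := by
    obtain ⟨m, hm⟩ := hΓ
    exact exists_restrict hlam (add_mul_pow_mem_imageSet hm)
  beta_reduce
  rw [dif_pos hS]
  have hT := hS.choose_spec
  set T := hS.choose
  have hclass := fun (B : ℝ≥0) (hB : ∀ (g : G) (m : M), ‖g • m‖ ≤ B * ‖m‖) =>
    hD hN hcl hΓ hT hx hcomp hgr hB
  -- Orbits of the compact group are bounded, and Banach–Steinhaus makes the bound uniform.
  -- Existence and uniqueness thus presuppose no given `B`.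
  obtain ⟨B₀, hB₀⟩ : ∃ B : ℝ≥0, ∀ (g : G) (m : M), ‖g • m‖ ≤ B * ‖m‖ := by
    let a : G → M →L[ℚ_[p]] M := fun g =>
      { toFun := fun m => g • m
        map_add' := smul_add g
        map_smul' := fun c m => smul_comm g c m
        cont := continuous_const_smul g }
    obtain ⟨B, hB⟩ := banach_steinhaus (g := a) fun m => by
      obtain ⟨C, hC⟩ := (isCompact_range (f := fun g : G => g • m) (by fun_prop)).isBounded.exists_norm_le
      exact ⟨C, fun g => hC _ ⟨g, rfl⟩⟩
    have hB0 : 0 ≤ B := (norm_nonneg _).trans (hB 1)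
    exact ⟨⟨B, hB0⟩, fun g m => (a g).le_of_opNorm_le (hB g) m⟩
  obtain ⟨μ, hμ, -⟩ := hclass B₀ hB₀
  refine ⟨μ, ⟨fun g => ?_, fun n j hj => ?_⟩, fun ν hν => ?_, fun B hB => ?_⟩
  -- Invariance follows from uniqueness: `g μ` and `μ` have the same integrals over all translated
  -- balls.
  · refine H1.eq_of_integral_dilateL_ballPow_eq hlam hh hN hcl hT fun g' n j hj => ?_
    rw [H1.integral_conj, dilateL_dilateL, hμ g' n j hj]
    have h1 : (χ g')⁻¹.1 * (χ g)⁻¹.1 = (χ (g' * g))⁻¹.1 := by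
      rw [map_mul, mul_inv, Units.val_mul]
    rw [h1, hμ _ n j hj, ← H1.conj_mul, mul_inv_rev, mul_inv_cancel_left]
  · have := hμ 1 n j hj
    rwa [map_one, inv_one, inv_one, Units.val_one, dilateL_one, H1.conj_one] at this
  · refine H1.eq_of_integral_dilateL_ballPow_eq hlam hh hN hcl hT fun g n j hj => ?_
    rw [hμ g n j hj]
    exact integral_dilateL_ballPow_of_conj_eq hN hν.1 hν.2 g n j hj
  -- The class produced for this `B` could a priori differ from `μ`; uniqueness identifies them.
  · obtain ⟨μ', hμ', h1, h2⟩ := hclass B hB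
    have : μ = μ' := H1.eq_of_integral_dilateL_ballPow_eq hlam hh hN hcl hT fun g n j hj => by
      rw [hμ g n j hj, hμ' g n j hj]
    rw [this]
    exact ⟨h1, h2⟩

end Existence

end PadicIwasawa

namespace PadicIwasawa

/-! ### Openness of the image of the cyclotomic character. -/

section OpenImage

variable {p : ℕ} [Fact p.Prime]

/-- Elements close to `1` are `k`-th powers. -/
theorem exists_pow_eq_one_add {k : ℕ} (hk : k ≠ 0) :
    ∃ m : ℕ, ∀ s : ℤ_[p], ∃ u : ℤ_[p]ˣ, (u : ℤ_[p]) ^ k = 1 + (p : ℤ_[p]) ^ m * s := by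
  have hk0 : (0 : ℝ) < ‖(k : ℤ_[p])‖ ^ 2 :=
    pow_pos (norm_pos_iff.2 (Nat.cast_ne_zero.2 hk)) 2
  have hk1 : ‖(k : ℤ_[p])‖ ^ 2 ≤ 1 := pow_le_one₀ (norm_nonneg _) (PadicInt.norm_le_one _)
  -- Hensel's lemma for `X ^ k - (1 + p ^ m s)` at `1` requires `|p ^ m s| < |k| ^ 2`.
  obtain ⟨m, hm⟩ := exists_pow_lt_of_lt_one hk0 (PadicInt.norm_lt_one_iff_dvd _ |>.2 (dvd_refl (p : ℤ_[p])))
  refine ⟨m, fun s => ?_⟩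
  have hs : ‖(p : ℤ_[p]) ^ m * s‖ < ‖(k : ℤ_[p])‖ ^ 2 := by
    rw [norm_mul, norm_pow]
    exact (mul_le_of_le_one_right (by positivity) (PadicInt.norm_le_one s)).trans_lt hm
  set F : Polynomial ℤ_[p] := Polynomial.X ^ k - Polynomial.C (1 + (p : ℤ_[p]) ^ m * s)
  have h1 : Polynomial.aeval (1 : ℤ_[p]) F = -((p : ℤ_[p]) ^ m * s) := by
    simp [F]
  have h2 : Polynomial.aeval (1 : ℤ_[p]) (Polynomial.derivative F) = k := by
    simp only [F, Polynomial.derivative_sub, Polynomial.derivative_C, Polynomial.derivative_X_pow]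
    simp
  obtain ⟨z, hz, -⟩ := hensels_lemma (F := F) (a := (1 : ℤ_[p])) (by rw [h1, h2, norm_neg]; exact hs)
  have hzk : z ^ k = 1 + (p : ℤ_[p]) ^ m * s := by
    have : z ^ k - (1 + (p : ℤ_[p]) ^ m * s) = 0 := by simpa [F] using hz
    exact sub_eq_zero.1 this
  have hunit : IsUnit (1 + (p : ℤ_[p]) ^ m * s) := by
    rw [PadicInt.isUnit_iff]
    have : ‖(p : ℤ_[p]) ^ m * s‖ < ‖(1 : ℤ_[p])‖ := by
      rw [norm_one]; exact hs.trans_le hk1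
    rw [IsUltrametricDist.norm_add_eq_max_of_norm_ne_norm this.ne', max_eq_left this.le, norm_one]
  rw [← hzk, isUnit_pow_iff hk] at hunit
  exact ⟨hunit.unit, hzk⟩

/-- The image is compact, hence closed, so it contains all `k`-th powers of units as soon as it does
so modulo every `p ^ n`. These powers fill a neighbourhood of `1`. -/
theorem exists_eq_one_add_of_pow_mem {G : Type*} [Group G] [TopologicalSpace G] [CompactSpace G]
    {χ : G →* ℤ_[p]ˣ} (hχ : Continuous χ) {k : ℕ} (hk : k ≠ 0)
    (h : ∀ (a : ℤ_[p]ˣ) (n : ℕ), ∃ g, PadicInt.toZModPow n (χ g : ℤ_[p]) =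
      PadicInt.toZModPow n (a : ℤ_[p]) ^ k) :
    ∃ m : ℕ, ∀ s : ℤ_[p], ∃ g, (χ g : ℤ_[p]) = 1 + (p : ℤ_[p]) ^ m * s := by
  obtain ⟨m, hm⟩ := exists_pow_eq_one_add (p := p) hk
  refine ⟨m, fun s => ?_⟩
  obtain ⟨u, hu⟩ := hm s
  rw [← hu]
  have hclosed : IsClosed (imageSet χ) :=
    (isCompact_range (Units.continuous_val.comp hχ)).isClosed
  suffices (u : ℤ_[p]) ^ k ∈ imageSet χ from this
  rw [← hclosed.closure_eq, Metric.mem_closure_iff]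
  intro ε hε
  obtain ⟨n, hn⟩ := exists_pow_lt_of_lt_one hε
    (PadicInt.norm_lt_one_iff_dvd _ |>.2 (dvd_refl (p : ℤ_[p])))
  obtain ⟨g, hg⟩ := h u n
  refine ⟨_, ⟨g, rfl⟩, ?_⟩
  rw [← map_pow] at hg
  obtain ⟨t, ht⟩ := toZModPow_eq_iff_dvd.1 hg.symm
  rw [dist_eq_norm, ht, norm_mul, norm_pow]
  exact (mul_le_of_le_one_right (by positivity) (PadicInt.norm_le_one t)).trans_lt hn

end OpenImage

section CyclotomicDegree

variable {p : ℕ} [Fact p.Prime] {K Ω : Type*} [Field K] [Field Ω] [Algebra K Ω]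

/-- Irreducibility gives `F(ζ)` the degree `φ(n)` over `F`, and `F(ζ)` lies in `K(ζ)`. -/
theorem totient_le_natDegree_minpoly_mul (F : Type*) [Field F] [CharZero F] [Algebra F K]
    [FiniteDimensional F K] {n : ℕ} [NeZero n] {ζ : Ω} (hζ : IsPrimitiveRoot ζ n)
    (hirr : Irreducible (Polynomial.cyclotomic n F)) :
    n.totient ≤ (minpoly K ζ).natDegree * Module.finrank F K := by
  let _ : Algebra F Ω := ((algebraMap K Ω).comp (algebraMap F K)).toAlgebra
  have : IsScalarTower F K Ω := IsScalarTower.of_algebraMap_eq fun _ => rfl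
  have hint : IsIntegral K ζ := hζ.isIntegral (NeZero.pos n) |>.tower_top
  have : FiniteDimensional K (IntermediateField.adjoin K {ζ}) :=
    IntermediateField.adjoin.finiteDimensional hint
  have : FiniteDimensional F (IntermediateField.adjoin K {ζ}) := FiniteDimensional.trans F K _
  have : IsScalarTower F (IntermediateField.adjoin K {ζ}) Ω :=
    IsScalarTower.of_algebraMap_eq fun _ => rfl
  have : NeZero (n : F) := ⟨Nat.cast_ne_zero.2 (NeZero.ne n)⟩
  have h1 := hζ.minpoly_eq_cyclotomic_of_irreducible hirr
  have h2 : minpoly F (IntermediateField.AdjoinSimple.gen K ζ) = minpoly F ζ :=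
    (minpoly.algebraMap_eq (B' := Ω) (algebraMap (IntermediateField.adjoin K {ζ}) Ω).injective
      (IntermediateField.AdjoinSimple.gen K ζ)).symm
  have h3 := minpoly.natDegree_le (A := F) (IntermediateField.AdjoinSimple.gen K ζ)
  rwa [h2, ← h1, Polynomial.natDegree_cyclotomic, ← Module.finrank_mul_finrank F K, mul_comm,
    IntermediateField.adjoin.finrank hint] at h3

theorem cycChar_spec (hΩ : ∀ n, ∃ ζ : Ω, IsPrimitiveRoot ζ (p ^ n)) (g : Gal(Ω/K)) {n : ℕ} {ζ : Ω}
    (hζ : ζ ^ p ^ n = 1) :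
    g ζ = ζ ^ (PadicInt.toZModPow n (cycChar p K Ω g : ℤ_[p])).val := by
  have (i : ℕ) : HasEnoughRootsOfUnity Ω (p ^ i) := ⟨hΩ i, rootsOfUnity.isCyclic _ _⟩
  exact cyclotomicCharacter.spec p (MulSemiringAction.toRingAut Gal(Ω/K) Ω g) ζ hζ

/-- The conjugates of `ζ` are the `σ ζ`, and `σ ζ` depends only on `χ(σ)` modulo `p ^ n`. -/
theorem natDegree_minpoly_le_card_range [CharZero K] [Normal K Ω]
    (hΩ : ∀ n, ∃ ζ : Ω, IsPrimitiveRoot ζ (p ^ n)) {n : ℕ} {ζ : Ω} (hζ : IsPrimitiveRoot ζ (p ^ n)) :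
    (minpoly K ζ).natDegree ≤ Nat.card
      ((Units.map (PadicInt.toZModPow (p := p) n).toMonoidHom).comp (cycChar p K Ω)).range := by
  classical
  have hsep : (minpoly K ζ).Separable :=
    (minpoly.irreducible (Normal.isIntegral inferInstance ζ)).separable
  rw [← Polynomial.card_rootSet_eq_natDegree hsep (Normal.splits inferInstance ζ),
    ← Nat.card_eq_fintype_card]
  have hroot : ∀ y : (minpoly K ζ).rootSet Ω, ∃ σ : Gal(Ω/K), σ ζ = y := fun y =>
    minpoly.exists_algEquiv_of_root' (Normal.isIntegral inferInstance ζ).isAlgebraic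
      ((Polynomial.mem_rootSet.1 y.2).2)
  choose σ hσ using hroot
  have : Finite (ZMod (p ^ n))ˣ := by
    have : NeZero (p ^ n) := ⟨pow_ne_zero _ (Fact.out : p.Prime).ne_zero⟩
    infer_instance
  refine Nat.card_le_card_of_injective
    (fun y => (⟨_, ⟨σ y, rfl⟩⟩ : ((Units.map (PadicInt.toZModPow (p := p) n).toMonoidHom).comp
      (cycChar p K Ω)).range)) fun y y' hyy => Subtype.ext ?_
  have h1 : PadicInt.toZModPow n (cycChar p K Ω (σ y) : ℤ_[p]) =
      PadicInt.toZModPow n (cycChar p K Ω (σ y') : ℤ_[p]) :=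
    congrArg Units.val (congrArg Subtype.val hyy)
  rw [← hσ y, ← hσ y', cycChar_spec hΩ _ hζ.pow_eq_one, cycChar_spec hΩ _ hζ.pow_eq_one, h1]

/-- The cyclotomic character has open image. -/
theorem exists_cycChar_eq_one_add (F : Type*) [Field F] [CharZero F] [Algebra F K]
    [FiniteDimensional F K] [IsGalois K Ω] (hΩ : ∀ n, ∃ ζ : Ω, IsPrimitiveRoot ζ (p ^ n))
    (hirr : ∀ n, Irreducible (Polynomial.cyclotomic (p ^ n) F)) :
    ∃ m : ℕ, ∀ s : ℤ_[p], ∃ g, (cycChar p K Ω g : ℤ_[p]) = 1 + (p : ℤ_[p]) ^ m * s := by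
  have : CharZero K := charZero_of_injective_algebraMap (algebraMap F K).injective
  -- The index modulo `p ^ n` is at most `[K : F]`, hence divides its factorial: one exponent serves
  -- all `n`.
  refine exists_eq_one_add_of_pow_mem (cyclotomicCharacter.continuous p K Ω)
    (k := (Module.finrank F K).factorial) (Nat.factorial_ne_zero _) fun a n => ?_
  obtain ⟨ζ, hζ⟩ := hΩ n
  have hne : NeZero (p ^ n) := ⟨pow_ne_zero _ (Fact.out : p.Prime).ne_zero⟩
  set S := ((Units.map (PadicInt.toZModPow (p := p) n).toMonoidHom).comp (cycChar p K Ω)).range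
  have h1 := totient_le_natDegree_minpoly_mul F (K := K) hζ (hirr n)
  have h2 := natDegree_minpoly_le_card_range (K := K) hΩ hζ
  have h3 : S.index * Nat.card S = (p ^ n).totient := by
    rw [S.index_mul_card, Nat.card_eq_fintype_card, ZMod.card_units_eq_totient]
  have h4 : S.index ≤ Module.finrank F K := by
    have h5 : 0 < Nat.card S := Nat.card_pos
    refine Nat.le_of_mul_le_mul_right ?_ h5
    rw [h3, mul_comm]
    exact h1.trans (Nat.mul_le_mul_right _ h2)
  have h6 : S.index ∣ (Module.finrank F K).factorial :=
    Nat.dvd_factorial (Nat.pos_of_ne_zero S.index_ne_zero_of_finite) h4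
  obtain ⟨c, hc⟩ := h6
  have h7 : (Units.map (PadicInt.toZModPow (p := p) n).toMonoidHom a) ^
      (Module.finrank F K).factorial ∈ S := by
    rw [hc, pow_mul]
    exact S.pow_mem (S.pow_index_mem _) _
  obtain ⟨g, hg⟩ := h7
  exact ⟨g, congrArg Units.val hg⟩

end CyclotomicDegree

section Irreducibility

open Polynomial

/-- Eisenstein's criterion over `ℤ_p` after the shift `X ↦ X + 1`, followed by Gauss's lemma. -/
theorem irreducible_cyclotomic_prime_pow_padic (p : ℕ) [Fact p.Prime] (n : ℕ) :
    Irreducible (cyclotomic (p ^ n) ℚ_[p]) := by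
  rcases n with _ | n
  · rw [pow_zero, cyclotomic_one]
    simpa using irreducible_X_sub_C (1 : ℚ_[p])
  have hE := cyclotomic_prime_pow_comp_X_add_one_isEisensteinAt p n
  set f : ℤ_[p][X] := (cyclotomic (p ^ (n + 1)) ℤ_[p]).comp (X + 1) with hf
  have hfmap : f = ((cyclotomic (p ^ (n + 1)) ℤ).comp (X + 1)).map (Int.castRingHom ℤ_[p]) := by
    rw [hf, Polynomial.map_comp, map_cyclotomic]
    simp
  have hmonic : f.Monic := (cyclotomic.monic _ _).comp (monic_X_add_C 1)
    ((natDegree_X_add_C (1 : ℤ_[p])).trans_ne one_ne_zero)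
  have hdeg : f.natDegree = (p ^ (n + 1)).totient := by
    rw [hf, natDegree_comp, natDegree_cyclotomic]
    have : (X + 1 : ℤ_[p][X]).natDegree = 1 := natDegree_X_add_C 1
    rw [this, mul_one]
  have hpos : 0 < f.natDegree := by
    rw [hdeg, Nat.totient_pos]
    exact pow_pos (Fact.out : p.Prime).pos _
  have hprime : (Ideal.span {(p : ℤ_[p])}).IsPrime :=
    (Ideal.span_singleton_prime PadicInt.prime_p.ne_zero).2 PadicInt.prime_p
  have hfE : f.IsEisensteinAt (Ideal.span {(p : ℤ_[p])}) :=
    { leading := by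
        rw [hmonic.leadingCoeff]
        exact fun h => hprime.ne_top ((Ideal.eq_top_iff_one _).2 h)
      mem := fun {k} hk => by
        rw [hfmap, coeff_map]
        have h1 : ((cyclotomic (p ^ (n + 1)) ℤ).comp (X + 1)).coeff k ∈ Ideal.span {(p : ℤ)} := by
          refine hE.mem ?_
          have : ((cyclotomic (p ^ (n + 1)) ℤ).comp (X + 1)).natDegree =
              (p ^ (n + 1)).totient := by
            rw [natDegree_comp, natDegree_cyclotomic]
            have : (X + 1 : ℤ[X]).natDegree = 1 := natDegree_X_add_C 1
            rw [this, mul_one]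
          rwa [this, ← hdeg]
        rw [Ideal.mem_span_singleton] at h1 ⊢
        simpa using map_dvd (Int.castRingHom ℤ_[p]) h1
      notMem := by
        have h1 : f.coeff 0 = p := by
          rw [coeff_zero_eq_eval_zero, hf, eval_comp]
          simp
        rw [h1, Ideal.span_singleton_pow, Ideal.mem_span_singleton]
        intro h
        have h2 : (p : ℤ_[p]) * p ∣ p * 1 := by rwa [mul_one, ← sq]
        exact PadicInt.prime_p.not_unit (isUnit_of_dvd_one
          ((mul_dvd_mul_iff_left PadicInt.prime_p.ne_zero).1 h2)) }
  have hfirr : Irreducible f := hfE.irreducible hprime hmonic.isPrimitive hpos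
  have hirr : Irreducible (cyclotomic (p ^ (n + 1)) ℤ_[p]) := by
    have h1 : f = algEquivAevalXAddC (1 : ℤ_[p]) (cyclotomic (p ^ (n + 1)) ℤ_[p]) := by
      rw [hf, algEquivAevalXAddC_apply, aeval_def, comp, C_1]
      rfl
    rw [h1] at hfirr
    exact (MulEquiv.irreducible_iff (algEquivAevalXAddC (1 : ℤ_[p])).toRingEquiv.toMulEquiv).1 hfirr
  rw [(cyclotomic.monic _ _).irreducible_iff_irreducible_map_fraction_map (K := ℚ_[p]),
    map_cyclotomic] at hirr
  exact hirr

end Irreducibility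

end PadicIwasawa

namespace PadicIwasawa

/-! ### Roots of unity and normality of `K^S`. -/

section Unramified

theorem isUnramifiedIn_of_algEquiv {R A B : Type*} [CommRing R] [CommRing A] [CommRing B]
    [Algebra R A] [Algebra R B] (e : A ≃ₐ[R] B) {𝔭 : Ideal R}
    (h : Algebra.IsUnramifiedIn A 𝔭) : Algebra.IsUnramifiedIn B 𝔭 := by
  intro 𝔓 _ h𝔓
  have hlies : (𝔓.comap e.toRingEquiv.toRingHom).LiesOver 𝔭 := by
    refine ⟨?_⟩
    rw [h𝔓.over]
    ext x
    simp [Ideal.mem_comap, Ideal.under]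
  have := h (𝔓.comap e.toRingEquiv.toRingHom) inferInstance hlies
  exact Algebra.FormallyUnramified.of_equiv
    (Localization.localAlgEquiv (𝔓.comap e.toRingEquiv.toRingHom) 𝔓 e rfl)

open Polynomial in
/-- The extension generated by a root of unity of order prime to `v` is unramified at `v`. -/
theorem isUnramifiedIn_of_adjoin_root_of_unity {K L : Type*} [Field K] [NumberField K] [Field L]
    [NumberField L] [Algebra K L] {n : ℕ} (hn : n ≠ 0) {ζ : 𝓞 L} (hζ : ζ ^ n = 1)
    (hadj : Algebra.adjoin K {algebraMap (𝓞 L) L ζ} = ⊤) {v : Ideal (𝓞 K)}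
    (hv : (n : 𝓞 K) ∉ v) : Algebra.IsUnramifiedIn (𝓞 L) v := by
  intro P hP hPv
  -- The different contains `f'(ζ)` for the minimal polynomial `f` of `ζ`. As `f` divides `X ^ n -
  -- 1`, `f'(ζ)` divides `n ζ ^ (n - 1)`. A prime `P` dividing the different would therefore contain
  -- `n`.
  rw [← not_dvd_differentIdeal_iff]
  intro hdvd
  have h1 := aeval_derivative_mem_differentIdeal (𝓞 K) K L ζ hadj
  have h2 : aeval ζ (derivative (minpoly (𝓞 K) ζ)) ∈ P := Ideal.dvd_iff_le.1 hdvd h1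
  have hint : IsIntegral (𝓞 K) ζ := Algebra.IsIntegral.isIntegral ζ
  obtain ⟨q, hq⟩ : minpoly (𝓞 K) ζ ∣ X ^ n - 1 :=
    minpoly.isIntegrallyClosed_dvd hint (by simp [hζ])
  have h3 := congrArg (fun f => aeval ζ (derivative f)) hq
  simp only [derivative_mul, map_add, map_mul, minpoly.aeval, zero_mul, add_zero, derivative_sub,
    derivative_X_pow, derivative_one, map_sub, map_zero, sub_zero, aeval_C, map_pow, aeval_X,
    map_natCast] at h3
  have h4 : (n : 𝓞 L) ∈ P := by
    have h5 : (n : 𝓞 L) = ((n : 𝓞 L) * ζ ^ (n - 1)) * ζ := by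
      rw [mul_assoc, ← pow_succ, Nat.sub_add_cancel (Nat.pos_of_ne_zero hn), hζ, mul_one]
    rw [h5, h3]
    exact P.mul_mem_right _ (P.mul_mem_right _ h2)
  refine hv ?_
  rw [hPv.over]
  simpa [Ideal.under, Ideal.mem_comap] using h4

end Unramified

section MaximalUnramified

open IsDedekindDomain

variable {K : Type*} [Field K] [NumberField K] (S : Set (HeightOneSpectrum (𝓞 K)))

/-- A conjugate of a finite extension unramified outside `S` is isomorphic to it over `K`, hence
again of this kind. This yields normality of `K^S`. -/
theorem map_maxUnramified_le (σ : AlgebraicClosure K →ₐ[K] AlgebraicClosure K) :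
    (maxUnramified K S).map σ ≤ maxUnramified K S := by
  rw [IntermediateField.map_le_iff_le_comap]
  refine iSup₂_le fun L hL => ?_
  rw [← IntermediateField.map_le_iff_le_comap]
  have hfin := hL.1
  have : FiniteDimensional K (L.map σ) := (L.equivMap σ).toLinearEquiv.finiteDimensional
  refine le_iSup₂_of_le (L.map σ) ⟨this, fun v hv => ?_⟩ le_rfl
  exact isUnramifiedIn_of_algEquiv
    (NumberField.RingOfIntegers.mapAlgEquiv (L.equivMap σ)) (hL.2 v hv)

instance : Normal K (maxUnramified K S) :=
  IntermediateField.normal_iff_forall_map_le.2 (map_maxUnramified_le S)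

/-- `K(ζ)` is finite and unramified at every `v` not above `p`, and `S` contains the places above
`p`. -/
theorem mem_maxUnramified_of_pow_eq_one {p : ℕ} [Fact p.Prime]
    (hp : ∀ v : HeightOneSpectrum (𝓞 K), (p : 𝓞 K) ∈ v.asIdeal → v ∈ S) {n : ℕ}
    {ζ : AlgebraicClosure K} (hζ : ζ ^ p ^ n = 1) : ζ ∈ maxUnramified K S := by
  have hpn : p ^ n ≠ 0 := pow_ne_zero _ (Fact.out : p.Prime).ne_zero
  have hint : IsIntegral ℤ ζ := ⟨Polynomial.X ^ p ^ n - 1, Polynomial.monic_X_pow_sub_C 1 hpn, by simp [hζ]⟩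
  set L := IntermediateField.adjoin K {ζ}
  have hfin : FiniteDimensional K L := IntermediateField.adjoin.finiteDimensional hint.tower_top
  have : NumberField L := NumberField.of_module_finite K L
  let z : L := IntermediateField.AdjoinSimple.gen K ζ
  have hz : z ^ p ^ n = 1 := Subtype.ext (by simpa [z] using hζ)
  have hzint : IsIntegral ℤ z := ⟨Polynomial.X ^ p ^ n - 1, Polynomial.monic_X_pow_sub_C 1 hpn, by simp [hz]⟩
  let ζ' : 𝓞 L := ⟨z, hzint⟩
  have hadj : Algebra.adjoin K {algebraMap (𝓞 L) L ζ'} = ⊤ := by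
    have h1 := (IntermediateField.adjoin.powerBasis (hint.tower_top (A := K))).adjoin_gen_eq_top
    rwa [IntermediateField.adjoin.powerBasis_gen] at h1
  refine (le_iSup₂_of_le L ⟨hfin, fun v hv => ?_⟩ le_rfl :  L ≤ maxUnramified K S)
    (IntermediateField.mem_adjoin_simple_self K ζ)
  refine isUnramifiedIn_of_adjoin_root_of_unity hpn (ζ := ζ') (NumberField.RingOfIntegers.ext hz) hadj ?_
  intro hmem
  rw [Nat.cast_pow] at hmem
  exact hv (hp v (v.isPrime.mem_of_pow_mem _ hmem))

end MaximalUnramified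

section Setting

variable {p : ℕ} [Fact p.Prime] {K : Type*} [Field K]
  {Ω : IntermediateField K (AlgebraicClosure K)}

theorem GaloisSetting.isGalois (hΩ : GaloisSetting p K Ω) : IsGalois K Ω := by
  cases hΩ with
  | loc =>
    have : CharZero K := charZero_of_injective_algebraMap (algebraMap ℚ_[p] K).injective
    have : Normal K (⊤ : IntermediateField K (AlgebraicClosure K)) :=
      IntermediateField.normal_iff_forall_map_le.2 fun _ => le_top
    exact ⟨⟩
  | glob S hS hp => exact ⟨⟩

theorem exists_isPrimitiveRoot_of_mem {p : ℕ} [Fact p.Prime] {K : Type*} [Field K] [CharZero K]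
    {Ω : IntermediateField K (AlgebraicClosure K)}
    (h : ∀ (n : ℕ) (ζ : AlgebraicClosure K), ζ ^ p ^ n = 1 → ζ ∈ Ω) (n : ℕ) :
    ∃ ζ : Ω, IsPrimitiveRoot ζ (p ^ n) := by
  have : NeZero (p ^ n) := ⟨pow_ne_zero _ (Fact.out : p.Prime).ne_zero⟩
  have : NeZero ((p ^ n : ℕ) : K) := ⟨Nat.cast_ne_zero.2 (NeZero.ne _)⟩
  obtain ⟨ζ, hζ⟩ := HasEnoughRootsOfUnity.exists_primitiveRoot (AlgebraicClosure K) (p ^ n)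
  refine ⟨⟨ζ, h n ζ hζ.pow_eq_one⟩, ?_⟩
  exact IsPrimitiveRoot.of_map_of_injective (f := Ω.val) hζ Ω.val.injective

theorem GaloisSetting.exists_cycChar_eq_one_add (hΩ : GaloisSetting p K Ω) :
    ∃ m : ℕ, ∀ s : ℤ_[p], ∃ g, (cycChar p K Ω g : ℤ_[p]) = 1 + (p : ℤ_[p]) ^ m * s := by
  have := hΩ.isGalois
  cases hΩ with
  | loc =>
    have : CharZero K := charZero_of_injective_algebraMap (algebraMap ℚ_[p] K).injective
    exact PadicIwasawa.exists_cycChar_eq_one_add ℚ_[p]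
      (exists_isPrimitiveRoot_of_mem fun _ _ _ => IntermediateField.mem_top)
      (irreducible_cyclotomic_prime_pow_padic p)
  | glob S hS hp =>
    exact PadicIwasawa.exists_cycChar_eq_one_add ℚ
      (exists_isPrimitiveRoot_of_mem fun _ _ h => mem_maxUnramified_of_pow_eq_one S hp h)
      fun n => Polynomial.cyclotomic.irreducible_rat (pow_pos (Fact.out : p.Prime).pos n)

end Setting

end PadicIwasawa

theorem proposition2p3p3 (p : ℕ) [Fact p.Prime] (lam : ℝ) (hlam : 0 ≤ lam) (h : ℕ)
    (hh : ⌊lam⌋₊ ≤ h) :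
    ∃ (D : ℝ≥0) (D' : Subgroup ℤ_[p]ˣ → ℝ≥0),
      ∀ (K : Type u) [Field K] (Ω : IntermediateField K (AlgebraicClosure K)),
        GaloisSetting p K Ω →
      ∀ (A : Type v) [NormedCommRing A] [NormedAlgebra ℚ_[p] A] [IsUltrametricDist A]
        [CompleteSpace A] [IsNoetherianRing A]
        (M : Type w) [NormedAddCommGroup M] [NormedSpace ℚ_[p] M] [IsUltrametricDist M]
        [CompleteSpace M] [Module A M] [IsScalarTower ℚ_[p] A M] [IsBoundedSMul A M]
        [Module.Finite A M] [Module.Free A M]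
        [DistribMulAction Gal(Ω/K) M] [ContinuousSMul Gal(Ω/K) M] [SMulCommClass Gal(Ω/K) A M]
        [SMulCommClass Gal(Ω/K) ℚ_[p] M]
        (x : ℕ → ℕ → H1 ℚ_[p] (galInf p K Ω) M) (C : ℝ≥0),
        -- `x n j` lies in the part of `H^1(K_∞, M)` on which `Γ_n` acts by `χ ^ j`
        (∀ n, ∀ j ≤ h, ∀ g ∈ levelSubgroup p K Ω n,
          H1.conj (R := ℚ_[p]) (X := M) (galInf p K Ω) g (x n j) = ((cycChar p K Ω g : ℤ_[p]) : ℚ_[p]) ^ j • x n j) →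
        -- norm-compatibility (the terms do not depend on the choice of representatives)
        (∀ n, ∀ j ≤ h,
          ∑ᶠ γ : levelSubgroup p K Ω n ⧸
              (levelSubgroup p K Ω (n + 1)).subgroupOf (levelSubgroup p K Ω n),
            (((cycChar p K Ω (γ.out : Gal(Ω/K)) : ℤ_[p]) : ℚ_[p]) ^ j)⁻¹ •
              H1.conj (R := ℚ_[p]) (X := M) (galInf p K Ω) (γ.out : Gal(Ω/K)) (x (n + 1) j) = x n j) →
        -- growth bound
        (∀ n, H1.seminorm (fun m : M => ‖m‖ₑ)
            (((p : ℚ_[p]) ^ (h * n))⁻¹ •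
              ∑ j ∈ Finset.range (h + 1), ((-1 : ℚ_[p]) ^ j * (h.choose j : ℚ_[p])) • x n j) ≤
          (C : ℝ≥0∞) * (p : ℝ≥0∞) ^ ⌊lam * n⌋₊) →
        ∃ μ : H1 ℚ_[p] (galInf p K Ω) (GammaDist lam M (cycChar p K Ω)),
          Interpolates lam h x μ ∧
          (∀ ν : H1 ℚ_[p] (galInf p K Ω) (GammaDist lam M (cycChar p K Ω)),
            Interpolates lam h x ν → ν = μ) ∧
          ∀ B : ℝ≥0, (∀ (g : Gal(Ω/K)) (m : M), ‖g • m‖ ≤ B * ‖m‖) →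
            H1.seminorm (fun ν : GammaDist lam M (cycChar p K Ω) =>
              distNorm (imageSet (cycChar p K Ω)) ν.1) μ ≤ (D * C * B : ℝ≥0) ∧
            H1.seminorm (fun ν : GammaDist lam M (cycChar p K Ω) =>
              distNorm Set.univ ν.1) μ ≤ (D' (cycChar p K Ω).range * C * B : ℝ≥0) := by
  -- The hypothesis on `h` enters only as `lam < h + 1`.
  have hh' : lam < h + 1 := (Nat.lt_floor_add_one lam).trans_le (by exact_mod_cast Nat.succ_le_succ hh)
  obtain ⟨D, D', hD⟩ := exists_unique_interpolating_class.{u, w} p hlam hh'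
  refine ⟨D, fun Γ => D' ((fun a : ℤ_[p]ˣ => (a : ℤ_[p])) '' Γ), ?_⟩
  intro K _ Ω hΩ A _ _ _ _ _ M _ _ _ _ _ _ _ _ _ _ _ _ _ x C hx hcomp hgr
  have := hΩ.isGalois
  have hN : IsClosed (galInf p K Ω : Set Gal(Ω/K)) :=
    InfiniteGalois.fixingSubgroup_isClosed (cycTower p K Ω)
  have : CompactSpace (galInf p K Ω) := isCompact_iff_compactSpace.1 hN.isCompact
  have hS : imageSet (cycChar p K Ω) =
      (fun a : ℤ_[p]ˣ => (a : ℤ_[p])) '' ((cycChar p K Ω).range : Set ℤ_[p]ˣ) := by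
    rw [MonoidHom.coe_range, ← Set.range_comp]
    rfl
  obtain ⟨μ, h1, h2, h3⟩ := hD (galInf_le_ker p K Ω)
    (isClosed_coboundaries (H := galInf p K Ω) (M := M) A) hΩ.exists_cycChar_eq_one_add hx hcomp hgr
  exact ⟨μ, h1, h2, fun B hB => (h3 B hB).imp_right fun h => h.trans_eq (by beta_reduce; rw [hS])⟩
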